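/- Let $d\ge 0$ be an integer, $\mathbb T^d=\mathbb R^d/\mathbb Z^d$, and let $q\in L^\infty([0,1];\mathbb R^d)$. Let $K$ be the set of all $Y\in L^2([0,1]\times\mathbb T^d)$ such that $\partial_aY\ge0$ in the sense of distributions on $]0,1[\times\mathbb T^d$, where $(a,x)$ denotes the points of $[0,1]\times\mathbb T^d$. For $Y_0\in K$ and $q_0\in L^2([0,1])$, a function $Y:[0,\infty[\,\to L^2([0,1]\times\mathbb T^d)$ is called a solution of $$q_0(a)\in\partial_tY+q(a)\cdot\nabla_xY+\partial K(Y)$$ with initial value $Y_0$ and left-hand side $q_0$ if (1) $t\mapsto Y(t,\cdot)$ is continuous from $[0,\infty[$ to $L^2$ and valued in $K$, with $Y(0,\cdot)=Y_0$; and (2) for each smooth real function $Z(t,a,x)$ on $[0,\infty[\times[0,1]\times\mathbb T^d$ with $\partial_aZ\ge0$, $$\frac{d}{dt}\int|Y-Z|^2\,da\,dx\le2\int(Y-Z)\,(q_0(a)-\partial_tZ-q(a)\cdot\nabla_xZ)\,da\,dx$$ in the sense of distributions in $t\in\,]0,\infty[$. Then the following hold. (i) For each $Y_0\in K$ and $q_0\in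 L^2([0,1])$ there is a unique solution $Y$ with initial value $Y_0$ and left-hand side $q_0$. (ii) If $Y_0$ and $q_0$ both belong to $L^\infty$, then for all $t\ge0$, almost everywhere in $[0,1]\times\mathbb T^d$, $$-t\sup(-q_0)_++\inf Y_0\le Y(t,\cdot)\le\sup Y_0+t\sup(q_0)_+,$$ where $r_+=\max(r,0)$ and $\sup$, $\inf$ are the essential supremum and infimum. (iii) If $\nabla_xY_0$ (in the sense of distributions) belongs to $L^2$, then so do $\partial_tY(t,\cdot)$ and $\nabla_xY(t,\cdot)$ for all $t\ge0$. Here $\partial_tY$ is meant as follows: at every $t\ge0$ the right derivative $V(t)=\lim_{h\downarrow0}(Y(t+h,\cdot)-Y(t,\cdot))/h$ exists in $L^2$, and $V$ is also the distributional time derivative of $Y$, that is, $V$ is integrable on bounded intervals with values in $L^2$ and $Y(t,\cdot)=Y_0+\int_0^tV(s)\,ds$ for all $t\ge0$. (iv) Let $Y$ and $\tilde Y$ be solutions with initial values $Y_0,\tilde Y_0\in K$ and left-hand sides $q_0,\tilde q_0\in L^2([0,1])$. Then for all $t\ge0$ $$\|Y(t,\cdot)-\tilde Y(t,\cdot)\|_{L^2}\le\|Y_0-\tilde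 Y_0\|_{L^2}+t\,\|q_0-\tilde q_0\|_{L^2},$$ and for each $p\in[1,\infty]$ such that $Y_0-\tilde Y_0$ and $q_0-\tilde q_0$ belong to $L^p$, also $Y(t,\cdot)-\tilde Y(t,\cdot)\in L^p$ and $$\|Y(t,\cdot)-\tilde Y(t,\cdot)\|_{L^p}\le\|Y_0-\tilde Y_0\|_{L^p}+t\,\|q_0-\tilde q_0\|_{L^p}.$$ -/

import Mathlib

open MeasureTheory

namespace LevelSet

noncomputable section

open scoped ContDiff

/-- The domain `[0,1] × 𝕋ᵈ`, with points `z = (a, x)`; it carries the product of the Lebesgue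
measures, which is a probability measure. -/
abbrev Dom (d : ℕ) : Type := unitInterval × UnitAddTorus (Fin d)

/-- The Hilbert space `L²([0,1] × 𝕋ᵈ)`. -/
abbrev L2 (d : ℕ) : Type := Lp ℝ 2 (volume : Measure (Dom d))

/-- The quotient map `ℝᵈ → 𝕋ᵈ = ℝᵈ / ℤᵈ`. -/
def toTorus {d : ℕ} (x : Fin d → ℝ) : UnitAddTorus (Fin d) := fun i => (x i : UnitAddCircle)

/-- The partial derivative `∂f/∂xᵢ` of a function on the torus `𝕋ᵈ`. -/
def torusDeriv {d : ℕ} (i : Fin d) (f : UnitAddTorus (Fin d) → ℝ) (x : UnitAddTorus (Fin d)) : ℝ :=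
  deriv (fun s : ℝ => f (x + Pi.single i (s : UnitAddCircle))) 0

/-- Smooth functions `φ(a, x)` with compact support in `]0,1[ × 𝕋ᵈ`: the test functions of
the theory of distributions. -/
structure IsTestFunction {d : ℕ} (φ : ℝ → UnitAddTorus (Fin d) → ℝ) : Prop where
  smooth : ContDiff ℝ ∞ (fun p : ℝ × (Fin d → ℝ) => φ p.1 (toTorus p.2))
  compact_support : HasCompactSupport (Function.uncurry φ)
  support_subset : tsupport (Function.uncurry φ) ⊆ Set.Ioo 0 1 ×ˢ Set.univ

/-- The cone `K` of all `Y ∈ L²([0,1] × 𝕋ᵈ)` such that `∂ₐ Y ≥ 0` in the sense of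
distributions. -/
def K (d : ℕ) : Set (L2 d) :=
  {Y | ∀ φ : ℝ → UnitAddTorus (Fin d) → ℝ, IsTestFunction φ → (∀ a x, 0 ≤ φ a x) →
    ∫ z : Dom d, Y z * deriv (fun b => φ b z.2) (z.1 : ℝ) ≤ 0}

/-- `∂Y/∂xᵢ = G` in the sense of distributions. -/
def HasWeakDeriv {d : ℕ} (i : Fin d) (Y G : L2 d) : Prop :=
  ∀ φ : ℝ → UnitAddTorus (Fin d) → ℝ, IsTestFunction φ →
    ∫ z : Dom d, Y z * torusDeriv i (φ z.1) z.2 = - ∫ z : Dom d, G z * φ z.1 z.2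

/-- `∇ₓ Y` (in the sense of distributions) belongs to `L²`. -/
def GradInL2 {d : ℕ} (Y : L2 d) : Prop :=
  ∀ i : Fin d, ∃ G : L2 d, HasWeakDeriv i Y G

/-- `∂ₜ Y = V` on `[0, ∞[` as functions of `t` with values in `L²`: `V t` is the right derivative
of `Y` in `L²` at *every* time `t ≥ 0`, and `V` is also the distributional time derivative
of `Y`, that is, `V` is locally integrable and `Y` is an antiderivative of it. -/
structure HasTimeDeriv {d : ℕ} (Y V : ℝ → L2 d) : Prop where
  right_deriv : ∀ t, 0 ≤ t → HasDerivWithinAt Y (V t) (Set.Ici t) t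
  integrable : ∀ t, 0 ≤ t → IntervalIntegrable V volume 0 t
  integral_eq : ∀ t, 0 ≤ t → Y t = Y 0 + ∫ s in (0 : ℝ)..t, V s

/-- The smooth functions `Z(t, a, x)`, `t ≥ 0`, `a ∈ [0,1]`, `x ∈ 𝕋ᵈ`, with `∂ₐ Z ≥ 0`. -/
structure IsMonotoneSmooth {d : ℕ} (Z : ℝ → ℝ → UnitAddTorus (Fin d) → ℝ) : Prop where
  smooth : ContDiff ℝ ∞ (fun p : ℝ × ℝ × (Fin d → ℝ) => Z p.1 p.2.1 (toTorus p.2.2))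
  deriv_nonneg : ∀ t, 0 ≤ t → ∀ a ∈ Set.Icc (0 : ℝ) 1, ∀ x, 0 ≤ deriv (fun b => Z t b x) a

/-- `Y` is a solution on `[0, ∞[` of `q₀(a) ∈ ∂ₜ Y + q(a) ⬝ ∇ₓ Y + ∂K(Y)` with initial value `Y₀`.
The field `semi_integral` says that
`d/dt ∫ |Y - Z|² da dx ≤ 2 ∫ (Y - Z) (q₀(a) - ∂ₜ Z - q(a) ⬝ ∇ₓ Z) da dx`
in the sense of distributions on `]0, ∞[`. -/
structure IsSolution {d : ℕ} (q : unitInterval → Fin d → ℝ)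
    (q₀ : Lp ℝ 2 (volume : Measure unitInterval)) (Y₀ : L2 d) (Y : ℝ → L2 d) : Prop where
  continuous : ContinuousOn Y (Set.Ici 0)
  mem_K : ∀ t, 0 ≤ t → Y t ∈ K d
  initial : Y 0 = Y₀
  semi_integral : ∀ Z : ℝ → ℝ → UnitAddTorus (Fin d) → ℝ, IsMonotoneSmooth Z →
    ∀ θ : ℝ → ℝ, ContDiff ℝ ∞ θ → HasCompactSupport θ → tsupport θ ⊆ Set.Ioi 0 →
    (∀ t, 0 ≤ θ t) →
    - ∫ t in Set.Ioi (0 : ℝ), deriv θ t * ∫ z : Dom d, |Y t z - Z t z.1 z.2| ^ 2 ≤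
      ∫ t in Set.Ioi (0 : ℝ), θ t * (2 * ∫ z : Dom d, (Y t z - Z t z.1 z.2) *
        (q₀ z.1 - deriv (fun s => Z s z.1 z.2) t
          - ∑ i, q z.1 i * torusDeriv i (Z t z.1) z.2))

end

end LevelSet

open LevelSet

namespace LevelSet
noncomputable section
open scoped ContDiff Topology
open Set Filter

/-- A Gronwall estimate: if the upper right derivative of `φ ≥ 0` is at most `2 m √φ`, then `√φ`
grows at most with slope `m`. -/
theorem sqrt_le_of_slope_le {φ : ℝ → ℝ} {a b m : ℝ} (hab : a ≤ b) (hm : 0 ≤ m)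
    (hφ : ContinuousOn φ (Icc a b)) (h0 : ∀ t, 0 ≤ φ t)
    (h : ∀ s ∈ Ico a b, ∀ ε > 0, ∀ᶠ t in 𝓝[>] s, φ t - φ s ≤ (t - s) * (2 * m * √(φ s) + ε)) :
    √(φ b) ≤ √(φ a) + m * (b - a) := by
  have key : ∀ δ > 0, √(φ b) ≤ √(φ a) + δ + (m + δ) * (b - a) := by
    intro δ hδ
    have hpos : ∀ t ∈ Icc a b, 0 < √(φ a) + δ + (m + δ) * (t - a) := by
      intro t ht
      have := mul_nonneg (add_nonneg hm hδ.le) (sub_nonneg.2 ht.1)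
      have := Real.sqrt_nonneg (φ a)
      linarith
    have := image_le_of_liminf_slope_right_lt_deriv_boundary (f := φ)
      (f' := fun s => 2 * m * √(φ s)) (a := a) (b := b) hφ
      (fun x hx r hr => by
        have hev := h x hx ((r - 2 * m * √(φ x)) / 2) (by linarith)
        refine (Eventually.frequently ?_)
        filter_upwards [hev, self_mem_nhdsWithin] with z hz hxz
        rw [slope_def_field, div_lt_iff₀ (sub_pos.2 hxz)]
        have : 0 < z - x := sub_pos.2 hxz
        nlinarith)
      (B := fun t => (√(φ a) + δ + (m + δ) * (t - a)) ^ 2)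
      (B' := fun t => 2 * (√(φ a) + δ + (m + δ) * (t - a)) * (m + δ))
      (by
        have h1 := Real.sq_sqrt (h0 a)
        have h2 := Real.sqrt_nonneg (φ a)
        simp only [sub_self, mul_zero, add_zero]
        nlinarith)
      (fun x => by
        have h1 : HasDerivAt (fun t => √(φ a) + δ + (m + δ) * (t - a)) (m + δ) x := by
          simpa using (((hasDerivAt_id x).sub_const a).const_mul (m + δ)).const_add (√(φ a) + δ)
        have h2 := h1.fun_pow 2
        simpa using h2)
      (fun x hx hxB => by
        have hp := hpos x ⟨hx.1, hx.2.le⟩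
        rw [hxB, Real.sqrt_sq hp.le]
        nlinarith)
      (right_mem_Icc.2 hab)
    exact Real.sqrt_le_iff.2 ⟨(hpos b (right_mem_Icc.2 hab)).le, this⟩
  refine le_of_forall_pos_le_add fun ε hε => ?_
  have hb : 0 < 1 + (b - a) := by linarith
  have := key (ε / (1 + (b - a))) (by positivity)
  have h2 : ε / (1 + (b - a)) * (1 + (b - a)) = ε := by field_simp
  nlinarith

/-- A function whose upper right derivative is at most `ψ` grows at most like the integral of
`ψ`. -/
theorem sub_le_integral_of_slope_le {φ ψ : ℝ → ℝ} {a b : ℝ} (hab : a ≤ b)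
    (hφ : ContinuousOn φ (Icc a b)) (hψ : Continuous ψ)
    (h : ∀ s ∈ Ico a b, ∀ ε > 0, ∀ᶠ t in 𝓝[>] s, φ t - φ s ≤ (t - s) * (ψ s + ε)) :
    φ b - φ a ≤ ∫ t in a..b, ψ t := by
  have key : ∀ δ > 0, φ b ≤ φ a + (∫ t in a..b, ψ t) + δ * (b - a) := by
    intro δ hδ
    refine image_le_of_liminf_slope_right_lt_deriv_boundary (f := φ)
      (f' := ψ) (a := a) (b := b) hφ
      (fun x hx r hr => by
        have hev := h x hx ((r - ψ x) / 2) (by linarith)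
        refine (Eventually.frequently ?_)
        filter_upwards [hev, self_mem_nhdsWithin] with z hz hxz
        rw [slope_def_field, div_lt_iff₀ (sub_pos.2 hxz)]
        have : 0 < z - x := sub_pos.2 hxz
        nlinarith)
      (B := fun t => φ a + (∫ s in a..t, ψ s) + δ * (t - a))
      (B' := fun t => ψ t + δ)
      (by simp)
      (fun x => by
        have h1 := (intervalIntegral.integral_hasDerivAt_right (hψ.intervalIntegrable a x)
          (hψ.stronglyMeasurableAtFilter _ _) hψ.continuousAt).const_add (φ a)
        have h2 : HasDerivAt (fun t => δ * (t - a)) δ x := by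
          simpa using ((hasDerivAt_id x).sub_const a).const_mul δ
        exact h1.add h2)
      (fun x hx hxB => by linarith)
      (right_mem_Icc.2 hab)
  refine le_of_forall_pos_le_add fun ε hε => ?_
  have hb : 0 < 1 + (b - a) := by linarith
  have := key (ε / (1 + (b - a))) (by positivity)
  have h2 : ε / (1 + (b - a)) * (1 + (b - a)) = ε := by field_simp
  have h3 : 0 < ε / (1 + (b - a)) := by positivity
  nlinarith

/-- A nondecreasing function has a nonnegative distributional derivative. -/
theorem integral_deriv_mul_nonpos {F θ : ℝ → ℝ} (hF : Continuous F) (hmono : Monotone F)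
    (hθ : ContDiff ℝ ∞ θ) (hc : HasCompactSupport θ) (h0 : ∀ t, 0 ≤ θ t) :
    ∫ t, deriv θ t * F t ≤ 0 := by
  obtain ⟨C, hC⟩ := ContDiff.lipschitzWith_of_hasCompactSupport hc hθ (by simp)
  obtain ⟨R, hR⟩ := hc.isCompact.isBounded.subset_closedBall (0 : ℝ)
  have hzero : ∀ t, t ∉ Icc (-R) R → θ t = 0 := by
    intro t ht
    by_contra hne
    have := hR (subset_tsupport _ hne)
    rw [Real.closedBall_eq_Icc] at this
    simp only [zero_sub, zero_add] at this
    exact ht this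
  set u : ℕ → ℝ := fun n => 1 / ((n : ℝ) + 1) with hu
  have hu0 : ∀ n, 0 < u n := fun n => by positivity
  have hu1 : ∀ n, u n ≤ 1 := fun n => by
    rw [hu, div_le_one (by positivity)]; linarith [Nat.cast_nonneg (α := ℝ) n]
  have hut : Tendsto u atTop (𝓝[≠] 0) := by
    refine tendsto_nhdsWithin_iff.2 ⟨tendsto_one_div_add_atTop_nhds_zero_nat, ?_⟩
    exact Eventually.of_forall fun n => (hu0 n).ne'
  have hcont := hθ.continuous
  have hInt : ∀ c, Integrable (fun t => θ (t + c) * F t) := by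
    intro c
    refine Continuous.integrable_of_hasCompactSupport (by fun_prop) ?_
    exact (hc.comp_homeomorph (Homeomorph.addRight c)).mul_right
  have hlim : Tendsto (fun n => ∫ t, (u n)⁻¹ * (θ (t + u n) - θ t) * F t) atTop
      (𝓝 (∫ t, deriv θ t * F t)) := by
    refine tendsto_integral_of_dominated_convergence
      (fun t => (Icc (-R - 1) (R + 1)).indicator (fun t => C * |F t|) t) ?_ ?_ ?_ ?_
    · intro n; exact Continuous.aestronglyMeasurable (by fun_prop)
    · rw [integrable_indicator_iff measurableSet_Icc]
      exact (Continuous.continuousOn (by fun_prop)).integrableOn_compact isCompact_Icc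
    · intro n
      refine Eventually.of_forall fun t => ?_
      by_cases ht : t ∈ Icc (-R - 1) (R + 1)
      · rw [indicator_of_mem ht, norm_mul, Real.norm_eq_abs, Real.norm_eq_abs]
        refine mul_le_mul_of_nonneg_right ?_ (abs_nonneg _)
        have := hC.dist_le_mul (t + u n) t
        rw [Real.dist_eq, Real.dist_eq, add_sub_cancel_left, abs_of_pos (hu0 n)] at this
        rw [abs_mul, abs_of_pos (inv_pos.2 (hu0 n)), inv_mul_le_iff₀ (hu0 n)]
        linarith
      · rw [indicator_of_notMem ht, hzero t, hzero (t + u n)]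
        · simp
        · intro h; apply ht; constructor <;> linarith [h.1, h.2, hu0 n, hu1 n]
        · intro h; apply ht; constructor <;> linarith [h.1, h.2]
    · refine Eventually.of_forall fun t => ?_
      have hd : HasDerivAt θ (deriv θ t) t :=
        (hθ.differentiable (by simp)).differentiableAt.hasDerivAt
      have := (hasDerivAt_iff_tendsto_slope_zero.1 hd).comp hut
      simpa [smul_eq_mul] using this.mul_const (F t)
  refine le_of_tendsto hlim (Eventually.of_forall fun n => ?_)
  have e1 : ∫ t, (u n)⁻¹ * (θ (t + u n) - θ t) * F t
      = (u n)⁻¹ * ((∫ t, θ (t + u n) * F t) - ∫ t, θ t * F t) := by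
    rw [← integral_sub (hInt _) (by simpa using hInt 0), ← integral_const_mul]
    congr 1; ext t; ring
  have e2 : ∫ t, θ (t + u n) * F t = ∫ t, θ t * F (t - u n) := by
    rw [← integral_add_right_eq_self (fun t => θ t * F (t - u n)) (u n)]
    simp
  have hle : ∫ t, θ t * F (t - u n) ≤ ∫ t, θ t * F t := by
    refine integral_mono ?_ (by simpa using hInt 0) fun t =>
      mul_le_mul_of_nonneg_left (hmono (by linarith [hu0 n])) (h0 t)
    exact Continuous.integrable_of_hasCompactSupport (by fun_prop) hc.mul_right
  rw [e1, e2]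
  exact mul_nonpos_of_nonneg_of_nonpos (inv_nonneg.2 (hu0 n).le) (by linarith)

theorem integrable_mul_of_hasCompactSupport {f g : ℝ → ℝ} (hf : Continuous f) (hg : Continuous g)
    (hc : HasCompactSupport f) : Integrable fun t => f t * g t :=
  Continuous.integrable_of_hasCompactSupport (hf.mul hg) hc.mul_right

theorem integral_mul_eq_neg_integral_deriv_mul {ψ θ : ℝ → ℝ} (hψ : Continuous ψ)
    (hθ : ContDiff ℝ ∞ θ) (hc : HasCompactSupport θ) :
    ∫ t, θ t * ψ t = - ∫ t, deriv θ t * ∫ s in (0 : ℝ)..t, ψ s := by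
  have hΨ : ∀ x, HasDerivAt (fun t => ∫ s in (0 : ℝ)..t, ψ s) (ψ x) x := fun x =>
    intervalIntegral.integral_hasDerivAt_right (hψ.intervalIntegrable 0 x)
      (hψ.stronglyMeasurableAtFilter _ _) hψ.continuousAt
  have hΨc : Continuous (fun t => ∫ s in (0 : ℝ)..t, ψ s) :=
    continuous_iff_continuousAt.2 fun x => (hΨ x).continuousAt
  have hθc := hθ.continuous
  have hθd : Continuous (deriv θ) := hθ.continuous_deriv (by simp)
  refine integral_mul_deriv_eq_deriv_mul_of_integrable (u := θ) (u' := deriv θ)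
    (v := fun t => ∫ s in (0 : ℝ)..t, ψ s) (v' := ψ)
    (fun x _ => (hθ.differentiable (by simp)).differentiableAt.hasDerivAt) (fun x _ => hΨ x) ?_ ?_ ?_
  · exact integrable_mul_of_hasCompactSupport hθc hψ hc
  · exact integrable_mul_of_hasCompactSupport hθd hΨc hc.deriv
  · exact integrable_mul_of_hasCompactSupport hθc hΨc hc

theorem setIntegral_Ioi_mul_eq {f g : ℝ → ℝ} {θ : ℝ → ℝ} (hθ : tsupport θ ⊆ Ioi 0)
    (hf : ∀ t, t ∉ tsupport θ → f t = 0) :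
    ∫ t in Ioi (0 : ℝ), f t * g t = ∫ t, f t * g (max t 0) := by
  have h1 : ∀ t, t ∉ Ioi (0 : ℝ) → f t * g (max t 0) = 0 := fun t ht => by
    rw [hf t fun h => ht (hθ h), zero_mul]
  rw [← setIntegral_eq_integral_of_forall_compl_eq_zero h1]
  refine setIntegral_congr_fun measurableSet_Ioi fun t ht => ?_
  simp only [max_eq_left (le_of_lt (mem_Ioi.1 ht))]

theorem continuous_comp_max_zero {E : Type*} [TopologicalSpace E] {φ : ℝ → E}
    (hφ : ContinuousOn φ (Ici 0)) : Continuous fun t => φ (max t 0) :=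
  hφ.comp_continuous (by fun_prop) fun x => mem_Ici.2 (le_max_right x 0)

theorem intervalIntegral_comp_max_zero (ψ : ℝ → ℝ) {s t : ℝ} (hs : 0 ≤ s) (ht : 0 ≤ t) :
    ∫ r in s..t, ψ (max r 0) = ∫ r in s..t, ψ r := by
  refine intervalIntegral.integral_congr fun r hr => ?_
  have : 0 ≤ r := le_trans (le_inf hs ht) hr.1
  simp only [max_eq_left this]

/-- An inequality `dφ/dt ≤ ψ` in integrated form holds in the sense of distributions. -/
theorem distrib_le_of_sub_le_integral {φ ψ : ℝ → ℝ} (hφ : ContinuousOn φ (Ici 0))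
    (hψ : ContinuousOn ψ (Ici 0))
    (h : ∀ s t, 0 ≤ s → s ≤ t → φ t - φ s ≤ ∫ r in s..t, ψ r)
    {θ : ℝ → ℝ} (hθ : ContDiff ℝ ∞ θ) (hc : HasCompactSupport θ) (hs : tsupport θ ⊆ Ioi 0)
    (h0 : ∀ t, 0 ≤ θ t) :
    - ∫ t in Ioi (0 : ℝ), deriv θ t * φ t ≤ ∫ t in Ioi (0 : ℝ), θ t * ψ t := by
  have hφ' := continuous_comp_max_zero hφ
  have hψ' := continuous_comp_max_zero hψ
  rw [setIntegral_Ioi_mul_eq hs fun t ht => image_eq_zero_of_notMem_tsupport ht,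
    setIntegral_Ioi_mul_eq hs fun t ht => by
      simpa using image_eq_zero_of_notMem_tsupport (f := deriv θ)
        fun h => ht (tsupport_deriv_subset h),
    integral_mul_eq_neg_integral_deriv_mul hψ' hθ hc, neg_le_neg_iff]
  have hΨc : Continuous (fun t => ∫ s in (0 : ℝ)..t, ψ (max s 0)) :=
    intervalIntegral.continuous_primitive (fun a b => hψ'.intervalIntegrable a b) 0
  have hθd : Continuous (deriv θ) := hθ.continuous_deriv (by simp)
  have hΨc' : Continuous (fun t => ∫ s in (0 : ℝ)..(max t 0), ψ (max s 0)) :=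
    hΨc.comp (by fun_prop)
  have hF : Continuous fun t => (∫ s in (0 : ℝ)..(max t 0), ψ (max s 0)) - φ (max t 0) :=
    hΨc'.sub hφ'
  have hmono : Monotone fun t => (∫ s in (0 : ℝ)..(max t 0), ψ (max s 0)) - φ (max t 0) := by
    intro s t hst
    have hst' : max s 0 ≤ max t 0 := max_le_max_right 0 hst
    have h1 := h (max s 0) (max t 0) (le_max_right _ _) hst'
    rw [← intervalIntegral_comp_max_zero ψ (le_max_right _ _) (le_max_right _ _)] at h1
    have h2 := intervalIntegral.integral_add_adjacent_intervals
      (hψ'.intervalIntegrable (μ := volume) 0 (max s 0))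
      (hψ'.intervalIntegrable (μ := volume) (max s 0) (max t 0))
    simp only
    linarith
  have key := integral_deriv_mul_nonpos hF hmono hθ hc h0
  have e : ∫ t, deriv θ t * ((∫ s in (0 : ℝ)..(max t 0), ψ (max s 0)) - φ (max t 0))
      = (∫ t, deriv θ t * ∫ s in (0 : ℝ)..t, ψ (max s 0)) - ∫ t, deriv θ t * φ (max t 0) := by
    rw [← integral_sub
      (integrable_mul_of_hasCompactSupport hθd hΨc hc.deriv)
      (integrable_mul_of_hasCompactSupport hθd hφ' hc.deriv)]
    congr 1; ext t
    by_cases ht : t ∈ tsupport (deriv θ)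
    · have : 0 < t := hs (tsupport_deriv_subset ht)
      rw [max_eq_left this.le]; ring
    · rw [image_eq_zero_of_notMem_tsupport ht]; ring
  linarith

/-- An inequality `dφ/dt ≤ ψ` in the sense of distributions on `]0, ∞[` holds in integrated form. -/
theorem sub_le_integral_of_distrib_le {φ ψ : ℝ → ℝ} (hφ : ContinuousOn φ (Ici 0))
    (hψ : ContinuousOn ψ (Ici 0))
    (h : ∀ θ : ℝ → ℝ, ContDiff ℝ ∞ θ → HasCompactSupport θ → tsupport θ ⊆ Ioi 0 →
      (∀ t, 0 ≤ θ t) →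
      - ∫ t in Ioi (0 : ℝ), deriv θ t * φ t ≤ ∫ t in Ioi (0 : ℝ), θ t * ψ t)
    {s t : ℝ} (hs : 0 ≤ s) (hst : s ≤ t) :
    φ t - φ s ≤ ∫ r in s..t, ψ r := by
  have hφ' := continuous_comp_max_zero hφ
  have hψ' := continuous_comp_max_zero hψ
  have hΨc : Continuous (fun t => ∫ s in (0 : ℝ)..t, ψ (max s 0)) :=
    intervalIntegral.continuous_primitive (fun a b => hψ'.intervalIntegrable a b) 0
  set F : ℝ → ℝ := fun t => φ (max t 0) - ∫ s in (0 : ℝ)..t, ψ (max s 0) with hFdef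
  have hF : Continuous F := hφ'.sub hΨc
  suffices hanti : ∀ s t, 0 < s → s ≤ t → F t ≤ F s by
    have hle : F t ≤ F s := by
      have hts : Tendsto (fun ε => F (s + ε)) (𝓝[>] 0) (𝓝 (F s)) := by
        have : Continuous fun ε => F (s + ε) := hF.comp (by fun_prop)
        simpa using this.continuousWithinAt (s := Ioi 0) (x := 0) |>.tendsto
      have htt : Tendsto (fun ε => F (t + ε)) (𝓝[>] 0) (𝓝 (F t)) := by
        have : Continuous fun ε => F (t + ε) := hF.comp (by fun_prop)
        simpa using this.continuousWithinAt (s := Ioi 0) (x := 0) |>.tendsto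
      refine le_of_tendsto_of_tendsto htt hts ?_
      filter_upwards [self_mem_nhdsWithin] with ε hε
      exact hanti _ _ (add_pos_of_nonneg_of_pos hs hε) (by linarith)
    have ht : 0 ≤ t := hs.trans hst
    have h2 := intervalIntegral.integral_add_adjacent_intervals
      (hψ'.intervalIntegrable (μ := volume) 0 s) (hψ'.intervalIntegrable (μ := volume) s t)
    rw [← intervalIntegral_comp_max_zero ψ hs ht]
    simp only [hFdef, max_eq_left hs, max_eq_left ht] at hle
    linarith
  clear hs hst
  intro s t hs hst
  let η : ℕ → ContDiffBump (0 : ℝ) := fun n =>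
    ⟨s / (n + 2) / 2, s / (n + 2), by positivity, by
      have : 0 < s / ((n : ℝ) + 2) := by positivity
      linarith⟩
  have hη : Tendsto (fun n => (η n).rOut) atTop (𝓝 0) := by
    have := (tendsto_const_div_atTop_nhds_zero_nat s).comp (tendsto_add_atTop_nat 2)
    refine this.congr fun n => ?_
    simp [η]
  have hconv := fun x => ContDiffBump.convolution_tendsto_right_of_continuous (μ := volume) hη hF x
  refine le_of_tendsto_of_tendsto (hconv t) (hconv s) (Eventually.of_forall fun n => ?_)
  have hrs : (η n).rOut < s := by
    change s / ((n : ℝ) + 2) < s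
    rw [div_lt_iff₀ (by positivity)]
    nlinarith [Nat.cast_nonneg (α := ℝ) n]
  have hr0 := (η n).rOut_pos
  set e : ℝ → ℝ := (η n).normed volume with he
  have hes : ContDiff ℝ ∞ e := (η n).contDiff_normed
  have hec := hes.continuous
  have hecs : HasCompactSupport e := (η n).hasCompactSupport_normed
  have hezero : ∀ x, (η n).rOut < |x| → e x = 0 := by
    intro x hx
    have : x ∉ Function.support e := by
      rw [he, (η n).support_normed_eq]; simp [hx.le]
    simpa using this
  have he0 : ∀ x, 0 ≤ e x := (η n).nonneg_normed
  set H : ℝ → ℝ := fun x => ∫ r in (0 : ℝ)..x, e r with hH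
  have hHd : ∀ x, HasDerivAt H (e x) x := fun x =>
    intervalIntegral.integral_hasDerivAt_right (hec.intervalIntegrable 0 x)
      (hec.stronglyMeasurableAtFilter _ _) hec.continuousAt
  have hHs : ContDiff ℝ ∞ H := by
    rw [contDiff_infty_iff_deriv]
    refine ⟨fun x => (hHd x).differentiableAt, ?_⟩
    rwa [show deriv H = e from funext fun x => (hHd x).deriv]
  have hHmono : Monotone H := by
    refine monotone_of_deriv_nonneg (fun x => (hHd x).differentiableAt) fun x => ?_
    rw [(hHd x).deriv]; exact he0 x
  have hHconst : ∀ x y, (∀ r ∈ uIoc x y, (η n).rOut < |r|) → H y = H x := by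
    intro x y hxy
    have h1 := intervalIntegral.integral_interval_sub_left
      (hec.intervalIntegrable (μ := volume) 0 y) (hec.intervalIntegrable (μ := volume) 0 x)
    have h2 : ∫ r in x..y, e r = 0 :=
      intervalIntegral.integral_zero_ae (Eventually.of_forall fun r hr => hezero r (hxy r hr))
    have : H y - H x = ∫ r in x..y, e r := h1
    linarith
  set θ : ℝ → ℝ := fun r => H (t - r) - H (s - r) with hθ
  have hθd : ∀ r, HasDerivAt θ (e (s - r) - e (t - r)) r := by
    intro r
    have h1 : ∀ c, HasDerivAt (fun r => H (c - r)) (- e (c - r)) r := fun c => by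
      have := HasDerivAt.scomp r (hHd (c - r)) ((hasDerivAt_id r).const_sub c)
      simpa [Function.comp_def] using this
    have := (h1 t).fun_sub (h1 s)
    rwa [neg_sub_neg] at this
  have hθs : ContDiff ℝ ∞ θ :=
    (hHs.comp (contDiff_const.sub contDiff_id)).sub (hHs.comp (contDiff_const.sub contDiff_id))
  have hsupp : Function.support θ ⊆ Icc (s - (η n).rOut) (t + (η n).rOut) := by
    intro r hr
    by_contra hcon
    apply hr
    rw [mem_Icc, not_and_or, not_le, not_le] at hcon
    simp only [hθ]
    rcases hcon with hcon | hcon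
    · rw [hHconst (s - r) (t - r), sub_self]
      intro x hx
      rw [uIoc_of_le (by linarith)] at hx
      rw [lt_abs]; left; linarith [hx.1]
    · rw [hHconst (s - r) (t - r), sub_self]
      intro x hx
      rw [uIoc_of_le (by linarith)] at hx
      rw [lt_abs]; right; linarith [hx.2]
  have htsupp : tsupport θ ⊆ Icc (s - (η n).rOut) (t + (η n).rOut) :=
    closure_minimal hsupp isClosed_Icc
  have hθc : HasCompactSupport θ :=
    HasCompactSupport.of_support_subset_isCompact isCompact_Icc hsupp
  have hts : tsupport θ ⊆ Ioi 0 := fun r hr => by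
    have := (htsupp hr).1
    simp only [mem_Ioi]; linarith
  have key := h θ hθs hθc hts fun r => sub_nonneg.2 (hHmono (by linarith))
  rw [setIntegral_Ioi_mul_eq hts fun t ht => image_eq_zero_of_notMem_tsupport ht,
    setIntegral_Ioi_mul_eq hts fun t ht => by
      simpa using image_eq_zero_of_notMem_tsupport (f := deriv θ)
        fun h => ht (tsupport_deriv_subset h),
    integral_mul_eq_neg_integral_deriv_mul hψ' hθs hθc, neg_le_neg_iff] at key
  have hθd' : Continuous (deriv θ) := hθs.continuous_deriv (by simp)
  have e1 : 0 ≤ ∫ r, deriv θ r * F r := by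
    have : ∫ r, deriv θ r * F r = (∫ r, deriv θ r * φ (max r 0))
        - ∫ r, deriv θ r * ∫ s in (0 : ℝ)..r, ψ (max s 0) := by
      rw [← integral_sub
        (integrable_mul_of_hasCompactSupport hθd' hφ' hθc.deriv)
        (integrable_mul_of_hasCompactSupport hθd' hΨc hθc.deriv)]
      congr 1; ext t; simp only [hFdef]; ring
    linarith
  have e2 : ∀ c, (convolution e F (ContinuousLinearMap.lsmul ℝ ℝ) volume) c
      = ∫ r, e (c - r) * F r := by
    intro c
    rw [convolution_def, ← integral_sub_left_eq_self _ volume c]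
    simp
  change convolution e F _ _ t ≤ convolution e F _ _ s
  rw [e2, e2]
  have hi : ∀ c, Integrable fun r => e (c - r) * F r := fun c => by
    refine Continuous.integrable_of_hasCompactSupport (by fun_prop) ?_
    exact (hecs.comp_homeomorph (Homeomorph.subLeft c)).mul_right
  have e3 : ∫ r, deriv θ r * F r = (∫ r, e (s - r) * F r) - ∫ r, e (t - r) * F r := by
    rw [← integral_sub (hi s) (hi t)]
    congr 1; ext r
    rw [(hθd r).deriv]; ring
  linarith

end
end LevelSet

namespace LevelSet
noncomputable section
open scoped ContDiff Topology
open Set Filter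

open scoped InnerProductSpace

variable {H : Type*} [NormedAddCommGroup H] [InnerProductSpace ℝ H]

theorem exists_mem_forall_inner_le_zero [CompleteSpace H] {K : Set H} (hne : K.Nonempty)
    (hcl : IsClosed K) (hcv : Convex ℝ K) (x : H) :
    ∃ v ∈ K, ∀ w ∈ K, ⟪x - v, w - v⟫_ℝ ≤ 0 := by
  obtain ⟨v, hv, h⟩ := exists_norm_eq_iInf_of_complete_convex hne hcl.isComplete hcv x
  exact ⟨v, hv, (norm_eq_iInf_iff_real_inner_le_zero hcv hv).1 h⟩

variable (H) in
/-- The data of a splitting scheme in a Hilbert space: a closed convex set `K`, a group `U` of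
isometries, and a vector `b` fixed by the group. -/
structure Splitting where
  /-- the constraint -/
  K : Set H
  isClosed : IsClosed K
  convex : Convex ℝ K
  nonempty : K.Nonempty
  /-- the group of isometries -/
  U : ℝ → H →ₗᵢ[ℝ] H
  U_zero : ∀ x, U 0 x = x
  U_add : ∀ s t x, U (s + t) x = U s (U t x)
  /-- the source term -/
  b : H
  U_b : ∀ t, U t b = b

namespace Splitting

variable (S : Splitting H)

theorem U_U_neg (t : ℝ) (x : H) : S.U t (S.U (-t) x) = x := by
  rw [← S.U_add, add_neg_cancel, S.U_zero]

theorem inner_U_right (t : ℝ) (x y : H) : ⟪x, S.U t y⟫_ℝ = ⟪S.U (-t) x, y⟫_ℝ := by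
  conv_lhs => rw [← S.U_U_neg t x]
  exact (S.U t).inner_map_map _ _

variable [CompleteSpace H]

/-- The nearest point projection onto `K`. -/
def proj (x : H) : H :=
  (exists_mem_forall_inner_le_zero S.nonempty S.isClosed S.convex x).choose

theorem proj_mem (x : H) : S.proj x ∈ S.K :=
  (exists_mem_forall_inner_le_zero S.nonempty S.isClosed S.convex x).choose_spec.1

theorem inner_proj_le (x : H) {w : H} (hw : w ∈ S.K) : ⟪x - S.proj x, w - S.proj x⟫_ℝ ≤ 0 :=
  (exists_mem_forall_inner_le_zero S.nonempty S.isClosed S.convex x).choose_spec.2 w hw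

theorem norm_proj_sub_proj_le (x y : H) : ‖S.proj x - S.proj y‖ ≤ ‖x - y‖ := by
  have h1 := S.inner_proj_le x (S.proj_mem y)
  have h2 := S.inner_proj_le y (S.proj_mem x)
  have h3 : ‖S.proj x - S.proj y‖ ^ 2 ≤ ⟪x - y, S.proj x - S.proj y⟫_ℝ := by
    rw [← real_inner_self_eq_norm_sq]
    simp only [inner_sub_left, inner_sub_right] at h1 h2 ⊢
    linarith
  have h4 := real_inner_le_norm (x - y) (S.proj x - S.proj y)
  by_contra! hlt
  have := norm_nonneg (x - y)
  nlinarith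

theorem proj_eq {x v : H} (hv : v ∈ S.K) (h : ∀ w ∈ S.K, ⟪x - v, w - v⟫_ℝ ≤ 0) :
    S.proj x = v := by
  have h1 := S.inner_proj_le x hv
  have h2 := h _ (S.proj_mem x)
  have h3 : ⟪S.proj x - v, S.proj x - v⟫_ℝ ≤ 0 := by
    simp only [inner_sub_left, inner_sub_right] at h1 h2 ⊢
    linarith
  rw [real_inner_self_eq_norm_sq] at h3
  exact sub_eq_zero.1 (norm_eq_zero.1 (pow_eq_zero_iff two_ne_zero |>.1 (le_antisymm h3 (sq_nonneg _))))

theorem proj_of_mem {x : H} (hx : x ∈ S.K) : S.proj x = x :=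
  S.proj_eq hx fun w _ => by simp

/-- One step of the scheme: transport, then projection. -/
def step (h : ℝ) (x : H) : H := S.proj (S.U h x + h • S.b)

theorem step_mem (h : ℝ) (x : H) : S.step h x ∈ S.K := S.proj_mem _

theorem norm_step_sub_step_le (h : ℝ) (x y : H) : ‖S.step h x - S.step h y‖ ≤ ‖x - y‖ := by
  refine (S.norm_proj_sub_proj_le _ _).trans ?_
  rw [add_sub_add_right_eq_sub, ← map_sub, LinearIsometry.norm_map]

theorem norm_iterate_step_sub_le (h : ℝ) (x y : H) (n : ℕ) :
    ‖(S.step h)^[n] x - (S.step h)^[n] y‖ ≤ ‖x - y‖ := by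
  induction n with
  | zero => simp
  | succ n ih =>
    rw [Function.iterate_succ_apply', Function.iterate_succ_apply']
    exact (S.norm_step_sub_step_le _ _ _).trans ih

theorem iterate_step_mem (h : ℝ) {x : H} (hx : x ∈ S.K) (n : ℕ) : (S.step h)^[n] x ∈ S.K := by
  induction n with
  | zero => simpa
  | succ n ih => rw [Function.iterate_succ_apply']; exact S.step_mem _ _

/-- A subset of `K` that is invariant under the scheme and on which the group is Lipschitz. -/
structure IsRegularSet (R : Set H) (C : ℝ) : Prop where
  nonneg : 0 ≤ C
  subset : R ⊆ S.K
  lipschitz : ∀ x ∈ R, ∀ h, ‖S.U h x - x‖ ≤ C * |h|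
  step_mem : ∀ h, 0 ≤ h → ∀ x ∈ R, S.step h x ∈ R

variable {S}

namespace IsRegularSet

variable {R : Set H} {C : ℝ}

theorem iterate_mem (hR : S.IsRegularSet R C) {h : ℝ} (hh : 0 ≤ h) {x : H} (hx : x ∈ R) (n : ℕ) :
    (S.step h)^[n] x ∈ R := by
  induction n with
  | zero => simpa
  | succ n ih => rw [Function.iterate_succ_apply']; exact hR.step_mem h hh _ ih

theorem norm_sub_le (hR : S.IsRegularSet R C) {h : ℝ} (hh : 0 ≤ h) {x : H} (hx : x ∈ R) :
    ‖S.U h x + h • S.b - x‖ ≤ h * (C + ‖S.b‖) := by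
  have h1 := hR.lipschitz x hx h
  rw [abs_of_nonneg hh] at h1
  calc ‖S.U h x + h • S.b - x‖ = ‖(S.U h x - x) + h • S.b‖ := by congr 1; abel
    _ ≤ ‖S.U h x - x‖ + ‖h • S.b‖ := norm_add_le _ _
    _ ≤ C * h + h * ‖S.b‖ := by rw [norm_smul, Real.norm_of_nonneg hh]; gcongr
    _ = _ := by ring

theorem norm_step_sub_le (hR : S.IsRegularSet R C) {h : ℝ} (hh : 0 ≤ h) {x : H} (hx : x ∈ R) :
    ‖S.step h x - x‖ ≤ h * (C + ‖S.b‖) := by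
  have := S.norm_proj_sub_proj_le (S.U h x + h • S.b) x
  rw [S.proj_of_mem (hR.subset hx)] at this
  exact this.trans (hR.norm_sub_le hh hx)

theorem norm_iterate_sub_le (hR : S.IsRegularSet R C) {h : ℝ} (hh : 0 ≤ h) {x : H} (hx : x ∈ R) (n : ℕ) :
    ‖(S.step h)^[n] x - x‖ ≤ n * (h * (C + ‖S.b‖)) := by
  induction n with
  | zero => simp
  | succ n ih =>
    rw [Function.iterate_succ_apply']
    have h1 := hR.norm_step_sub_le hh (hR.iterate_mem hh hx n)
    have h2 := norm_sub_le_norm_sub_add_norm_sub (S.step h ((S.step h)^[n] x))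
      ((S.step h)^[n] x) x
    push_cast
    linarith

/-- One step of size `2k` against two steps of size `k`. -/
theorem norm_sq_step_sub_le (hR : S.IsRegularSet R C) {k : ℝ} (hk : 0 ≤ k) {x w : H} (hx : x ∈ R) (hw : w ∈ R) :
    ‖S.step (2 * k) x - S.step k (S.step k w)‖ ^ 2
      ≤ ‖x - w‖ ^ 2 + 12 * (k * (C + ‖S.b‖)) ^ 2 := by
  set L := C + ‖S.b‖ with hL
  set x₁ := S.step (2 * k) x with hx₁
  set w₁ := S.step k w with hw₁
  set w₂ := S.step k w₁ with hw₂
  have hx₁R : x₁ ∈ R := hR.step_mem _ (by positivity) x hx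
  have hw₁R : w₁ ∈ R := hR.step_mem _ hk w hw
  have hw₂R : w₂ ∈ R := hR.step_mem _ hk _ hw₁R
  have hCL : C ≤ L := by rw [hL]; linarith [norm_nonneg S.b]
  have hL0 : 0 ≤ L := hR.nonneg.trans hCL
  set ξ := S.U (2 * k) x + (2 * k) • S.b - x₁ with hξ
  set η₁ := S.U k w + k • S.b - w₁ with hη₁
  set η₂ := S.U k w₁ + k • S.b - w₂ with hη₂
  have i1 : ⟪ξ, w₂ - x₁⟫_ℝ ≤ 0 := S.inner_proj_le _ (hR.subset hw₂R)
  have i2 : ⟪η₂, x₁ - w₂⟫_ℝ ≤ 0 := S.inner_proj_le _ (hR.subset hx₁R)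
  have i3 : ⟪η₁, x₁ - w₁⟫_ℝ ≤ 0 := S.inner_proj_le _ (hR.subset hx₁R)
  have n1 : ‖η₁‖ ≤ 2 * (k * L) := by
    have a1 := hR.norm_sub_le hk hw
    have a2 := hR.norm_step_sub_le hk hw
    have a3 : η₁ = (S.U k w + k • S.b - w) - (w₁ - w) := by rw [hη₁]; abel
    rw [a3]
    exact (_root_.norm_sub_le _ _).trans (by rw [two_mul]; exact add_le_add a1 a2)
  have e : x₁ - w₂ = S.U (2 * k) (x - w) - ξ + η₂ + S.U k η₁ := by
    have u2 : S.U k (S.U k w) = S.U (2 * k) w := by rw [← S.U_add, two_mul]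
    rw [hη₁]
    simp only [map_sub, map_add, map_smul, S.U_b, u2, hξ, hη₂]
    module
  have i4 : ⟪x₁ - w₂, S.U k η₁⟫_ℝ ≤ 6 * (k * L) ^ 2 := by
    rw [S.inner_U_right]
    have d : S.U (-k) (x₁ - w₂) = (x₁ - w₁) + ((S.U (-k) x₁ - x₁) - (w₂ - w₁)
        - (S.U (-k) w₂ - w₂)) := by rw [map_sub]; abel
    have b1 := hR.lipschitz x₁ hx₁R (-k)
    have b2 := hR.lipschitz w₂ hw₂R (-k)
    have b3 : ‖w₂ - w₁‖ ≤ k * L := hR.norm_step_sub_le hk hw₁R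
    rw [abs_neg, abs_of_nonneg hk] at b1 b2
    have b4 : ‖(S.U (-k) x₁ - x₁) - (w₂ - w₁) - (S.U (-k) w₂ - w₂)‖ ≤ 3 * (k * L) := by
      refine (_root_.norm_sub_le _ _).trans ?_
      have := _root_.norm_sub_le (S.U (-k) x₁ - x₁) (w₂ - w₁)
      nlinarith
    rw [d, inner_add_left, real_inner_comm η₁ (x₁ - w₁)]
    have b5 := real_inner_le_norm ((S.U (-k) x₁ - x₁) - (w₂ - w₁) - (S.U (-k) w₂ - w₂)) η₁
    have b6 := mul_le_mul b4 n1 (norm_nonneg _) (by positivity)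
    nlinarith
  have i5 : ⟪x₁ - w₂, S.U (2 * k) (x - w)⟫_ℝ ≤ ‖x₁ - w₂‖ * ‖x - w‖ := by
    have := real_inner_le_norm (x₁ - w₂) (S.U (2 * k) (x - w))
    rwa [LinearIsometry.norm_map] at this
  have i6 : ‖x₁ - w₂‖ ^ 2 = ⟪x₁ - w₂, S.U (2 * k) (x - w)⟫_ℝ - ⟪x₁ - w₂, ξ⟫_ℝ
      + ⟪x₁ - w₂, η₂⟫_ℝ + ⟪x₁ - w₂, S.U k η₁⟫_ℝ := by
    rw [← real_inner_self_eq_norm_sq]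
    conv_lhs => rw [e]; rw [← e]
    nth_rewrite 2 [e]
    rw [inner_add_right, inner_add_right, inner_sub_right]
  have i7 : ⟪x₁ - w₂, ξ⟫_ℝ = -⟪ξ, w₂ - x₁⟫_ℝ := by
    rw [real_inner_comm, ← inner_neg_right, neg_sub]
  have i8 : ⟪x₁ - w₂, η₂⟫_ℝ ≤ 0 := by rw [real_inner_comm]; exact i2
  nlinarith [sq_nonneg (‖x₁ - w₂‖ - ‖x - w‖)]

theorem norm_sq_iterate_sub_le (hR : S.IsRegularSet R C) {k : ℝ} (hk : 0 ≤ k) {x : H} (hx : x ∈ R) (m : ℕ) :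
    ‖(S.step (2 * k))^[m] x - (S.step k)^[2 * m] x‖ ^ 2
      ≤ m * (12 * (k * (C + ‖S.b‖)) ^ 2) := by
  induction m with
  | zero => simp
  | succ m ih =>
    rw [show 2 * (m + 1) = 2 * m + 1 + 1 by ring, Function.iterate_succ_apply',
      Function.iterate_succ_apply', Function.iterate_succ_apply']
    have := hR.norm_sq_step_sub_le hk (hR.iterate_mem (h := 2 * k) (by positivity) hx m)
      (hR.iterate_mem hk hx (2 * m))
    push_cast
    linarith

end IsRegularSet

variable (S) in
/-- The approximation of the solution at time `t` by the scheme with time step `2⁻ⁿ`. -/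
def approx (n : ℕ) (t : ℝ) (x : H) : H := (S.step ((2 ^ n)⁻¹))^[⌊2 ^ n * t⌋₊] x

theorem approx_mem (n : ℕ) (t : ℝ) {x : H} (hx : x ∈ S.K) : S.approx n t x ∈ S.K :=
  S.iterate_step_mem _ hx _

theorem approx_zero (n : ℕ) (x : H) : S.approx n 0 x = x := by simp [approx]

theorem norm_approx_sub_approx_le (n : ℕ) (t : ℝ) (x y : H) :
    ‖S.approx n t x - S.approx n t y‖ ≤ ‖x - y‖ := S.norm_iterate_step_sub_le _ _ _ _

theorem approx_nat_mul (n k : ℕ) (x : H) :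
    S.approx n (k * (2 ^ n)⁻¹) x = (S.step ((2 ^ n)⁻¹))^[k] x := by
  have : (2 : ℝ) ^ n * (k * (2 ^ n)⁻¹) = k := by field_simp
  rw [approx, this, Nat.floor_natCast]

theorem IsRegularSet.norm_approx_sub_approx_le {R : Set H} {C : ℝ} (hR : S.IsRegularSet R C)
    {x : H} (hx : x ∈ R) (n : ℕ) {s t : ℝ} (hs : 0 ≤ s) (hst : s ≤ t) :
    ‖S.approx n t x - S.approx n s x‖ ≤ (C + ‖S.b‖) * (t - s + (2 ^ n)⁻¹) := by
  have hL : 0 ≤ C + ‖S.b‖ := add_nonneg hR.nonneg (norm_nonneg _)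
  have hp : (0 : ℝ) < 2 ^ n := by positivity
  have hle : ⌊2 ^ n * s⌋₊ ≤ ⌊2 ^ n * t⌋₊ := Nat.floor_le_floor (by gcongr)
  obtain ⟨j, hj⟩ := Nat.exists_eq_add_of_le hle
  have h1 : (j : ℝ) ≤ 2 ^ n * (t - s) + 1 := by
    have a1 := Nat.floor_le (mul_nonneg hp.le (hs.trans hst))
    have a2 := Nat.lt_floor_add_one (2 ^ n * s)
    rw [hj] at a1
    push_cast at a1
    linarith
  unfold approx
  rw [hj, add_comm, Function.iterate_add_apply]
  refine (hR.norm_iterate_sub_le (by positivity) (hR.iterate_mem (by positivity) hx _) j).trans ?_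
  calc (j : ℝ) * ((2 ^ n)⁻¹ * (C + ‖S.b‖))
      ≤ (2 ^ n * (t - s) + 1) * ((2 ^ n)⁻¹ * (C + ‖S.b‖)) := by gcongr
    _ = _ := by field_simp

theorem IsRegularSet.norm_approx_sub_succ_le {R : Set H} {C : ℝ} (hR : S.IsRegularSet R C)
    {x : H} (hx : x ∈ R) (n : ℕ) {t : ℝ} (ht : 0 ≤ t) :
    ‖S.approx n t x - S.approx (n + 1) t x‖ ≤ (C + ‖S.b‖) * (3 + 2 * t) * (√(1 / 2)) ^ n := by
  set L := C + ‖S.b‖ with hLdef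
  have hL : 0 ≤ L := add_nonneg hR.nonneg (norm_nonneg _)
  set r : ℝ := (√(1 / 2)) ^ n with hr
  have hr0 : 0 ≤ r := by positivity
  have hr2 : r ^ 2 = (2 ^ n)⁻¹ := by
    rw [hr, ← pow_mul, mul_comm, pow_mul, Real.sq_sqrt (by norm_num)]; simp
  have hr1 : r ≤ 1 := pow_le_one₀ (by positivity) (Real.sqrt_le_one.2 (by norm_num))
  set k : ℝ := (2 ^ (n + 1))⁻¹ with hk
  have hk0 : 0 ≤ k := by positivity
  have h2k : ((2 : ℝ) ^ n)⁻¹ = 2 * k := by rw [hk, pow_succ]; field_simp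
  set m := ⌊2 ^ n * t⌋₊ with hm
  have hmle : (m : ℝ) ≤ 2 ^ n * t := Nat.floor_le (by positivity)
  have h1 : ‖(S.step (2 * k))^[m] x - (S.step k)^[2 * m] x‖ ≤ 2 * (1 + t) * L * r := by
    refine abs_le_of_sq_le_sq' ?_ (by positivity) |>.2
    refine (hR.norm_sq_iterate_sub_le hk0 hx m).trans ?_
    have e1 : (2 : ℝ) ^ n * r ^ 2 = 1 := by rw [hr2]; field_simp
    have e2 : k = r ^ 2 / 2 := by rw [hr2, h2k]; ring
    calc (m : ℝ) * (12 * (k * L) ^ 2) ≤ (2 ^ n * t) * (12 * (k * L) ^ 2) := by gcongr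
      _ = 3 * t * L ^ 2 * r ^ 2 * (2 ^ n * r ^ 2) := by rw [e2]; ring
      _ = 3 * t * (L * r) ^ 2 := by rw [e1]; ring
      _ ≤ 4 * (1 + t) ^ 2 * (L * r) ^ 2 := by
        refine mul_le_mul_of_nonneg_right ?_ (sq_nonneg _)
        nlinarith
      _ = _ := by ring
  have h2 : ‖S.approx (n + 1) t x - (S.step k)^[2 * m] x‖ ≤ k * L := by
    have hle : 2 * m ≤ ⌊2 ^ (n + 1) * t⌋₊ := by
      apply Nat.le_floor
      push_cast
      rw [pow_succ]; linarith
    obtain ⟨j, hj⟩ := Nat.exists_eq_add_of_le hle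
    have hj1 : j ≤ 1 := by
      have a1 := Nat.floor_le (show 0 ≤ 2 ^ (n + 1) * t by positivity)
      have a2 := Nat.lt_floor_add_one (2 ^ n * t)
      rw [hj] at a1
      rw [← hm] at a2
      push_cast at a1
      have : (j : ℝ) < 2 := by rw [pow_succ] at a1; linarith
      have : j < 2 := by exact_mod_cast this
      omega
    unfold approx
    rw [hj, add_comm (2 * m) j, Function.iterate_add_apply]
    refine (hR.norm_iterate_sub_le hk0 (hR.iterate_mem hk0 hx _) j).trans ?_
    have : (j : ℝ) ≤ 1 := by exact_mod_cast hj1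
    have hkL : 0 ≤ k * L := by positivity
    nlinarith
  have h3 : S.approx n t x = (S.step (2 * k))^[m] x := by rw [approx, h2k]
  rw [h3]
  have h4 := norm_sub_le_norm_sub_add_norm_sub ((S.step (2 * k))^[m] x) ((S.step k)^[2 * m] x)
    (S.approx (n + 1) t x)
  rw [norm_sub_rev ((S.step k)^[2 * m] x) (S.approx (n + 1) t x)] at h4
  have h5 : k ≤ r := by nlinarith
  have h6 : k * L ≤ r * L := by gcongr
  nlinarith

variable (S) in
/-- The limit of the scheme. -/
def sol (x : H) (t : ℝ) : H := limUnder atTop fun n => S.approx n t x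

theorem IsRegularSet.tendsto_approx {R : Set H} {C : ℝ} (hR : S.IsRegularSet R C)
    {x : H} (hx : x ∈ R) {t : ℝ} (ht : 0 ≤ t) :
    Tendsto (fun n => S.approx n t x) atTop (𝓝 (S.sol x t)) :=
  (cauchySeq_of_le_geometric (√(1 / 2)) ((C + ‖S.b‖) * (3 + 2 * t))
    ((Real.sqrt_lt' one_pos).2 (by norm_num)) fun n => by
      rw [dist_eq_norm]; exact hR.norm_approx_sub_succ_le hx n ht).tendsto_limUnder

theorem IsRegularSet.tendstoUniformlyOn_approx {R : Set H} {C : ℝ} (hR : S.IsRegularSet R C)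
    {x : H} (hx : x ∈ R) (T : ℝ) :
    TendstoUniformlyOn (fun n t => S.approx n t x) (S.sol x) atTop (Icc 0 T) := by
  have hlt : √(1 / 2 : ℝ) < 1 := (Real.sqrt_lt' one_pos).2 (by norm_num)
  have hL : 0 ≤ C + ‖S.b‖ := add_nonneg hR.nonneg (norm_nonneg _)
  rw [Metric.tendstoUniformlyOn_iff]
  intro ε hε
  have hlim : Tendsto (fun n : ℕ => (C + ‖S.b‖) * (3 + 2 * T) * √(1 / 2) ^ n / (1 - √(1 / 2)))
      atTop (𝓝 0) := by
    have := (tendsto_pow_atTop_nhds_zero_of_lt_one (Real.sqrt_nonneg (1 / 2)) hlt).const_mul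
      ((C + ‖S.b‖) * (3 + 2 * T))
    simpa using this.div_const (1 - √(1 / 2))
  filter_upwards [hlim.eventually (gt_mem_nhds hε)] with n hn t ht
  rw [dist_comm]
  refine lt_of_le_of_lt (dist_le_of_le_geometric_of_tendsto (√(1 / 2))
    ((C + ‖S.b‖) * (3 + 2 * T)) hlt (fun n => ?_) (hR.tendsto_approx hx ht.1) n) hn
  rw [dist_eq_norm]
  refine (hR.norm_approx_sub_succ_le hx n ht.1).trans ?_
  have := ht.2
  gcongr

variable (S) in
/-- Every point of `K` is a limit of points of regular sets. -/
def DenseRegular : Prop :=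
  ∀ x ∈ S.K, ∀ ε > 0, ∃ R C, S.IsRegularSet R C ∧ ∃ y ∈ R, ‖x - y‖ < ε

theorem DenseRegular.tendsto_approx (hS : S.DenseRegular) {x : H} (hx : x ∈ S.K) {t : ℝ}
    (ht : 0 ≤ t) : Tendsto (fun n => S.approx n t x) atTop (𝓝 (S.sol x t)) := by
  refine CauchySeq.tendsto_limUnder (Metric.cauchySeq_iff'.2 fun ε hε => ?_)
  obtain ⟨R, C, hR, y, hy, hxy⟩ := hS x hx (ε / 3) (by positivity)
  obtain ⟨N, hN⟩ := Metric.cauchySeq_iff'.1 (hR.tendsto_approx hy ht).cauchySeq (ε / 3)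
    (by positivity)
  refine ⟨N, fun n hn => ?_⟩
  have h1 := hN n hn
  rw [dist_eq_norm] at h1 ⊢
  have h2 := norm_approx_sub_approx_le (S := S) n t x y
  have h3 := norm_approx_sub_approx_le (S := S) N t x y
  have h4 := norm_sub_le_norm_sub_add_norm_sub (S.approx n t x) (S.approx n t y) (S.approx N t x)
  have h5 := norm_sub_le_norm_sub_add_norm_sub (S.approx n t y) (S.approx N t y) (S.approx N t x)
  rw [norm_sub_rev (S.approx N t y)] at h5
  linarith

theorem DenseRegular.norm_sol_sub_sol_le (hS : S.DenseRegular) {x y : H} (hx : x ∈ S.K)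
    (hy : y ∈ S.K) {t : ℝ} (ht : 0 ≤ t) : ‖S.sol x t - S.sol y t‖ ≤ ‖x - y‖ :=
  le_of_tendsto ((hS.tendsto_approx hx ht).sub (hS.tendsto_approx hy ht)).norm
    (Eventually.of_forall fun n => norm_approx_sub_approx_le n t x y)

theorem DenseRegular.sol_mem (hS : S.DenseRegular) {x : H} (hx : x ∈ S.K) {t : ℝ}
    (ht : 0 ≤ t) : S.sol x t ∈ S.K :=
  S.isClosed.mem_of_tendsto (hS.tendsto_approx hx ht)
    (Eventually.of_forall fun n => approx_mem n t hx)

theorem DenseRegular.sol_zero (hS : S.DenseRegular) {x : H} (hx : x ∈ S.K) : S.sol x 0 = x :=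
  tendsto_nhds_unique (hS.tendsto_approx hx le_rfl) (by simp [approx_zero])

theorem DenseRegular.tendstoUniformlyOn_approx (hS : S.DenseRegular) {x : H} (hx : x ∈ S.K)
    (T : ℝ) : TendstoUniformlyOn (fun n t => S.approx n t x) (S.sol x) atTop (Icc 0 T) := by
  rw [Metric.tendstoUniformlyOn_iff]
  intro ε hε
  obtain ⟨R, C, hR, y, hy, hxy⟩ := hS x hx (ε / 3) (by positivity)
  filter_upwards [Metric.tendstoUniformlyOn_iff.1 (hR.tendstoUniformlyOn_approx hy T) (ε / 3)
    (by positivity)] with n hn t ht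
  have h1 := hn t ht
  rw [dist_eq_norm] at h1 ⊢
  have h2 := norm_approx_sub_approx_le (S := S) n t x y
  have h3 := hS.norm_sol_sub_sol_le hx (hR.subset hy) ht.1
  have h4 := norm_sub_le_norm_sub_add_norm_sub (S.sol x t) (S.sol y t) (S.approx n t x)
  have h5 := norm_sub_le_norm_sub_add_norm_sub (S.sol y t) (S.approx n t y) (S.approx n t x)
  rw [norm_sub_rev (S.approx n t y)] at h5
  linarith

theorem IsRegularSet.norm_sol_sub_sol_le {R : Set H} {C : ℝ} (hR : S.IsRegularSet R C)
    {x : H} (hx : x ∈ R) {s t : ℝ} (hs : 0 ≤ s) (hst : s ≤ t) :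
    ‖S.sol x t - S.sol x s‖ ≤ (C + ‖S.b‖) * (t - s) := by
  have h2 : Tendsto (fun n : ℕ => ((2 : ℝ) ^ n)⁻¹) atTop (𝓝 0) := by
    simpa using tendsto_pow_atTop_nhds_zero_of_lt_one (r := (2 : ℝ)⁻¹) (by norm_num) (by norm_num)
  refine le_of_tendsto_of_tendsto
    ((hR.tendsto_approx hx (hs.trans hst)).sub (hR.tendsto_approx hx hs)).norm
    (b := (atTop : Filter ℕ)) (g := fun n => (C + ‖S.b‖) * (t - s + (2 ^ n)⁻¹)) ?_
    (Eventually.of_forall fun n => hR.norm_approx_sub_approx_le hx n hs hst)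
  simpa using (h2.const_add (t - s)).const_mul (C + ‖S.b‖)

theorem IsRegularSet.continuousOn_sol {R : Set H} {C : ℝ} (hR : S.IsRegularSet R C)
    {x : H} (hx : x ∈ R) : ContinuousOn (S.sol x) (Ici 0) := by
  have hL : 0 ≤ C + ‖S.b‖ := add_nonneg hR.nonneg (norm_nonneg _)
  refine LipschitzOnWith.continuousOn (K := ⟨C + ‖S.b‖, hL⟩)
    (LipschitzOnWith.of_dist_le_mul fun t ht s hs => ?_)
  change dist _ _ ≤ (C + ‖S.b‖) * _
  rw [dist_eq_norm, Real.dist_eq]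
  rcases le_total s t with hst | hst
  · rw [abs_of_nonneg (sub_nonneg.2 hst)]; exact hR.norm_sol_sub_sol_le hx hs hst
  · rw [norm_sub_rev, abs_sub_comm, abs_of_nonneg (sub_nonneg.2 hst)]
    exact hR.norm_sol_sub_sol_le hx ht hst

theorem DenseRegular.continuousOn_sol (hS : S.DenseRegular) {x : H} (hx : x ∈ S.K) :
    ContinuousOn (S.sol x) (Ici 0) := by
  refine continuousOn_of_uniform_approx_of_continuousOn fun u hu => ?_
  obtain ⟨ε, hε, hεu⟩ := Metric.mem_uniformity_dist.1 hu
  obtain ⟨R, C, hR, y, hy, hxy⟩ := hS x hx ε hε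
  refine ⟨S.sol y, hR.continuousOn_sol hy, fun t ht => hεu ?_⟩
  rw [dist_eq_norm]
  exact (hS.norm_sol_sub_sol_le hx (hR.subset hy) ht).trans_lt hxy

end Splitting

end
end LevelSet

namespace LevelSet
noncomputable section
open scoped ContDiff Topology
open Set Filter

open scoped InnerProductSpace

variable {H : Type*} [NormedAddCommGroup H] [InnerProductSpace ℝ H]

theorem sub_le_integral_of_slope_le_Ici {φ ψ : ℝ → ℝ} (hφ : ContinuousOn φ (Ici 0))
    (hψ : ContinuousOn ψ (Ici 0))
    (h : ∀ s, 0 ≤ s → ∀ ε > 0, ∀ᶠ t in 𝓝[>] s, φ t - φ s ≤ (t - s) * (ψ s + ε))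
    {s t : ℝ} (hs : 0 ≤ s) (hst : s ≤ t) :
    φ t - φ s ≤ ∫ r in s..t, ψ r := by
  rw [← intervalIntegral_comp_max_zero ψ hs (hs.trans hst)]
  refine sub_le_integral_of_slope_le hst (hφ.mono fun r hr => hs.trans hr.1)
    (continuous_comp_max_zero hψ) fun r hr ε hε => ?_
  rw [max_eq_left (hs.trans hr.1)]
  exact h r (hs.trans hr.1) ε hε

theorem norm_sq_add_le {p p₀ g ρ : H} {h ε : ℝ} (hh : 0 ≤ h) (hε : 0 ≤ ε)
    (hp : ‖p - p₀‖ ≤ ε) (hρ : ‖ρ‖ ≤ h * ε) :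
    ‖p + h • g + ρ‖ ^ 2 ≤ ‖p‖ ^ 2
      + h * (2 * ⟪p₀, g⟫_ℝ + (2 * ε * ‖g‖ + 2 * ε * (‖p₀‖ + ε) + h * (‖g‖ + ε) ^ 2)) := by
  have h1 : ‖p + h • g + ρ‖ ^ 2 = ‖p‖ ^ 2 + 2 * ⟪p, h • g + ρ⟫_ℝ + ‖h • g + ρ‖ ^ 2 := by
    rw [add_assoc, norm_add_sq_real]
  have h2 : ⟪p, h • g + ρ⟫_ℝ = h * ⟪p₀, g⟫_ℝ + h * ⟪p - p₀, g⟫_ℝ + ⟪p, ρ⟫_ℝ := by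
    rw [inner_add_right, real_inner_smul_right, inner_sub_left]; ring
  have h3 : ⟪p - p₀, g⟫_ℝ ≤ ε * ‖g‖ :=
    (real_inner_le_norm _ _).trans (by gcongr)
  have h4 : ‖p‖ ≤ ‖p₀‖ + ε := by
    have := norm_le_norm_add_norm_sub p₀ p
    rw [norm_sub_rev] at this
    linarith
  have h5 : ⟪p, ρ⟫_ℝ ≤ (‖p₀‖ + ε) * (h * ε) :=
    (real_inner_le_norm _ _).trans (by gcongr)
  have h6 : ‖h • g + ρ‖ ≤ h * (‖g‖ + ε) := by
    refine (norm_add_le _ _).trans ?_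
    rw [norm_smul, Real.norm_of_nonneg hh]
    linarith
  have h7 : ‖h • g + ρ‖ ^ 2 ≤ (h * (‖g‖ + ε)) ^ 2 := by gcongr
  rw [h1, h2]
  nlinarith

theorem tendsto_floor_mul_inv {t : ℝ} (ht : 0 ≤ t) :
    Tendsto (fun n : ℕ => (⌊2 ^ n * t⌋₊ : ℝ) * (2 ^ n)⁻¹) atTop (𝓝 t) := by
  have h := (tendsto_nat_floor_mul_div_atTop ht).comp
    (tendsto_pow_atTop_atTop_of_one_lt (r := (2 : ℝ)) (by norm_num))
  refine h.congr fun n => ?_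
  simp [div_eq_mul_inv, mul_comm]

namespace Splitting

variable [CompleteSpace H] {S : Splitting H}

/-- The inequality satisfied by one step of the scheme with respect to a moving point of `K`. -/
theorem norm_sq_step_sub_le {x z z' : H} (hz' : z' ∈ S.K) {h : ℝ} :
    ‖S.step h x - z'‖ ^ 2 ≤ ‖(x - z) + h • S.b - (S.U (-h) z' - z)‖ ^ 2 := by
  have h1 := S.norm_proj_sub_proj_le (S.U h x + h • S.b) z'
  rw [S.proj_of_mem hz'] at h1
  have h2 : ‖S.U h x + h • S.b - z'‖ = ‖(x - z) + h • S.b - (S.U (-h) z' - z)‖ := by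
    rw [← (S.U h).norm_map ((x - z) + h • S.b - (S.U (-h) z' - z))]
    simp only [map_add, map_sub, map_smul, S.U_b, S.U_U_neg]
    congr 1; abel
  rw [← h2]
  exact pow_le_pow_left₀ (norm_nonneg _) h1 2

theorem eventually_norm_sq_sol_sub_le (hS : S.DenseRegular) {x : H} (hx : x ∈ S.K)
    {z B : ℝ → H} (hz : Continuous z) (hzK : ∀ t, 0 ≤ t → z t ∈ S.K) (hB : Continuous B)
    (hUB : Continuous fun t => S.U (-t) (B t))
    (hd : ∀ t, HasDerivAt (fun s => S.U (-s) (z s)) (S.U (-t) (B t)) t)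
    {t₀ : ℝ} (ht₀ : 0 ≤ t₀) {δ : ℝ} (hδ : 0 < δ) :
    ∀ᶠ t in 𝓝[>] t₀, ‖S.sol x t - z t‖ ^ 2 - ‖S.sol x t₀ - z t₀‖ ^ 2
      ≤ (t - t₀) * (2 * ⟪S.sol x t₀ - z t₀, S.b - B t₀⟫_ℝ + δ) := by
  set p₀ := S.sol x t₀ - z t₀ with hp₀
  set g := S.b - B t₀ with hg
  obtain ⟨ε, hε, hεδ⟩ : ∃ ε > 0, 2 * ε * ‖g‖ + 2 * ε * (‖p₀‖ + ε) + ε * (‖g‖ + ε) ^ 2 < δ := by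
    have hc : Continuous fun ε : ℝ =>
        2 * ε * ‖g‖ + 2 * ε * (‖p₀‖ + ε) + ε * (‖g‖ + ε) ^ 2 := by fun_prop
    have : ∀ᶠ ε in 𝓝[>] (0 : ℝ),
        2 * ε * ‖g‖ + 2 * ε * (‖p₀‖ + ε) + ε * (‖g‖ + ε) ^ 2 < δ := by
      refine (hc.tendsto 0).mono_left nhdsWithin_le_nhds |>.eventually (gt_mem_nhds ?_)
      simpa using hδ
    obtain ⟨ε, h1, h2⟩ := (this.and self_mem_nhdsWithin).exists
    exact ⟨ε, h2, h1⟩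
  set ε' := ε / 4 with hε'
  have hε'0 : 0 < ε' := by positivity
  have hSc := hS.continuousOn_sol hx
  obtain ⟨ν, hν, hwin⟩ : ∃ ν > 0, ∀ r, 0 ≤ r → |r - t₀| < ν → ‖S.sol x r - S.sol x t₀‖ < ε' ∧
      ‖z r - z t₀‖ < ε' ∧ ‖B r - B t₀‖ < ε' ∧ ‖S.U (-r) (B r) - S.U (-t₀) (B t₀)‖ < ε' := by
    have e1 := Metric.continuousWithinAt_iff.1 (hSc t₀ ht₀) ε' hε'0
    obtain ⟨ν₁, hν₁, h1⟩ := e1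
    obtain ⟨ν₂, hν₂, h2⟩ := Metric.continuousAt_iff.1 (hz.continuousAt (x := t₀)) ε' hε'0
    obtain ⟨ν₃, hν₃, h3⟩ := Metric.continuousAt_iff.1 (hB.continuousAt (x := t₀)) ε' hε'0
    obtain ⟨ν₄, hν₄, h4⟩ := Metric.continuousAt_iff.1 (hUB.continuousAt (x := t₀)) ε' hε'0
    refine ⟨min (min ν₁ ν₂) (min ν₃ ν₄), by positivity, fun r hr hrt => ?_⟩
    simp only [lt_min_iff] at hrt
    rw [← Real.dist_eq] at hrt
    simp only [← dist_eq_norm]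
    exact ⟨h1 hr hrt.1.1, h2 hrt.1.2, h3 hrt.2.1, h4 hrt.2.2⟩
  -- one step of the scheme inside the window
  have hstep : ∀ᶠ n : ℕ in atTop, ∀ k : ℕ, |(k : ℝ) * (2 ^ n)⁻¹ - t₀| < ν →
      |((k + 1 : ℕ) : ℝ) * (2 ^ n)⁻¹ - t₀| < ν →
      ‖(S.step ((2 ^ n)⁻¹))^[k + 1] x - z ((k + 1 : ℕ) * (2 ^ n)⁻¹)‖ ^ 2
        ≤ ‖(S.step ((2 ^ n)⁻¹))^[k] x - z (k * (2 ^ n)⁻¹)‖ ^ 2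
          + (2 ^ n)⁻¹ * (2 * ⟪p₀, g⟫_ℝ + δ) := by
    have h2 : Tendsto (fun n : ℕ => ((2 : ℝ) ^ n)⁻¹) atTop (𝓝 0) := by
      simpa using
        tendsto_pow_atTop_nhds_zero_of_lt_one (r := (2 : ℝ)⁻¹) (by norm_num) (by norm_num)
    have hu := Metric.tendstoUniformlyOn_iff.1 (hS.tendstoUniformlyOn_approx hx (t₀ + ν)) ε' hε'0
    filter_upwards [hu, h2.eventually (gt_mem_nhds hε)] with n hn hnε k hk hk1
    set h : ℝ := (2 ^ n)⁻¹ with hh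
    have hh0 : 0 ≤ h := by positivity
    set τ : ℝ := k * h with hτ
    have hτ0 : 0 ≤ τ := by positivity
    have hτ1 : ((k + 1 : ℕ) : ℝ) * h = τ + h := by push_cast; ring
    rw [hτ1] at hk1 ⊢
    rw [Function.iterate_succ_apply']
    set xk := (S.step h)^[k] x with hxk
    refine (norm_sq_step_sub_le (z := z τ) (hzK _ (by positivity))).trans ?_
    -- the remainder in the expansion of the moving point
    have hmv : ‖S.U (-(τ + h)) (z (τ + h)) - S.U (-τ) (z τ) - h • S.U (-t₀) (B t₀)‖ ≤ h * ε' := by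
      have hder : ∀ r ∈ Icc τ (τ + h), HasDerivWithinAt
          (fun s => S.U (-s) (z s) - s • S.U (-t₀) (B t₀))
          (S.U (-r) (B r) - S.U (-t₀) (B t₀)) (Icc τ (τ + h)) r := fun r _ => by
        have := (hd r).fun_sub ((hasDerivAt_id r).smul_const (S.U (-t₀) (B t₀)))
        simpa using this.hasDerivWithinAt
      have hbd : ∀ r ∈ Icc τ (τ + h), ‖S.U (-r) (B r) - S.U (-t₀) (B t₀)‖ ≤ ε' := fun r hr => by
        refine (hwin r (hτ0.trans hr.1) ?_).2.2.2.le
        rw [abs_lt] at hk hk1 ⊢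
        constructor <;> linarith [hr.1, hr.2]
      have := (convex_Icc τ (τ + h)).norm_image_sub_le_of_norm_hasDerivWithin_le hder hbd
        (left_mem_Icc.2 (by linarith)) (right_mem_Icc.2 (by linarith))
      rw [Real.norm_eq_abs, add_sub_cancel_left, abs_of_nonneg hh0, mul_comm ε'] at this
      refine le_trans (le_of_eq ?_) this
      congr 1
      rw [add_smul]; abel
    have hmv' : ‖S.U (-h) (z (τ + h)) - z τ - h • B t₀‖ ≤ h * (3 * ε') := by
      have w := hwin τ hτ0 hk
      have e1 : S.U (-h) (z (τ + h)) - z τ - h • B t₀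
          = S.U τ (S.U (-(τ + h)) (z (τ + h)) - S.U (-τ) (z τ) - h • S.U (-t₀) (B t₀))
            - h • S.U τ (S.U (-τ) (B τ) - S.U (-t₀) (B t₀)) + h • (B τ - B t₀) := by
        simp only [map_sub, map_smul, S.U_U_neg]
        rw [← S.U_add τ (-(τ + h)), show τ + -(τ + h) = -h by ring]
        module
      rw [e1]
      refine (norm_add_le _ _).trans ?_
      have e2 : ‖h • (B τ - B t₀)‖ ≤ h * ε' := by
        rw [norm_smul, Real.norm_of_nonneg hh0]; gcongr; exact w.2.2.1.le
      have e3 : ‖h • S.U τ (S.U (-τ) (B τ) - S.U (-t₀) (B t₀))‖ ≤ h * ε' := by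
        rw [norm_smul, Real.norm_of_nonneg hh0, LinearIsometry.norm_map]
        gcongr; exact w.2.2.2.le
      have e4 := norm_sub_le (S.U τ (S.U (-(τ + h)) (z (τ + h)) - S.U (-τ) (z τ)
        - h • S.U (-t₀) (B t₀))) (h • S.U τ (S.U (-τ) (B τ) - S.U (-t₀) (B t₀)))
      rw [LinearIsometry.norm_map] at e4
      linarith
    have hpp : ‖(xk - z τ) - p₀‖ ≤ ε := by
      have w := hwin τ hτ0 hk
      have a1 : ‖S.sol x τ - xk‖ < ε' := by
        have := hn τ ⟨hτ0, by linarith [(abs_lt.1 hk).2]⟩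
        rwa [dist_eq_norm, hτ, hh, approx_nat_mul] at this
      have e1 : (xk - z τ) - p₀ = (S.sol x τ - S.sol x t₀) - (S.sol x τ - xk) - (z τ - z t₀) := by
        rw [hp₀]; abel
      rw [e1]
      have b1 := norm_sub_le ((S.sol x τ - S.sol x t₀) - (S.sol x τ - xk)) (z τ - z t₀)
      have b2 := norm_sub_le (S.sol x τ - S.sol x t₀) (S.sol x τ - xk)
      linarith [w.1, w.2.1]
    have e5 : (xk - z τ) + h • S.b - (S.U (-h) (z (τ + h)) - z τ)
        = (xk - z τ) + h • g + -(S.U (-h) (z (τ + h)) - z τ - h • B t₀) := by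
      rw [hg]; module
    have hρ : ‖-(S.U (-h) (z (τ + h)) - z τ - h • B t₀)‖ ≤ h * ε := by
      rw [norm_neg]; refine hmv'.trans ?_; gcongr; linarith
    rw [e5]
    refine (norm_sq_add_le hh0 hε.le hpp hρ).trans ?_
    have e6 : h * (‖g‖ + ε) ^ 2 ≤ ε * (‖g‖ + ε) ^ 2 := by gcongr
    gcongr
    linarith
  have hwt : ∀ᶠ t in 𝓝[>] t₀, t ∈ Ioo t₀ (t₀ + ν) := Ioo_mem_nhdsGT (by linarith)
  filter_upwards [hwt] with t ht
  have ht0 : 0 ≤ t := ht₀.trans ht.1.le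
  have hft := tendsto_floor_mul_inv ht0
  have hft₀ := tendsto_floor_mul_inv ht₀
  have l1 : Tendsto (fun n => ‖S.approx n t x - z (⌊2 ^ n * t⌋₊ * (2 ^ n)⁻¹)‖ ^ 2) atTop
      (𝓝 (‖S.sol x t - z t‖ ^ 2)) :=
    ((hS.tendsto_approx hx ht0).sub ((hz.tendsto t).comp hft)).norm.pow 2
  have l2 : Tendsto (fun n => ‖S.approx n t₀ x - z (⌊2 ^ n * t₀⌋₊ * (2 ^ n)⁻¹)‖ ^ 2) atTop
      (𝓝 (‖S.sol x t₀ - z t₀‖ ^ 2)) :=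
    ((hS.tendsto_approx hx ht₀).sub ((hz.tendsto t₀).comp hft₀)).norm.pow 2
  have l3 := (hft.sub hft₀).mul_const (2 * ⟪p₀, g⟫_ℝ + δ)
  refine le_of_tendsto_of_tendsto (l1.sub l2) l3 ?_
  have c1 := hft.eventually (lt_mem_nhds (show t₀ - ν < t by linarith [ht.1]))
  have c2 := hft.eventually (gt_mem_nhds (show t < t₀ + ν from ht.2))
  have c3 := hft₀.eventually (lt_mem_nhds (show t₀ - ν < t₀ by linarith))
  filter_upwards [hstep, c2, c3] with n hn hc2 hc3
  have hle : ⌊2 ^ n * t₀⌋₊ ≤ ⌊2 ^ n * t⌋₊ :=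
    Nat.floor_le_floor (mul_le_mul_of_nonneg_left ht.1.le (by positivity))
  obtain ⟨j, hj⟩ := Nat.exists_eq_add_of_le hle
  have hp : (0 : ℝ) < (2 ^ n)⁻¹ := by positivity
  have ind : ∀ i ≤ j,
      ‖(S.step ((2 ^ n)⁻¹))^[⌊2 ^ n * t₀⌋₊ + i] x
        - z ((⌊2 ^ n * t₀⌋₊ + i : ℕ) * (2 ^ n)⁻¹)‖ ^ 2
      ≤ ‖(S.step ((2 ^ n)⁻¹))^[⌊2 ^ n * t₀⌋₊] x - z (⌊2 ^ n * t₀⌋₊ * (2 ^ n)⁻¹)‖ ^ 2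
        + i * ((2 ^ n)⁻¹ * (2 * ⟪p₀, g⟫_ℝ + δ)) := by
    intro i
    induction i with
    | zero => intro _; simp
    | succ i ih =>
      intro hi
      have hrange : ∀ m : ℕ, ⌊2 ^ n * t₀⌋₊ ≤ m → m ≤ ⌊2 ^ n * t⌋₊ →
          |(m : ℝ) * (2 ^ n)⁻¹ - t₀| < ν := by
        intro m h1 h2
        have a1 : (⌊2 ^ n * t₀⌋₊ : ℝ) * (2 ^ n)⁻¹ ≤ m * (2 ^ n)⁻¹ := by gcongr
        have a2 : (m : ℝ) * (2 ^ n)⁻¹ ≤ ⌊2 ^ n * t⌋₊ * (2 ^ n)⁻¹ := by gcongr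
        rw [abs_lt]; constructor <;> linarith
      have := hn (⌊2 ^ n * t₀⌋₊ + i) (hrange _ (by omega) (by omega))
        (hrange _ (by omega) (by omega))
      rw [← add_assoc]
      have ih' := ih (by omega)
      push_cast at this ih' ⊢
      linarith
  have fin := ind j le_rfl
  rw [← hj] at fin
  unfold approx
  have hjr : (⌊2 ^ n * t⌋₊ : ℝ) = ⌊2 ^ n * t₀⌋₊ + j := by rw [hj]; push_cast; ring
  rw [← sub_mul, hjr, add_sub_cancel_left, ← hjr]
  linarith

/-- The solution produced by the scheme satisfies the integral inequality with respect to all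
regular moving points of `K`. -/
theorem norm_sq_sol_sub_le_integral (hS : S.DenseRegular) {x : H} (hx : x ∈ S.K)
    {z B : ℝ → H} (hz : Continuous z) (hzK : ∀ t, 0 ≤ t → z t ∈ S.K) (hB : Continuous B)
    (hUB : Continuous fun t => S.U (-t) (B t))
    (hd : ∀ t, HasDerivAt (fun s => S.U (-s) (z s)) (S.U (-t) (B t)) t)
    {s t : ℝ} (hs : 0 ≤ s) (hst : s ≤ t) :
    ‖S.sol x t - z t‖ ^ 2 - ‖S.sol x s - z s‖ ^ 2
      ≤ ∫ r in s..t, 2 * ⟪S.sol x r - z r, S.b - B r⟫_ℝ := by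
  have hc := hS.continuousOn_sol hx
  have hzc : ContinuousOn z (Ici 0) := hz.continuousOn
  have hBc : ContinuousOn B (Ici 0) := hB.continuousOn
  refine sub_le_integral_of_slope_le_Ici (φ := fun t => ‖S.sol x t - z t‖ ^ 2)
    ((hc.sub hzc).norm.pow 2)
    (continuousOn_const.mul ((hc.sub hzc).inner (continuousOn_const.sub hBc))) ?_ hs hst
  intro s hs ε hε
  exact eventually_norm_sq_sol_sub_le hS hx hz hzK hB hUB hd hs hε

end Splitting

end
end LevelSet

namespace LevelSet
noncomputable section
open scoped ContDiff Topology
open Set Filter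

open scoped InnerProductSpace

variable {H : Type*} [NormedAddCommGroup H] [InnerProductSpace ℝ H]

/-- Integral solutions of `b ∈ du/dt + A u + ∂K(u)`, where `G` is the graph of `A`. -/
structure IsIntegralSolution (K : Set H) (G : Set (H × H)) (b : H) (u : ℝ → H) : Prop where
  continuousOn : ContinuousOn u (Ici 0)
  mem : ∀ t, 0 ≤ t → u t ∈ K
  le_integral : ∀ Z g, Z ∈ K → (Z, g) ∈ G → ∀ s t, 0 ≤ s → s ≤ t →
    ‖u t - Z‖ ^ 2 - ‖u s - Z‖ ^ 2 ≤ ∫ r in s..t, 2 * ⟪u r - Z, b - g⟫_ℝ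

theorem eventually_integral_le {ψ : ℝ → ℝ} {s δ : ℝ} (hs : 0 ≤ s)
    (hψ : ContinuousOn ψ (Ici 0)) (hδ : 0 < δ) :
    ∀ᶠ t in 𝓝[>] s, ∫ r in s..t, ψ r ≤ (t - s) * (ψ s + δ) := by
  obtain ⟨η, hη, h⟩ := Metric.continuousWithinAt_iff.1 (hψ s hs) δ hδ
  have hw : ∀ᶠ t in 𝓝[>] s, t ∈ Ioo s (s + η) := Ioo_mem_nhdsGT (by linarith)
  filter_upwards [hw] with t ht
  have hsub : uIcc s t ⊆ Ici 0 := by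
    rw [uIcc_of_le ht.1.le]; exact fun r hr => hs.trans hr.1
  have hle : ∫ r in s..t, ψ r ≤ ∫ _ in s..t, (ψ s + δ) := by
    refine intervalIntegral.integral_mono_on ht.1.le (hψ.mono hsub).intervalIntegrable
      intervalIntegrable_const fun r hr => ?_
    have : dist (ψ r) (ψ s) < δ := h (hs.trans hr.1) (by
      rw [Real.dist_eq, abs_of_nonneg (sub_nonneg.2 hr.1)]; linarith [hr.2, ht.2])
    rw [Real.dist_eq] at this
    linarith [(abs_lt.1 this).2]
  simpa only [intervalIntegral.integral_const, smul_eq_mul] using hle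

namespace IsIntegralSolution

variable {K : Set H} {G : Set (H × H)} {b : H} {u : ℝ → H}

theorem eventually_le (hu : IsIntegralSolution K G b u) {Z g : H} (hZ : Z ∈ K)
    (hG : (Z, g) ∈ G) {s δ : ℝ} (hs : 0 ≤ s) (hδ : 0 < δ) :
    ∀ᶠ t in 𝓝[>] s, ‖u t - Z‖ ^ 2 - ‖u s - Z‖ ^ 2 ≤ (t - s) * (2 * ⟪u s - Z, b - g⟫_ℝ + δ) := by
  have hc : ContinuousOn (fun r => 2 * ⟪u r - Z, b - g⟫_ℝ) (Ici 0) :=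
    continuousOn_const.mul ((hu.continuousOn.sub continuousOn_const).inner continuousOn_const)
  filter_upwards [eventually_integral_le hs hc hδ, self_mem_nhdsWithin] with t ht hst
  exact (hu.le_integral Z g hZ hG s t hs (le_of_lt hst)).trans ht

/-- An integral solution is differentiable from the right at every time at which its value
belongs to the domain of `A`. -/
theorem exists_hasDerivWithinAt [CompleteSpace H] (hu : IsIntegralSolution K G b u)
    (hK : Convex ℝ K) (hG : Convex ℝ G)
    (hdense : ∀ Z ∈ K, ∀ ε > 0, ∃ Z' ∈ K, ‖Z - Z'‖ < ε ∧ ∃ g, (Z', g) ∈ G)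
    {t₀ : ℝ} (ht₀ : 0 ≤ t₀) {g₀ : H} (hg₀ : (u t₀, g₀) ∈ G) :
    ∃ v, HasDerivWithinAt u v (Ici t₀) t₀ ∧ ‖v‖ ≤ ‖b - g₀‖ ∧
      ∀ w ∈ K, ⟪b - g₀ - v, w - u t₀⟫_ℝ ≤ 0 := by
  set u₀ := u t₀ with hu₀
  set g := b - g₀ with hg
  have hu₀K : u₀ ∈ K := hu.mem t₀ ht₀
  set C : Set H := {y | ∃ c : ℝ, 0 ≤ c ∧ ∃ Z ∈ K, y = c • (Z - u₀)} with hC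
  have hCconv : Convex ℝ C := by
    rintro _ ⟨c, hc, Z, hZ, rfl⟩ _ ⟨c', hc', Z', hZ', rfl⟩ α β hα hβ hαβ
    rcases eq_or_lt_of_le (show 0 ≤ α * c + β * c' by positivity) with h0 | h0
    · have h1 : α * c = 0 := by nlinarith [mul_nonneg hα hc, mul_nonneg hβ hc']
      have h2 : β * c' = 0 := by nlinarith [mul_nonneg hα hc, mul_nonneg hβ hc']
      exact ⟨0, le_rfl, u₀, hu₀K, by rw [smul_smul, smul_smul, h1, h2]; simp⟩
    · refine ⟨α * c + β * c', h0.le,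
        (α * c / (α * c + β * c')) • Z + (β * c' / (α * c + β * c')) • Z',
        hK hZ hZ' (by positivity) (by positivity) (by field_simp), ?_⟩
      rw [smul_sub (α * c + β * c'), smul_add (α * c + β * c'), smul_smul _ _ Z, smul_smul _ _ Z',
        mul_div_cancel₀ _ h0.ne', mul_div_cancel₀ _ h0.ne']
      module
  have hCsmul : ∀ r : ℝ, 0 ≤ r → ∀ y ∈ closure C, r • y ∈ closure C := by
    intro r hr y hy
    refine map_mem_closure (continuous_const_smul r) hy ?_
    rintro _ ⟨c, hc, Z, hZ, rfl⟩
    exact ⟨r * c, by positivity, Z, hZ, by rw [smul_smul]⟩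
  have h0C : (0 : H) ∈ closure C := subset_closure ⟨0, le_rfl, u₀, hu₀K, by simp⟩
  obtain ⟨v, hv, hvmin⟩ := exists_mem_forall_inner_le_zero ⟨0, h0C⟩ isClosed_closure
    hCconv.closure g
  have hgv : ⟪g - v, v⟫_ℝ = 0 := by
    have h1 := hvmin 0 h0C
    have h2 := hvmin ((2 : ℝ) • v) (hCsmul 2 (by norm_num) v hv)
    rw [zero_sub, inner_neg_right] at h1
    rw [two_smul, add_sub_cancel_right] at h2
    linarith
  have hpolar : ∀ w ∈ K, ⟪g - v, w - u₀⟫_ℝ ≤ 0 := by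
    intro w hw
    have h1 := hvmin (w - u₀) (subset_closure ⟨1, zero_le_one, w, hw, by simp⟩)
    rw [inner_sub_right] at h1
    linarith
  have hgv' : ⟪g, v⟫_ℝ = ‖v‖ ^ 2 := by
    rw [inner_sub_left, real_inner_self_eq_norm_sq] at hgv; linarith
  have hvg : ‖v‖ ≤ ‖g‖ := by
    have h1 := real_inner_le_norm g v
    by_contra! hlt
    nlinarith [norm_nonneg g]
  refine ⟨v, ?_, hvg, hpolar⟩
  set m := ‖v‖ with hm
  have hm0 : 0 ≤ m := norm_nonneg v
  have hub : ∀ t, t₀ < t → ‖u t - u₀‖ ≤ m * (t - t₀) := by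
    intro t ht
    have := sqrt_le_of_slope_le (φ := fun r => ‖u r - u₀‖ ^ 2) (a := t₀) (b := t) ht.le hm0
      (((hu.continuousOn.mono fun r hr => ht₀.trans hr.1).sub continuousOn_const).norm.pow 2)
      (fun r => sq_nonneg _) (fun s hs ε hε => by
        filter_upwards [hu.eventually_le hu₀K hg₀ (ht₀.trans hs.1) hε, self_mem_nhdsWithin]
          with r hr hsr
        refine hr.trans (mul_le_mul_of_nonneg_left ?_ (sub_nonneg.2 (le_of_lt hsr)))
        rw [Real.sqrt_sq (norm_nonneg _)]
        have h1 := hpolar (u s) (hu.mem s (ht₀.trans hs.1))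
        have h2 := real_inner_le_norm (u s - u₀) v
        rw [real_inner_comm, inner_sub_right] at h1
        change 2 * ⟪u s - u₀, g⟫_ℝ + ε ≤ _
        nlinarith)
    simpa [Real.sqrt_sq (norm_nonneg _), ← hu₀] using this
  have hlb : ∀ Z ∈ K, ∀ gZ, (Z, gZ) ∈ G → ∀ ε > 0, ∀ᶠ t in 𝓝[>] t₀,
      (t - t₀) * (⟪g, Z - u₀⟫_ℝ - ε) ≤ ⟪u t - u₀, Z - u₀⟫_ℝ := by
    intro Z hZ gZ hgZ ε hε
    set c := ⟪Z - u₀, gZ - g₀⟫_ℝ with hc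
    obtain ⟨θ, hθ0, hθ1, hθc⟩ : ∃ θ : ℝ, 0 < θ ∧ θ ≤ 1 ∧ θ * |c| ≤ ε / 2 := by
      refine ⟨min 1 (ε / (2 * (|c| + 1))), by positivity, min_le_left _ _, ?_⟩
      calc min 1 (ε / (2 * (|c| + 1))) * |c| ≤ ε / (2 * (|c| + 1)) * (|c| + 1) := by
            gcongr
            · exact min_le_right _ _
            · linarith
        _ = ε / 2 := by field_simp
    have hmem : (u₀ + θ • (Z - u₀), g₀ + θ • (gZ - g₀)) ∈ G := by
      have := hG hg₀ hgZ (sub_nonneg.2 hθ1) hθ0.le (by ring)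
      convert this using 1
      rw [Prod.smul_mk, Prod.smul_mk, Prod.mk_add_mk]
      congr 1 <;> module
    have hmemK : u₀ + θ • (Z - u₀) ∈ K := by
      have := hK hu₀K hZ (sub_nonneg.2 hθ1) hθ0.le (by ring)
      convert this using 1; module
    filter_upwards [hu.eventually_le hmemK hmem ht₀ (mul_pos hθ0 hε), self_mem_nhdsWithin]
      with t ht htt
    have htt' : 0 < t - t₀ := sub_pos.2 htt
    have e1 : u t - (u₀ + θ • (Z - u₀)) = (u t - u₀) - θ • (Z - u₀) := by abel
    have e2 : u₀ - (u₀ + θ • (Z - u₀)) = -(θ • (Z - u₀)) := by abel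
    have e3 : b - (g₀ + θ • (gZ - g₀)) = g - θ • (gZ - g₀) := by rw [hg]; abel
    rw [← hu₀, e1, e2, e3, norm_sub_sq_real, norm_neg, inner_neg_left, real_inner_smul_left,
      inner_sub_right, real_inner_smul_right, real_inner_smul_right, ← hc,
      real_inner_comm g (Z - u₀)] at ht
    have h1 : 0 ≤ ‖u t - u₀‖ ^ 2 := sq_nonneg _
    have h2 : θ * c ≤ ε / 2 := (mul_le_mul_of_nonneg_left (le_abs_self c) hθ0.le).trans hθc
    have h3 : θ * ((t - t₀) * (⟪g, Z - u₀⟫_ℝ - θ * c - ε / 2)) ≤ θ * ⟪u t - u₀, Z - u₀⟫_ℝ := by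
      nlinarith
    have h4 := le_of_mul_le_mul_left h3 hθ0
    refine le_trans (mul_le_mul_of_nonneg_left ?_ htt'.le) h4
    linarith
  rw [← hasDerivWithinAt_Ioi_iff_Ici, hasDerivWithinAt_iff_tendsto_slope' (by simp),
    Metric.tendsto_nhds]
  intro ε hε
  -- approximation of `v` by directions pointing to regular elements of `K`
  obtain ⟨δ, hδ, hδε⟩ : ∃ δ > 0, 2 * (δ * (1 + m + ‖g‖)) < ε ^ 2 := by
    refine ⟨ε ^ 2 / (4 * (1 + m + ‖g‖)), by positivity, ?_⟩
    have : ε ^ 2 / (4 * (1 + m + ‖g‖)) * (1 + m + ‖g‖) = ε ^ 2 / 4 := by field_simp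
    rw [this]
    nlinarith [sq_pos_of_pos hε]
  obtain ⟨c, hc, Z, hZK, gZ, hgZ, hcv⟩ : ∃ c : ℝ, 0 ≤ c ∧ ∃ Z ∈ K, ∃ gZ, (Z, gZ) ∈ G ∧
      ‖v - c • (Z - u₀)‖ ≤ δ := by
    obtain ⟨y, ⟨c, hc, Z, hZ, rfl⟩, hy⟩ := Metric.mem_closure_iff.1 hv (δ / 2) (by positivity)
    obtain ⟨Z', hZ', hZZ', gZ, hgZ⟩ := hdense Z hZ (δ / (2 * (c + 1))) (by positivity)
    refine ⟨c, hc, Z', hZ', gZ, hgZ, ?_⟩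
    rw [dist_eq_norm] at hy
    have e1 : v - c • (Z' - u₀) = (v - c • (Z - u₀)) + c • (Z - Z') := by module
    have e2 : ‖c • (Z - Z')‖ ≤ δ / 2 := by
      rw [norm_smul, Real.norm_of_nonneg hc]
      calc c * ‖Z - Z'‖ ≤ (c + 1) * (δ / (2 * (c + 1))) := by gcongr; linarith
        _ = δ / 2 := by field_simp
    rw [e1]
    exact (norm_add_le _ _).trans (by linarith)
  filter_upwards [hlb Z hZK gZ hgZ (δ / (c + 1)) (by positivity), self_mem_nhdsWithin]
    with t ht htt
  have htt' : 0 < t - t₀ := sub_pos.2 htt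
  set vt := slope u t₀ t with hvt
  have hvteq : u t - u₀ = (t - t₀) • vt := by
    rw [hvt, slope_def_module, smul_smul, mul_inv_cancel₀ htt'.ne', one_smul]
  have n1 : ‖vt‖ ≤ m := by
    have := hub t htt
    rw [hvteq, norm_smul, Real.norm_of_nonneg htt'.le, mul_comm m] at this
    exact le_of_mul_le_mul_left this htt'
  have n2 : ⟪g, Z - u₀⟫_ℝ - δ / (c + 1) ≤ ⟪vt, Z - u₀⟫_ℝ := by
    rw [hvteq, real_inner_smul_left] at ht
    exact le_of_mul_le_mul_left ht htt'
  have n3 : c * (δ / (c + 1)) ≤ δ := by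
    rw [mul_div_assoc', div_le_iff₀ (by positivity)]; nlinarith
  have n4 : ⟪g, c • (Z - u₀)⟫_ℝ - δ ≤ ⟪vt, c • (Z - u₀)⟫_ℝ := by
    rw [real_inner_smul_right, real_inner_smul_right]
    nlinarith [mul_le_mul_of_nonneg_left n2 hc]
  have n5 : ⟪vt, c • (Z - u₀)⟫_ℝ - m * δ ≤ ⟪vt, v⟫_ℝ := by
    have a1 := real_inner_le_norm vt (-(v - c • (Z - u₀)))
    rw [norm_neg, inner_neg_right, inner_sub_right] at a1
    have a2 := mul_le_mul n1 hcv (norm_nonneg _) hm0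
    linarith
  have n6 : m ^ 2 - ‖g‖ * δ ≤ ⟪g, c • (Z - u₀)⟫_ℝ := by
    have a1 := real_inner_le_norm g (v - c • (Z - u₀))
    rw [inner_sub_right, hgv'] at a1
    have a2 := mul_le_mul_of_nonneg_left hcv (norm_nonneg g)
    linarith
  rw [dist_eq_norm]
  have n7 : ‖vt - v‖ ^ 2 < ε ^ 2 := by
    rw [norm_sub_sq_real]
    have : ‖vt‖ ^ 2 ≤ m ^ 2 := by gcongr
    rw [← hm]
    nlinarith
  exact lt_of_pow_lt_pow_left₀ 2 hε.le n7

/-- Comparison of an integral solution with one that stays in the domain of `A`. -/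
theorem norm_sub_le [CompleteSpace H] (hu : IsIntegralSolution K G b u)
    (hK : Convex ℝ K) (hG : Convex ℝ G)
    (hdense : ∀ Z ∈ K, ∀ ε > 0, ∃ Z' ∈ K, ‖Z - Z'‖ < ε ∧ ∃ g, (Z', g) ∈ G)
    (hreg : ∀ t, 0 ≤ t → ∃ g, (u t, g) ∈ G)
    {b' : H} {w : ℝ → H} (hw : IsIntegralSolution K G b' w) {t : ℝ} (ht : 0 ≤ t) :
    ‖w t - u t‖ ≤ ‖w 0 - u 0‖ + t * ‖b' - b‖ := by
  have key := sqrt_le_of_slope_le (φ := fun r => ‖w r - u r‖ ^ 2) (a := 0) (b := t)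
    (m := ‖b' - b‖) ht (norm_nonneg _)
    (((hw.continuousOn.sub hu.continuousOn).mono fun r hr => hr.1).norm.pow 2)
    (fun r => sq_nonneg _) (fun s hs ε hε => by
      obtain ⟨g, hg⟩ := hreg s hs.1
      obtain ⟨v, hv, -, hvK⟩ := hu.exists_hasDerivWithinAt hK hG hdense hs.1 hg
      have h1 := hw.eventually_le (hu.mem s hs.1) hg hs.1 (half_pos hε)
      rw [← hasDerivWithinAt_Ioi_iff_Ici, hasDerivWithinAt_iff_tendsto_slope' (by simp)] at hv
      have hwc : Tendsto w (𝓝[>] s) (𝓝 (w s)) :=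
        (hw.continuousOn s hs.1).mono_left (nhdsWithin_mono s fun r hr => hs.1.trans (le_of_lt hr))
      have huc : Tendsto u (𝓝[>] s) (𝓝 (u s)) :=
        (hu.continuousOn s hs.1).mono_left (nhdsWithin_mono s fun r hr => hs.1.trans (le_of_lt hr))
      have h2 : Tendsto (fun r => -2 * ⟪w r - u s, slope u s r⟫_ℝ + ⟪u r - u s, slope u s r⟫_ℝ)
          (𝓝[>] s) (𝓝 (-2 * ⟪w s - u s, v⟫_ℝ + ⟪u s - u s, v⟫_ℝ)) :=
        (((hwc.sub_const _).inner hv).const_mul _).add ((huc.sub_const _).inner hv)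
      rw [sub_self, inner_zero_left, add_zero] at h2
      have h3 := h2.eventually (gt_mem_nhds
        (show -2 * ⟪w s - u s, v⟫_ℝ < -2 * ⟪w s - u s, v⟫_ℝ + ε / 2 by linarith))
      filter_upwards [h1, h3, self_mem_nhdsWithin] with r hr1 hr3 hsr
      have hrs : 0 < r - s := sub_pos.2 hsr
      have hsl : u r - u s = (r - s) • slope u s r := by
        rw [slope_def_module, smul_smul, mul_inv_cancel₀ hrs.ne', one_smul]
      have e1 : ‖w r - u r‖ ^ 2 = ‖w r - u s‖ ^ 2
          + (r - s) * (-2 * ⟪w r - u s, slope u s r⟫_ℝ + ⟪u r - u s, slope u s r⟫_ℝ) := by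
        have a1 : w r - u r = (w r - u s) - (u r - u s) := by abel
        have a2 : ‖u r - u s‖ ^ 2 = (r - s) * ⟪u r - u s, slope u s r⟫_ℝ := by
          rw [← real_inner_self_eq_norm_sq]
          nth_rewrite 2 [hsl]
          rw [real_inner_smul_right]
        have a3 : ⟪w r - u s, u r - u s⟫_ℝ = (r - s) * ⟪w r - u s, slope u s r⟫_ℝ := by
          rw [hsl, real_inner_smul_right]
        rw [a1, norm_sub_sq_real, a2, a3]; ring
      have e2 : ⟪w s - u s, b' - g⟫_ℝ - ⟪w s - u s, v⟫_ℝ ≤ ‖b' - b‖ * ‖w s - u s‖ := by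
        have a1 := hvK (w s) (hw.mem s hs.1)
        have a2 := real_inner_le_norm (w s - u s) (b' - b)
        rw [real_inner_comm] at a1
        simp only [inner_sub_right] at a1 a2 ⊢
        linarith
      rw [Real.sqrt_sq (norm_nonneg _), e1]
      have e3 := mul_le_mul_of_nonneg_left hr3.le hrs.le
      have e4 := mul_le_mul_of_nonneg_left e2 hrs.le
      nlinarith)
  simpa [Real.sqrt_sq (norm_nonneg _), mul_comm] using key

end IsIntegralSolution

end
end LevelSet

namespace LevelSet
noncomputable section
open scoped ContDiff Topology
open Set Filter

variable {d : ℕ}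

instance : IsProbabilityMeasure (volume : Measure UnitAddCircle) :=
  ⟨UnitAddCircle.measure_univ⟩

theorem toTorus_add (x y : Fin d → ℝ) : toTorus (x + y) = toTorus x + toTorus y := by
  ext i; simp [toTorus]

theorem toTorus_sub (x y : Fin d → ℝ) : toTorus (x - y) = toTorus x - toTorus y := by
  ext i; simp [toTorus]

theorem toTorus_zero : toTorus (0 : Fin d → ℝ) = 0 := by
  ext i; simp [toTorus]

theorem toTorus_smul_single (i : Fin d) (s : ℝ) :
    toTorus (s • (Pi.single i 1 : Fin d → ℝ)) = Pi.single i (s : UnitAddCircle) := by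
  ext j
  by_cases h : j = i
  · subst h; simp [toTorus]
  · simp [toTorus, h]

theorem isOpenQuotientMap_toTorus : IsOpenQuotientMap (toTorus : (Fin d → ℝ) → _) :=
  IsOpenQuotientMap.piMap fun _ => QuotientAddGroup.isOpenQuotientMap_mk

theorem continuous_toTorus : Continuous (toTorus : (Fin d → ℝ) → _) :=
  isOpenQuotientMap_toTorus.continuous

theorem toTorus_surjective : Function.Surjective (toTorus : (Fin d → ℝ) → _) :=
  isOpenQuotientMap_toTorus.surjective

theorem continuous_of_comp_toTorus {E : Type*} [TopologicalSpace E] {f : UnitAddTorus (Fin d) → E}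
    (hf : Continuous fun x => f (toTorus x)) : Continuous f :=
  isOpenQuotientMap_toTorus.isQuotientMap.continuous_iff.2 hf

theorem continuous_of_comp_prod_toTorus {E X : Type*} [TopologicalSpace E] [TopologicalSpace X]
    {f : X × UnitAddTorus (Fin d) → E}
    (hf : Continuous fun p : X × (Fin d → ℝ) => f (p.1, toTorus p.2)) : Continuous f :=
  (IsOpenQuotientMap.id.prodMap isOpenQuotientMap_toTorus).isQuotientMap.continuous_iff.2 hf

theorem torusDeriv_toTorus {f : UnitAddTorus (Fin d) → ℝ} {x : Fin d → ℝ}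
    (hf : DifferentiableAt ℝ (fun x => f (toTorus x)) x) (i : Fin d) :
    torusDeriv i f (toTorus x) = fderiv ℝ (fun x => f (toTorus x)) x (Pi.single i 1) := by
  have h1 : HasDerivAt (fun s : ℝ => x + s • (Pi.single i 1 : Fin d → ℝ)) (Pi.single i 1) 0 := by
    simpa using ((hasDerivAt_id (0 : ℝ)).smul_const (Pi.single i (1 : ℝ) : Fin d → ℝ)).const_add x
  have h2 : HasFDerivAt (fun x => f (toTorus x)) (fderiv ℝ (fun x => f (toTorus x)) x)
      (x + (0 : ℝ) • (Pi.single i 1 : Fin d → ℝ)) := by simpa using hf.hasFDerivAt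
  have h3 := (h2.comp_hasDerivAt (0 : ℝ) h1).deriv
  rw [← h3, torusDeriv]
  congr 1
  ext s
  simp only [Function.comp_apply, toTorus_add, toTorus_smul_single]

theorem contDiff_torusDeriv {f : UnitAddTorus (Fin d) → ℝ}
    (hf : ContDiff ℝ ∞ fun x => f (toTorus x)) (i : Fin d) :
    ContDiff ℝ ∞ fun x => torusDeriv i f (toTorus x) := by
  have : (fun x => torusDeriv i f (toTorus x))
      = fun x => fderiv ℝ (fun x => f (toTorus x)) x (Pi.single i 1) := by
    ext x; exact torusDeriv_toTorus (hf.differentiable (by simp)).differentiableAt i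
  rw [this]
  exact (hf.fderiv_right (m := ∞) (by simp)).clm_apply contDiff_const

theorem hasFDerivAt_comp_toTorus {f : UnitAddTorus (Fin d) → ℝ}
    (hf : ContDiff ℝ ∞ fun x => f (toTorus x)) (x : Fin d → ℝ) :
    HasFDerivAt (fun x => f (toTorus x))
      (∑ i, torusDeriv i f (toTorus x) •
        (ContinuousLinearMap.proj i : (Fin d → ℝ) →L[ℝ] ℝ)) x := by
  have hd : DifferentiableAt ℝ (fun x => f (toTorus x)) x :=
    (hf.differentiable (by simp)).differentiableAt
  refine hd.hasFDerivAt.congr_fderiv ?_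
  ext y
  have hy : y = ∑ i, y i • (Pi.single i 1 : Fin d → ℝ) := pi_eq_sum_univ' y
  conv_lhs => rw [hy]
  simp only [map_sum, map_smul, _root_.sum_apply, _root_.smul_apply,
    ContinuousLinearMap.proj_apply, torusDeriv_toTorus hd, smul_eq_mul]
  exact Finset.sum_congr rfl fun i _ => mul_comm _ _

theorem contDiff_comp_sub_left_toTorus {f : UnitAddTorus (Fin d) → ℝ}
    (hf : ContDiff ℝ ∞ fun x => f (toTorus x)) (y : UnitAddTorus (Fin d)) :
    ContDiff ℝ ∞ fun x => f (y - toTorus x) := by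
  obtain ⟨y, rfl⟩ := toTorus_surjective y
  simp only [← toTorus_sub]
  exact hf.comp (contDiff_const.sub contDiff_id)

/-- Smoothing of `f` by the kernel `η(a - b) ρ(x - y)`. -/
def smoothing (η : ℝ → ℝ) (ρ : UnitAddTorus (Fin d) → ℝ) (f : Dom d → ℝ)
    (p : ℝ × (Fin d → ℝ)) : ℝ :=
  ∫ w : Dom d, f w * (η (p.1 - w.1) * ρ (toTorus p.2 - w.2))

section Smoothing

variable {η : ℝ → ℝ} {ρ : UnitAddTorus (Fin d) → ℝ} {f : Dom d → ℝ}

theorem integrable_mul_kernel (hf : Integrable f) (hη : Continuous η) (hηc : HasCompactSupport η)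
    (hρ : Continuous ρ) (a : ℝ) (x : UnitAddTorus (Fin d)) :
    Integrable fun w : Dom d => f w * (η (a - w.1) * ρ (x - w.2)) := by
  obtain ⟨C, hC⟩ := hηc.exists_bound_of_continuous hη
  obtain ⟨D, hD⟩ := isCompact_univ.exists_bound_of_continuousOn hρ.continuousOn
  refine hf.mul_bdd (c := C * D) (Continuous.aestronglyMeasurable (by fun_prop))
    (Eventually.of_forall fun w => ?_)
  rw [norm_mul]
  exact mul_le_mul (hC _) (hD _ (mem_univ _)) (norm_nonneg _) ((norm_nonneg _).trans (hC 0))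

theorem hasFDerivAt_smoothing (hf : Integrable f) (hη : ContDiff ℝ ∞ η)
    (hηc : HasCompactSupport η) (hρ : ContDiff ℝ ∞ fun x => ρ (toTorus x))
    (p : ℝ × (Fin d → ℝ)) :
    HasFDerivAt (smoothing η ρ f)
      (smoothing (deriv η) ρ f p • ContinuousLinearMap.fst ℝ ℝ (Fin d → ℝ)
        + ∑ i, smoothing η (torusDeriv i ρ) f p •
          (ContinuousLinearMap.proj (R := ℝ) i).comp (ContinuousLinearMap.snd ℝ ℝ (Fin d → ℝ)))
      p := by
  have hρc : Continuous ρ := continuous_of_comp_toTorus hρ.continuous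
  have hρi : ∀ i, Continuous (torusDeriv i ρ) := fun i =>
    continuous_of_comp_toTorus (contDiff_torusDeriv hρ i).continuous
  have hη' : Continuous (deriv η) := hη.continuous_deriv (by simp)
  have hηcont := hη.continuous
  obtain ⟨C, hC⟩ := hηc.exists_bound_of_continuous hηcont
  obtain ⟨C', hC'⟩ := hηc.deriv.exists_bound_of_continuous hη'
  obtain ⟨D, hD⟩ := isCompact_univ.exists_bound_of_continuousOn hρc.continuousOn
  have hDi : ∀ i, ∃ D, ∀ x, ‖torusDeriv i ρ x‖ ≤ D := fun i => by
    obtain ⟨D, hD⟩ := isCompact_univ.exists_bound_of_continuousOn (hρi i).continuousOn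
    exact ⟨D, fun x => hD x (mem_univ x)⟩
  choose E hE using hDi
  have hC0 : 0 ≤ C := (norm_nonneg _).trans (hC 0)
  have hC'0 : 0 ≤ C' := (norm_nonneg _).trans (hC' 0)
  set L₀ := ContinuousLinearMap.fst ℝ ℝ (Fin d → ℝ) with hL₀
  set L : Fin d → (ℝ × (Fin d → ℝ)) →L[ℝ] ℝ := fun i =>
    (ContinuousLinearMap.proj (R := ℝ) i).comp (ContinuousLinearMap.snd ℝ ℝ (Fin d → ℝ)) with hL
  let F' : ℝ × (Fin d → ℝ) → Dom d → (ℝ × (Fin d → ℝ)) →L[ℝ] ℝ := fun p w =>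
    (f w * (deriv η (p.1 - w.1) * ρ (toTorus p.2 - w.2))) • L₀
      + ∑ i, (f w * (η (p.1 - w.1) * torusDeriv i ρ (toTorus p.2 - w.2))) • L i
  have hi0 := integrable_mul_kernel hf hη' hηc.deriv hρc p.1 (toTorus p.2)
  have hii := fun i => integrable_mul_kernel hf hηcont hηc (hρi i) p.1 (toTorus p.2)
  have hInt : ∫ w, F' p w = smoothing (deriv η) ρ f p • L₀
      + ∑ i, smoothing η (torusDeriv i ρ) f p • L i := by
    simp only [F']
    rw [integral_add (hi0.smul_const _) (integrable_finsetSum _ fun i _ => (hii i).smul_const _),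
      integral_finsetSum _ fun i _ => (hii i).smul_const _, integral_smul_const]
    simp only [integral_smul_const, smoothing]
  rw [← hInt]
  refine hasFDerivAt_integral_of_dominated_of_fderiv_le (s := univ) (F' := F')
    (bound := fun w => ‖f w‖ * (C' * D * ‖L₀‖ + ∑ i, C * E i * ‖L i‖)) univ_mem ?_ ?_ ?_ ?_ ?_ ?_
  · exact Eventually.of_forall fun q =>
      (integrable_mul_kernel hf hηcont hηc hρc q.1 (toTorus q.2)).1
  · exact integrable_mul_kernel hf hηcont hηc hρc p.1 (toTorus p.2)
  · exact (hi0.smul_const _).1.add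
      (integrable_finsetSum _ fun i _ => (hii i).smul_const _).1
  · refine Eventually.of_forall fun w q _ => ?_
    refine (norm_add_le _ _).trans ?_
    rw [mul_add, Finset.mul_sum]
    refine add_le_add ?_ ((norm_sum_le _ _).trans (Finset.sum_le_sum fun i _ => ?_))
    · rw [norm_smul, norm_mul, norm_mul, mul_assoc]
      gcongr
      · exact hC' _
      · exact hD _ (mem_univ _)
    · rw [norm_smul, norm_mul, norm_mul, mul_assoc]
      gcongr
      · exact hC _
      · exact hE i _
  · exact hf.norm.mul_const _
  · refine Eventually.of_forall fun w q _ => ?_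
    obtain ⟨b, y⟩ := w
    obtain ⟨y, rfl⟩ := toTorus_surjective y
    have h1 : HasFDerivAt (fun q : ℝ × (Fin d → ℝ) => η (q.1 - b)) (deriv η (q.1 - b) • L₀) q := by
      have a1 : HasDerivAt η (deriv η (q.1 - b)) (q.1 - b) :=
        (hη.differentiable (by simp)).differentiableAt.hasDerivAt
      have a2 : HasFDerivAt (fun q : ℝ × (Fin d → ℝ) => q.1 - (b : ℝ)) L₀ q :=
        hasFDerivAt_fst.sub_const _
      exact a1.comp_hasFDerivAt q a2
    have h2 : HasFDerivAt (fun q : ℝ × (Fin d → ℝ) => ρ (toTorus q.2 - toTorus y))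
        (∑ i, torusDeriv i ρ (toTorus q.2 - toTorus y) • L i) q := by
      have a1 := hasFDerivAt_comp_toTorus hρ (q.2 - y)
      have a2 : HasFDerivAt (fun q : ℝ × (Fin d → ℝ) => q.2 - y)
          (ContinuousLinearMap.snd ℝ ℝ (Fin d → ℝ)) q := hasFDerivAt_snd.sub_const _
      have a3 := a1.comp q a2
      simp only [← toTorus_sub]
      refine HasFDerivAt.congr_fderiv a3 ?_
      ext v <;> simp [hL]
    refine ((h1.mul h2).const_mul (f (b, toTorus y))).congr_fderiv ?_
    change _ = (f (b, toTorus y) * _) • L₀ + ∑ i, (f (b, toTorus y) * _) • L i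
    simp only [smul_add, Finset.smul_sum, smul_smul]
    rw [add_comm]
    congr 2
    ring

theorem contDiff_smoothing (hf : Integrable f) {η : ℝ → ℝ} (hη : ContDiff ℝ ∞ η)
    (hηc : HasCompactSupport η) {ρ : UnitAddTorus (Fin d) → ℝ}
    (hρ : ContDiff ℝ ∞ fun x => ρ (toTorus x)) : ContDiff ℝ ∞ (smoothing η ρ f) := by
  rw [contDiff_infty]
  intro n
  induction n generalizing η ρ with
  | zero =>
    exact contDiff_zero.2 (continuous_iff_continuousAt.2 fun p =>
      (hasFDerivAt_smoothing hf hη hηc hρ p).continuousAt)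
  | succ n ih =>
    push_cast
    refine contDiff_succ_iff_hasFDerivAt.2 ⟨_, ?_, hasFDerivAt_smoothing hf hη hηc hρ⟩
    refine ContDiff.add (ContDiff.smul (ih ?_ hηc.deriv hρ) contDiff_const)
      (ContDiff.sum fun i _ => ContDiff.smul (ih hη hηc (contDiff_torusDeriv hρ i)) contDiff_const)
    exact (contDiff_infty_iff_deriv.1 hη).2

end Smoothing

end
end LevelSet

namespace LevelSet
noncomputable section
open scoped ContDiff Topology
open Set Filter

open scoped InnerProductSpace

variable {d : ℕ}

theorem integral_unitInterval (f : ℝ → ℝ) :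
    ∫ b : unitInterval, f b = ∫ b in Icc (0 : ℝ) 1, f b :=
  integral_subtype_comap measurableSet_Icc f

/-- The class in `L²` of a continuous function. -/
def toL2 (F : Dom d → ℝ) (hF : Continuous F) : L2 d :=
  ContinuousMap.toLp 2 volume ℝ ⟨F, hF⟩

theorem coeFn_toL2 (F : Dom d → ℝ) (hF : Continuous F) : toL2 F hF =ᵐ[volume] F :=
  ContinuousMap.coeFn_toLp (E := ℝ) volume ⟨F, hF⟩

theorem integrable_coeFn (Y : L2 d) : Integrable Y :=
  (Lp.memLp Y).integrable one_le_two

theorem inner_eq_integral (Y Z : L2 d) : ⟪Y, Z⟫_ℝ = ∫ z, Y z * Z z := by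
  rw [L2.inner_def]
  congr 1; ext z
  simp [mul_comm]

theorem norm_sq_eq_integral (Y : L2 d) : ‖Y‖ ^ 2 = ∫ z, Y z ^ 2 := by
  rw [← real_inner_self_eq_norm_sq, inner_eq_integral]
  congr 1; ext z; ring

theorem inner_toL2 (Y : L2 d) {F : Dom d → ℝ} (hF : Continuous F) :
    ⟪Y, toL2 F hF⟫_ℝ = ∫ z, Y z * F z := by
  rw [inner_eq_integral]
  refine integral_congr_ae ?_
  filter_upwards [coeFn_toL2 F hF] with z hz
  rw [hz]

theorem exists_norm_sub_toL2_lt (Y : L2 d) {ε : ℝ} (hε : 0 < ε) :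
    ∃ (F : Dom d → ℝ) (hF : Continuous F), ‖Y - toL2 F hF‖ < ε := by
  have h := ContinuousMap.toLp_denseRange ℝ (volume : Measure (Dom d)) ℝ (p := 2) (by simp)
  obtain ⟨F, hF⟩ := h.exists_dist_lt Y hε
  exact ⟨F, F.continuous, by rw [← dist_eq_norm]; exact hF⟩

theorem norm_toL2_le {F : Dom d → ℝ} (hF : Continuous F) {C : ℝ} (hC : ∀ z, |F z| ≤ C) :
    ‖toL2 F hF‖ ≤ C := by
  have h1 : ‖toL2 F hF‖ ^ 2 ≤ C ^ 2 := by
    rw [norm_sq_eq_integral]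
    have : ∫ z, (toL2 F hF z) ^ 2 = ∫ z, F z ^ 2 := integral_congr_ae (by
      filter_upwards [coeFn_toL2 F hF] with z hz
      rw [hz])
    rw [this]
    calc ∫ z, F z ^ 2 ≤ ∫ _ : Dom d, C ^ 2 := by
          refine integral_mono ((hF.pow 2).integrable_of_hasCompactSupport
            (HasCompactSupport.of_compactSpace _)) (integrable_const _) fun z => ?_
          exact sq_le_sq' (by linarith [(abs_le.1 (hC z)).1]) (abs_le.1 (hC z)).2
      _ = C ^ 2 := by simp
  have hC0 : 0 ≤ C := (abs_nonneg _).trans (hC (0, 0))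
  exact abs_le_of_sq_le_sq' h1 hC0 |>.2

/-! ### Test functions and the cone `K` -/

theorem hasDerivAt_fst_of_contDiff {φ : ℝ → UnitAddTorus (Fin d) → ℝ}
    (hφ : ContDiff ℝ ∞ (fun p : ℝ × (Fin d → ℝ) => φ p.1 (toTorus p.2)))
    (a : ℝ) (x : Fin d → ℝ) :
    HasDerivAt (fun b => φ b (toTorus x))
      (fderiv ℝ (fun p : ℝ × (Fin d → ℝ) => φ p.1 (toTorus p.2)) (a, x) (1, 0)) a := by
  have h1 : HasFDerivAt (fun p : ℝ × (Fin d → ℝ) => φ p.1 (toTorus p.2))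
      (fderiv ℝ (fun p : ℝ × (Fin d → ℝ) => φ p.1 (toTorus p.2)) (a, x)) (a, x) :=
    (hφ.differentiable (by simp)).differentiableAt.hasFDerivAt
  have h2 : HasDerivAt (fun b : ℝ => (b, x)) ((1 : ℝ), (0 : Fin d → ℝ)) a :=
    (hasDerivAt_id a).prodMk (hasDerivAt_const a x)
  exact h1.comp_hasDerivAt a h2

theorem continuous_deriv_fst {φ : ℝ → UnitAddTorus (Fin d) → ℝ}
    (hφ : ContDiff ℝ ∞ (fun p : ℝ × (Fin d → ℝ) => φ p.1 (toTorus p.2))) :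
    Continuous fun p : ℝ × UnitAddTorus (Fin d) => deriv (fun b => φ b p.2) p.1 := by
  refine continuous_of_comp_prod_toTorus ?_
  have : (fun p : ℝ × (Fin d → ℝ) => deriv (fun b => φ b (toTorus p.2)) p.1)
      = fun p => fderiv ℝ (fun p : ℝ × (Fin d → ℝ) => φ p.1 (toTorus p.2)) p (1, 0) := by
    ext p
    exact (hasDerivAt_fst_of_contDiff hφ p.1 p.2).deriv
  simp only [this]
  exact (hφ.continuous_fderiv (by simp)).clm_apply continuous_const

theorem contDiff_fst_of_contDiff {φ : ℝ → UnitAddTorus (Fin d) → ℝ}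
    (hφ : ContDiff ℝ ∞ (fun p : ℝ × (Fin d → ℝ) => φ p.1 (toTorus p.2)))
    (x : UnitAddTorus (Fin d)) : ContDiff ℝ ∞ fun b => φ b x := by
  obtain ⟨x, rfl⟩ := toTorus_surjective x
  exact hφ.comp (contDiff_id.prodMk contDiff_const)

theorem continuous_of_contDiff {φ : ℝ → UnitAddTorus (Fin d) → ℝ}
    (hφ : ContDiff ℝ ∞ (fun p : ℝ × (Fin d → ℝ) => φ p.1 (toTorus p.2))) :
    Continuous fun p : ℝ × UnitAddTorus (Fin d) => φ p.1 p.2 :=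
  continuous_of_comp_prod_toTorus hφ.continuous

theorem continuous_comp_dom {E : Type*} [TopologicalSpace E] {f : ℝ × UnitAddTorus (Fin d) → E}
    (hf : Continuous f) : Continuous fun z : Dom d => f ((z.1 : ℝ), z.2) :=
  hf.comp (by fun_prop)

theorem mem_K_iff {Y : L2 d} : Y ∈ K d ↔ ∀ (φ : ℝ → UnitAddTorus (Fin d) → ℝ)
    (hφ : IsTestFunction φ), (∀ a x, 0 ≤ φ a x) →
    ⟪Y, toL2 _ (continuous_comp_dom (continuous_deriv_fst hφ.smooth))⟫_ℝ ≤ 0 := by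
  simp only [inner_toL2]
  rfl

theorem isClosed_K : IsClosed (K d) := by
  have : K d = ⋂ (φ : ℝ → UnitAddTorus (Fin d) → ℝ) (hφ : IsTestFunction φ)
      (_ : ∀ a x, 0 ≤ φ a x),
      {Y | ⟪Y, toL2 _ (continuous_comp_dom (continuous_deriv_fst hφ.smooth))⟫_ℝ ≤ 0} := by
    ext Y; simp only [mem_K_iff, mem_iInter, mem_ofPred_eq]
  rw [this]
  exact isClosed_iInter fun φ => isClosed_iInter fun hφ => isClosed_iInter fun _ =>
    isClosed_le (by fun_prop) continuous_const

theorem convex_K : Convex ℝ (K d) := by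
  intro Y hY Z hZ α β hα hβ _
  rw [mem_K_iff] at hY hZ ⊢
  intro φ hφ h0
  rw [inner_add_left, real_inner_smul_left, real_inner_smul_left]
  exact add_nonpos (mul_nonpos_of_nonneg_of_nonpos hα (hY φ hφ h0))
    (mul_nonpos_of_nonneg_of_nonpos hβ (hZ φ hφ h0))

theorem zero_mem_K : (0 : L2 d) ∈ K d := by
  rw [mem_K_iff]; intro φ hφ _; simp

theorem hasCompactSupport_fst {φ : ℝ → UnitAddTorus (Fin d) → ℝ} (hφ : IsTestFunction φ)
    (x : UnitAddTorus (Fin d)) : HasCompactSupport (fun b => φ b x) ∧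
      ∀ b, b ∉ Ioo (0 : ℝ) 1 → φ b x = 0 := by
  have h0 : ∀ b, b ∉ Ioo (0 : ℝ) 1 → φ b x = 0 := by
    intro b hb
    by_contra hne
    exact hb (hφ.support_subset (subset_tsupport _ (show Function.uncurry φ (b, x) ≠ 0 from hne))).1
  refine ⟨HasCompactSupport.of_support_subset_isCompact (isCompact_Icc (a := (0 : ℝ)) (b := 1))
    fun b hb => ?_, h0⟩
  by_contra hcon
  exact hb (h0 b fun h => hcon (Ioo_subset_Icc_self h))

theorem toL2_mem_K {F : Dom d → ℝ} (hF : Continuous F)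
    (hmono : ∀ x, Monotone fun a => F (a, x)) : toL2 F hF ∈ K d := by
  rw [mem_K_iff]
  intro φ hφ h0
  rw [real_inner_comm, inner_toL2]
  have e1 : ∫ z, toL2 _ (continuous_comp_dom (continuous_deriv_fst hφ.smooth)) z * F z
      = ∫ z : Dom d, deriv (fun b => φ b z.2) z.1 * F z := by
    refine integral_congr_ae ?_
    filter_upwards [coeFn_toL2 _ (continuous_comp_dom (continuous_deriv_fst hφ.smooth))] with z hz
    rw [hz]
  have hc : Continuous fun z : Dom d => deriv (fun b => φ b z.2) z.1 * F z :=
    (continuous_comp_dom (continuous_deriv_fst hφ.smooth)).mul hF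
  have hi : Integrable (fun z : Dom d => deriv (fun b => φ b z.2) z.1 * F z)
      ((volume : Measure unitInterval).prod volume) :=
    hc.integrable_of_hasCompactSupport (HasCompactSupport.of_compactSpace _)
  rw [e1]
  change ∫ z, _ ∂((volume : Measure unitInterval).prod volume) ≤ 0
  rw [integral_prod_symm _ hi]
  refine integral_nonpos fun x => ?_
  obtain ⟨hcs, hz⟩ := hasCompactSupport_fst hφ x
  have hsm := contDiff_fst_of_contDiff hφ.smooth x
  set θ : ℝ → ℝ := fun b => φ b x with hθ
  set E : ℝ → ℝ := IccExtend (zero_le_one (α := ℝ)) fun a => F (a, x) with hE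
  have hEc : Continuous E := Continuous.Icc_extend' (by fun_prop)
  have hEm : Monotone E := (hmono x).IccExtend _
  have h1 : ∫ a : unitInterval, deriv θ a * F (a, x) = ∫ a : unitInterval, deriv θ a * E a := by
    congr 1; ext a; rw [hE, IccExtend_val]
  change ∫ a : unitInterval, deriv θ a * F (a, x) ≤ 0
  rw [h1, integral_unitInterval fun a => deriv θ a * E a,
    setIntegral_eq_integral_of_forall_compl_eq_zero]
  · exact integral_deriv_mul_nonpos hEc hEm hsm hcs fun t => h0 t x
  · intro b hb
    have : deriv θ b = 0 := by
      have hev : θ =ᶠ[𝓝 b] fun _ => 0 := by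
        filter_upwards [isClosed_Icc.isOpen_compl.mem_nhds hb] with c hc
        exact hz c fun h => hc (Ioo_subset_Icc_self h)
      rw [hev.deriv_eq]; simp
    rw [this, zero_mul]

end
end LevelSet

namespace LevelSet
noncomputable section
open scoped ContDiff Topology
open Set Filter

open scoped InnerProductSpace

variable {d : ℕ}

/-! ### Mollifiers -/

/-- A smooth nonnegative function on the torus that vanishes only at the origin. -/
def torusGap (x : UnitAddTorus (Fin d)) : ℝ := ∑ i, (1 - (fourier 1 (x i) : ℂ).re)

theorem continuous_torusGap : Continuous (torusGap (d := d)) := by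
  unfold torusGap
  refine continuous_finsetSum _ fun i _ => continuous_const.sub (Complex.continuous_re.comp ?_)
  exact (fourier 1).continuous.comp (continuous_apply i)

theorem norm_fourier_one (x : UnitAddCircle) : ‖fourier 1 x‖ = 1 := by
  rw [fourier_one]; exact Circle.norm_coe _

theorem re_fourier_one_le (x : UnitAddCircle) : (fourier 1 x : ℂ).re ≤ 1 :=
  (Complex.re_le_norm _).trans (norm_fourier_one x).le

theorem torusGap_nonneg (x : UnitAddTorus (Fin d)) : 0 ≤ torusGap x :=
  Finset.sum_nonneg fun _ _ => sub_nonneg.2 (re_fourier_one_le _)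

theorem torusGap_zero : torusGap (0 : UnitAddTorus (Fin d)) = 0 := by
  simp [torusGap]

theorem torusGap_neg (x : UnitAddTorus (Fin d)) : torusGap (-x) = torusGap x := by
  unfold torusGap
  refine Finset.sum_congr rfl fun i _ => ?_
  rw [Pi.neg_apply, fourier_one, fourier_one, AddCircle.toCircle_neg, Circle.coe_inv_eq_conj,
    Complex.conj_re]

theorem eq_zero_of_torusGap_eq_zero {x : UnitAddTorus (Fin d)} (hx : torusGap x = 0) : x = 0 := by
  have h := (Finset.sum_eq_zero_iff_of_nonneg
    (fun i _ => sub_nonneg.2 (re_fourier_one_le (x i)))).1 hx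
  ext i
  have h1 : (fourier 1 (x i) : ℂ).re = 1 := by linarith [h i (Finset.mem_univ i)]
  have h2 : (fourier 1 (x i) : ℂ) = 1 := by
    have h3 := norm_fourier_one (x i)
    have h4 : Complex.normSq (fourier 1 (x i)) = 1 := by
      rw [Complex.normSq_eq_norm_sq, h3]; norm_num
    rw [Complex.normSq_apply, h1] at h4
    apply Complex.ext
    · simpa using h1
    · have : (fourier 1 (x i) : ℂ).im * (fourier 1 (x i) : ℂ).im = 0 := by linarith
      simpa using this
  rw [fourier_one] at h2
  have h5 : (x i).toCircle = (0 : UnitAddCircle).toCircle := by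
    rw [AddCircle.toCircle_zero]; exact Circle.ext h2
  exact AddCircle.injective_toCircle one_ne_zero h5

theorem contDiff_torusGap : ContDiff ℝ ∞ fun x : Fin d → ℝ => torusGap (toTorus x) := by
  have h : ∀ y : ℝ, (fourier 1 (y : UnitAddCircle) : ℂ).re = Real.cos (2 * Real.pi * y) := by
    intro y
    rw [fourier_coe_apply]
    have : (2 * (Real.pi : ℂ) * Complex.I * ((1 : ℤ) : ℂ) * (y : ℂ) / ((1 : ℝ) : ℂ))
        = ((2 * Real.pi * y : ℝ) : ℂ) * Complex.I := by push_cast; ring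
    rw [this, Complex.exp_ofReal_mul_I_re]
  simp only [torusGap, toTorus, h]
  refine ContDiff.sum fun i _ => contDiff_const.sub (Real.contDiff_cos.comp ?_)
  exact contDiff_const.mul (contDiff_apply ℝ ℝ i)

theorem exists_torusGap_lt {δ : ℝ} (hδ : 0 < δ) :
    ∃ ε > 0, ∀ x : UnitAddTorus (Fin d), torusGap x < ε → ‖x‖ < δ := by
  set S : Set (UnitAddTorus (Fin d)) := {x | δ ≤ ‖x‖} with hS
  have hSc : IsCompact S := (isClosed_le continuous_const continuous_norm).isCompact
  rcases S.eq_empty_or_nonempty with hE | hne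
  · refine ⟨1, one_pos, fun x _ => ?_⟩
    by_contra! h
    exact (hE ▸ (show x ∈ S from h) : x ∈ (∅ : Set _))
  · obtain ⟨x₀, hx₀, hmin⟩ := hSc.exists_isMinOn hne continuous_torusGap.continuousOn
    have hpos : 0 < torusGap x₀ := by
      rcases (torusGap_nonneg x₀).eq_or_lt with h | h
      · have h0 := eq_zero_of_torusGap_eq_zero h.symm
        have : δ ≤ ‖x₀‖ := hx₀
        rw [h0, norm_zero] at this
        linarith
      · exact h
    refine ⟨torusGap x₀, hpos, fun x hx => ?_⟩
    by_contra! h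
    exact absurd (hmin (show x ∈ S from h)) (not_le.2 hx)

/-- The width of the mollifier. -/
def width (n : ℕ) : ℝ := 1 / ((n : ℝ) + 4)

theorem width_pos (n : ℕ) : 0 < width n := by unfold width; positivity

theorem width_le (n : ℕ) : width n ≤ 1 / 4 := by
  unfold width
  gcongr
  linarith [Nat.cast_nonneg (α := ℝ) n]

theorem tendsto_width : Tendsto width atTop (𝓝 0) := by
  have := (tendsto_one_div_atTop_nhds_zero_nat (𝕜 := ℝ)).comp (tendsto_add_atTop_nat 4)
  refine this.congr fun n => ?_
  simp [width]

/-- A bump function of small width. -/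
def bump (n : ℕ) : ContDiffBump (0 : ℝ) :=
  ⟨width n / 4, width n / 2, by have := width_pos n; positivity, by linarith [width_pos n]⟩

/-- The kernel in the variable `a`. -/
def kerA (n : ℕ) : ℝ → ℝ := (bump n).normed volume

theorem contDiff_kerA (n : ℕ) : ContDiff ℝ ∞ (kerA n) := (bump n).contDiff_normed

theorem continuous_kerA (n : ℕ) : Continuous (kerA n) := (contDiff_kerA n).continuous

theorem hasCompactSupport_kerA (n : ℕ) : HasCompactSupport (kerA n) :=
  (bump n).hasCompactSupport_normed

theorem kerA_nonneg (n : ℕ) (s : ℝ) : 0 ≤ kerA n s := (bump n).nonneg_normed s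

theorem integral_kerA (n : ℕ) : ∫ s, kerA n s = 1 := (bump n).integral_normed

theorem kerA_eq_zero {n : ℕ} {s : ℝ} (hs : width n / 2 ≤ |s|) : kerA n s = 0 := by
  have : s ∉ Function.support (kerA n) := by
    rw [kerA, (bump n).support_normed_eq]
    simpa [bump] using hs
  simpa using this

/-- The kernel in the variable `x`, before normalization. -/
def preKerX (n : ℕ) (x : UnitAddTorus (Fin d)) : ℝ := bump n (torusGap x)

theorem continuous_preKerX (n : ℕ) : Continuous (preKerX (d := d) n) :=
  (bump n).continuous.comp continuous_torusGap

theorem integral_preKerX_pos (n : ℕ) : 0 < ∫ x : UnitAddTorus (Fin d), preKerX n x := by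
  refine (continuous_preKerX n).integral_pos_of_hasCompactSupport_nonneg_nonzero
    (HasCompactSupport.of_compactSpace _) (fun x => (bump n).nonneg) (x := 0) ?_
  rw [preKerX, torusGap_zero, (bump n).one_of_mem_closedBall]
  · exact one_ne_zero
  · exact Metric.mem_closedBall_self (bump n).rIn_pos.le

/-- The kernel in the variable `x`. -/
def kerX (n : ℕ) (x : UnitAddTorus (Fin d)) : ℝ :=
  preKerX n x / ∫ y : UnitAddTorus (Fin d), preKerX n y

theorem continuous_kerX (n : ℕ) : Continuous (kerX (d := d) n) :=
  (continuous_preKerX n).div_const _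

theorem contDiff_kerX (n : ℕ) : ContDiff ℝ ∞ fun x : Fin d → ℝ => kerX n (toTorus x) :=
  ((bump n).contDiff.comp contDiff_torusGap).div_const _

theorem kerX_nonneg (n : ℕ) (x : UnitAddTorus (Fin d)) : 0 ≤ kerX n x :=
  div_nonneg (bump n).nonneg (integral_preKerX_pos n).le

theorem kerX_neg (n : ℕ) (x : UnitAddTorus (Fin d)) : kerX n (-x) = kerX n x := by
  simp only [kerX, preKerX, torusGap_neg]

theorem integral_kerX (n : ℕ) : ∫ x : UnitAddTorus (Fin d), kerX n x = 1 := by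
  simp only [kerX]
  rw [integral_div, div_self (integral_preKerX_pos n).ne']

theorem kerX_eq_zero {n : ℕ} {x : UnitAddTorus (Fin d)} (hx : width n / 2 ≤ torusGap x) :
    kerX n x = 0 := by
  rw [kerX, preKerX, (bump n).zero_of_le_dist, zero_div]
  rw [Real.dist_eq, sub_zero, abs_of_nonneg (torusGap_nonneg x)]
  exact hx

theorem integral_kerX_sub_right (n : ℕ) (y : UnitAddTorus (Fin d)) :
    ∫ x, kerX n (x - y) = 1 := by
  rw [integral_sub_right_eq_self (fun x => kerX n x) y, integral_kerX]

theorem integral_kerX_sub_left (n : ℕ) (x : UnitAddTorus (Fin d)) :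
    ∫ y, kerX n (x - y) = 1 := by
  simp only [← kerX_neg n (x - _), neg_sub]
  exact integral_kerX_sub_right n x

/-- The contraction of `[0,1]` into its interior used by the mollifier. -/
def shrink (n : ℕ) (a : ℝ) : ℝ := (1 - 2 * width n) * a + width n

theorem shrink_mem {n : ℕ} {a : ℝ} (ha : a ∈ Icc (0 : ℝ) 1) :
    shrink n a ∈ Icc (width n) (1 - width n) := by
  have h1 := width_pos n
  have h2 := width_le n
  unfold shrink
  constructor <;> nlinarith [ha.1, ha.2]

theorem abs_shrink_sub_le {n : ℕ} {a : ℝ} (ha : a ∈ Icc (0 : ℝ) 1) :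
    |shrink n a - a| ≤ width n := by
  have h1 := width_pos n
  rw [shrink, abs_le]
  constructor <;> nlinarith [ha.1, ha.2]

theorem integral_kerA_sub {n : ℕ} {c : ℝ} (hc : c ∈ Icc (width n) (1 - width n)) :
    ∫ b : unitInterval, kerA n (c - b) = 1 := by
  have h1 := width_pos n
  rw [integral_unitInterval fun b => kerA n (c - b),
    setIntegral_eq_integral_of_forall_compl_eq_zero, integral_sub_left_eq_self (kerA n) volume c,
    integral_kerA]
  intro b hb
  refine kerA_eq_zero ?_
  rw [le_abs]
  by_contra! hcon
  exact hb ⟨by linarith [hc.1, hcon.1], by linarith [hc.2, hcon.2]⟩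

theorem integral_kerA_shrink_le (n : ℕ) (b : ℝ) :
    ∫ a : unitInterval, kerA n (shrink n a - b) ≤ 2 := by
  have h1 := width_pos n
  have h2 := width_le n
  set l := 1 - 2 * width n with hl
  have hl2 : 1 / 2 ≤ l := by linarith
  set g : ℝ → ℝ := fun s => kerA n (s + (width n - b)) with hg
  have hcomp : ∀ a, kerA n (shrink n a - b) = g (l * a) := by
    intro a; simp only [shrink, ← hl, hg]; congr 1; ring
  have hInt : Integrable fun a => kerA n (shrink n a - b) := by
    simp only [hcomp]
    refine Integrable.comp_mul_left' (g := g) ?_ (show l ≠ 0 by linarith)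
    exact ((continuous_kerA n).integrable_of_hasCompactSupport
      (hasCompactSupport_kerA n)).comp_add_right _
  rw [integral_unitInterval fun a => kerA n (shrink n a - b)]
  refine (setIntegral_le_integral hInt (Eventually.of_forall fun a => kerA_nonneg n _)).trans ?_
  simp only [hcomp]
  rw [Measure.integral_comp_mul_left, hg, integral_add_right_eq_self (kerA n), integral_kerA,
    smul_eq_mul, mul_one, abs_of_nonneg (by positivity)]
  rw [inv_le_comm₀ (by linarith) (by norm_num)]
  linarith

/-- The mollification of a function on `[0,1] × 𝕋ᵈ`. -/
def moll (n : ℕ) (f : Dom d → ℝ) (a : ℝ) (x : UnitAddTorus (Fin d)) : ℝ :=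
  ∫ w : Dom d, f w * (kerA n (shrink n a - w.1) * kerX n (x - w.2))

theorem contDiff_moll (n : ℕ) {f : Dom d → ℝ} (hf : Integrable f) :
    ContDiff ℝ ∞ fun p : ℝ × (Fin d → ℝ) => moll n f p.1 (toTorus p.2) := by
  have h := contDiff_smoothing hf (contDiff_kerA n) (hasCompactSupport_kerA n) (contDiff_kerX n)
  refine h.comp (ContDiff.prodMk ?_ contDiff_snd)
  exact (contDiff_const.mul contDiff_fst).add contDiff_const

theorem hasDerivAt_moll (n : ℕ) {f : Dom d → ℝ} (hf : Integrable f) (a : ℝ)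
    (x : UnitAddTorus (Fin d)) :
    HasDerivAt (fun b => moll n f b x) ((1 - 2 * width n) *
      ∫ w : Dom d, f w * (deriv (kerA n) (shrink n a - w.1) * kerX n (x - w.2))) a := by
  obtain ⟨x, rfl⟩ := toTorus_surjective x
  have h := hasFDerivAt_smoothing hf (contDiff_kerA n) (hasCompactSupport_kerA n)
    (contDiff_kerX n) (shrink n a, x)
  have h2 : HasDerivAt (fun b : ℝ => (shrink n b, x)) ((1 - 2 * width n : ℝ), (0 : Fin d → ℝ)) a := by
    refine HasDerivAt.prodMk ?_ (hasDerivAt_const a x)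
    have := ((hasDerivAt_id a).const_mul (1 - 2 * width n)).add_const (width n)
    rw [mul_one] at this
    exact this
  have h3 := h.comp_hasDerivAt a h2
  refine h3.congr_deriv ?_
  simp [smoothing, mul_comm]

theorem torusDeriv_moll (n : ℕ) {f : Dom d → ℝ} (hf : Integrable f) (i : Fin d) (a : ℝ)
    (x : UnitAddTorus (Fin d)) : torusDeriv i (moll n f a) x =
      ∫ w : Dom d, f w * (kerA n (shrink n a - w.1) * torusDeriv i (kerX n) (x - w.2)) := by
  obtain ⟨x, rfl⟩ := toTorus_surjective x
  have h := hasFDerivAt_smoothing hf (contDiff_kerA n) (hasCompactSupport_kerA n)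
    (contDiff_kerX n) (shrink n a, x)
  have h2 : HasDerivAt (fun s : ℝ => (shrink n a, x + s • (Pi.single i 1 : Fin d → ℝ)))
      ((0 : ℝ), (Pi.single i 1 : Fin d → ℝ)) 0 := by
    refine HasDerivAt.prodMk (hasDerivAt_const _ _) ?_
    simpa using ((hasDerivAt_id (0 : ℝ)).smul_const (Pi.single i (1 : ℝ) : Fin d → ℝ)).const_add x
  have h3 := (h.comp_hasDerivAt_of_eq (0 : ℝ) h2 (by simp)).deriv
  have h4 : (smoothing (kerA n) (kerX n) f ∘
      fun s : ℝ => (shrink n a, x + s • (Pi.single i 1 : Fin d → ℝ)))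
      = fun s : ℝ => moll n f a (toTorus x + Pi.single i (s : UnitAddCircle)) := by
    ext s
    simp only [Function.comp_apply, smoothing, moll, toTorus_add, toTorus_smul_single]
  rw [h4] at h3
  rw [torusDeriv, h3]
  simp [smoothing, Pi.single_apply]

theorem isTestFunction_kernel (n : ℕ) {a : ℝ} (ha : a ∈ Icc (0 : ℝ) 1)
    (x : UnitAddTorus (Fin d)) :
    IsTestFunction fun b y => kerA n (shrink n a - b) * kerX n (x - y) := by
  have hw := width_pos n
  have hs := shrink_mem (n := n) ha
  have hsub : Function.support (Function.uncurry fun (b : ℝ) (y : UnitAddTorus (Fin d)) =>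
      kerA n (shrink n a - b) * kerX n (x - y))
      ⊆ Icc (width n / 2) (1 - width n / 2) ×ˢ univ := by
    rintro ⟨b, y⟩ hb
    refine ⟨?_, mem_univ _⟩
    by_contra hcon
    refine hb ?_
    simp only [Function.uncurry_apply_pair]
    rw [kerA_eq_zero, zero_mul]
    rw [le_abs]
    by_contra! h
    exact hcon ⟨by linarith [hs.1, h.1], by linarith [hs.2, h.2]⟩
  refine ⟨?_, ?_, ?_⟩
  · refine ContDiff.mul ?_ ?_
    · exact (contDiff_kerA n).comp (contDiff_const.sub contDiff_fst)
    · exact (contDiff_comp_sub_left_toTorus (contDiff_kerX n) x).comp contDiff_snd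
  · exact HasCompactSupport.of_support_subset_isCompact (isCompact_Icc.prod isCompact_univ) hsub
  · refine (closure_minimal hsub (isClosed_Icc.prod isClosed_univ)).trans ?_
    exact prod_mono (fun b hb => ⟨by linarith [hb.1], by linarith [hb.2]⟩) subset_rfl

theorem deriv_moll_nonneg (n : ℕ) {Y : L2 d} (hY : Y ∈ K d) {a : ℝ} (ha : a ∈ Icc (0 : ℝ) 1)
    (x : UnitAddTorus (Fin d)) : 0 ≤ deriv (fun b => moll n Y b x) a := by
  rw [(hasDerivAt_moll n (integrable_coeFn Y) a x).deriv]
  have hw := width_le n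
  refine mul_nonneg (by linarith) ?_
  have h := hY _ (isTestFunction_kernel n ha x)
    fun b y => mul_nonneg (kerA_nonneg n _) (kerX_nonneg n _)
  have hd : ∀ w : Dom d, deriv (fun b => kerA n (shrink n a - b) * kerX n (x - w.2)) (w.1 : ℝ)
      = - (deriv (kerA n) (shrink n a - w.1) * kerX n (x - w.2)) := by
    intro w
    have h1 : HasDerivAt (kerA n) (deriv (kerA n) (shrink n a - w.1)) (shrink n a - w.1) :=
      ((contDiff_kerA n).differentiable (by simp)).differentiableAt.hasDerivAt
    have h2 := (HasDerivAt.scomp (w.1 : ℝ) h1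
      ((hasDerivAt_id (w.1 : ℝ)).const_sub (shrink n a))).mul_const (kerX n (x - w.2))
    have h3 := h2.deriv
    simp only [smul_eq_mul, neg_mul, one_mul] at h3
    exact h3
  simp only [hd, mul_neg, integral_neg] at h
  linarith

theorem torusDeriv_moll_eq (n : ℕ) {Y G : L2 d} {i : Fin d} (h : HasWeakDeriv i Y G) {a : ℝ}
    (ha : a ∈ Icc (0 : ℝ) 1) (x : UnitAddTorus (Fin d)) :
    torusDeriv i (moll n Y a) x = moll n G a x := by
  rw [torusDeriv_moll n (integrable_coeFn Y)]
  have h1 := h _ (isTestFunction_kernel n ha x)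
  have hd : ∀ w : Dom d, torusDeriv i (fun y => kerA n (shrink n a - w.1) * kerX n (x - y)) w.2
      = - (kerA n (shrink n a - w.1) * torusDeriv i (kerX n) (x - w.2)) := by
    rintro ⟨b, y⟩
    obtain ⟨x, rfl⟩ := toTorus_surjective x
    obtain ⟨y, rfl⟩ := toTorus_surjective y
    have e1 := hasFDerivAt_comp_toTorus (contDiff_kerX (d := d) n) (x - y)
    have e2 : HasDerivAt (fun s : ℝ => x - y - s • (Pi.single i 1 : Fin d → ℝ))
        (-(Pi.single i 1 : Fin d → ℝ)) 0 := by
      simpa using ((hasDerivAt_id (0 : ℝ)).smul_const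
        (Pi.single i (1 : ℝ) : Fin d → ℝ)).const_sub (x - y)
    have e3 := (e1.comp_hasDerivAt_of_eq (0 : ℝ) e2 (by simp)).const_mul (kerA n (shrink n a - (b : ℝ)))
    have e4 := e3.deriv
    have e5 : (fun s : ℝ => kerA n (shrink n a - (b : ℝ)) * ((fun x => kerX n (toTorus x)) ∘
        fun s : ℝ => x - y - s • (Pi.single i 1 : Fin d → ℝ)) s)
        = fun s : ℝ => kerA n (shrink n a - (b : ℝ)) *
          kerX n (toTorus x - (toTorus y + Pi.single i (s : UnitAddCircle))) := by
      ext s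
      simp only [Function.comp_apply, toTorus_sub, toTorus_add, toTorus_smul_single, sub_sub]
    rw [e5] at e4
    rw [torusDeriv, e4]
    simp [toTorus_sub, Pi.single_apply]
  simp only [hd, mul_neg, integral_neg] at h1
  rw [moll]
  linarith

end
end LevelSet

namespace LevelSet
noncomputable section
open scoped ContDiff Topology
open Set Filter

open scoped InnerProductSpace

variable {d : ℕ}

theorem continuous_moll (n : ℕ) {f : Dom d → ℝ} (hf : Integrable f) :
    Continuous fun z : Dom d => moll n f z.1 z.2 :=
  continuous_comp_dom (continuous_of_contDiff (contDiff_moll n hf))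

/-- The mollification as an operator in `L²`. -/
def mollL2 (n : ℕ) (Y : L2 d) : L2 d :=
  toL2 (fun z => moll n Y z.1 z.2) (continuous_moll n (integrable_coeFn Y))

theorem coeFn_mollL2 (n : ℕ) (Y : L2 d) :
    mollL2 n Y =ᵐ[volume] fun z => moll n Y z.1 z.2 := coeFn_toL2 _ _

theorem moll_congr_ae (n : ℕ) {f g : Dom d → ℝ} (h : f =ᵐ[volume] g) (a : ℝ)
    (x : UnitAddTorus (Fin d)) : moll n f a x = moll n g a x :=
  integral_congr_ae (by filter_upwards [h] with w hw; rw [hw])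

theorem moll_sub (n : ℕ) {f g : Dom d → ℝ} (hf : Integrable f) (hg : Integrable g) (a : ℝ)
    (x : UnitAddTorus (Fin d)) : moll n (f - g) a x = moll n f a x - moll n g a x := by
  rw [moll, moll, moll, ← integral_sub
    (integrable_mul_kernel hf (continuous_kerA n) (hasCompactSupport_kerA n)
      (continuous_kerX n) _ _)
    (integrable_mul_kernel hg (continuous_kerA n) (hasCompactSupport_kerA n)
      (continuous_kerX n) _ _)]
  congr 1; ext w
  simp only [Pi.sub_apply]; ring

theorem mollL2_sub (n : ℕ) (Y Z : L2 d) : mollL2 n (Y - Z) = mollL2 n Y - mollL2 n Z := by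
  refine Lp.ext ?_
  filter_upwards [coeFn_mollL2 n (Y - Z), coeFn_mollL2 n Y, coeFn_mollL2 n Z,
    Lp.coeFn_sub (mollL2 n Y) (mollL2 n Z)] with z h1 h2 h3 h4
  rw [h1, h4, Pi.sub_apply, h2, h3, moll_congr_ae n (Lp.coeFn_sub Y Z),
    moll_sub n (integrable_coeFn Y) (integrable_coeFn Z)]

theorem integral_kernel (n : ℕ) (z : Dom d) :
    ∫ w : Dom d, kerA n (shrink n z.1 - w.1) * kerX n (z.2 - w.2) = 1 := by
  have := integral_prod_mul (μ := (volume : Measure unitInterval))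
    (ν := (volume : Measure (UnitAddTorus (Fin d))))
    (fun b : unitInterval => kerA n (shrink n z.1 - b)) (fun y => kerX n (z.2 - y))
  rw [integral_kerA_sub (shrink_mem z.1.2), integral_kerX_sub_left, mul_one] at this
  exact this

theorem integral_kernel_left_le (n : ℕ) (w : Dom d) :
    ∫ z : Dom d, kerA n (shrink n z.1 - w.1) * kerX n (z.2 - w.2) ≤ 2 := by
  have := integral_prod_mul (μ := (volume : Measure unitInterval))
    (ν := (volume : Measure (UnitAddTorus (Fin d))))
    (fun a : unitInterval => kerA n (shrink n a - w.1)) (fun x => kerX n (x - w.2))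
  rw [integral_kerX_sub_right, mul_one] at this
  exact this.le.trans (integral_kerA_shrink_le n w.1)

theorem continuous_shrink (n : ℕ) : Continuous (shrink n) := by
  unfold shrink; fun_prop

theorem continuous_kernel (n : ℕ) : Continuous fun p : Dom d × Dom d =>
    kerA n (shrink n p.1.1 - p.2.1) * kerX n (p.1.2 - p.2.2) := by
  have h1 := continuous_kerA n
  have h2 := continuous_kerX (d := d) n
  have h3 := continuous_shrink n
  fun_prop

theorem moll_sq_le (n : ℕ) (Y : L2 d) (z : Dom d) :
    moll n Y z.1 z.2 ^ 2
      ≤ ∫ w : Dom d, Y w ^ 2 * (kerA n (shrink n z.1 - w.1) * kerX n (z.2 - w.2)) := by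
  have hY := integrable_coeFn Y
  have hY2 : Integrable fun w => Y w ^ 2 := (Lp.memLp Y).integrable_sq
  have i1 := integrable_mul_kernel hY (continuous_kerA n) (hasCompactSupport_kerA n)
    (continuous_kerX n) (shrink n z.1) z.2
  have i2 := integrable_mul_kernel hY2 (continuous_kerA n) (hasCompactSupport_kerA n)
    (continuous_kerX n) (shrink n z.1) z.2
  have i3 := integrable_mul_kernel (integrable_const (1 : ℝ)) (continuous_kerA n)
    (hasCompactSupport_kerA n) (continuous_kerX n) (shrink n z.1) z.2
  simp only [one_mul] at i3
  set m := moll n Y z.1 z.2 with hm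
  have h0 : 0 ≤ ∫ w : Dom d, (Y w - m) ^ 2 *
      (kerA n (shrink n z.1 - w.1) * kerX n (z.2 - w.2)) :=
    integral_nonneg fun w => mul_nonneg (sq_nonneg _)
      (mul_nonneg (kerA_nonneg n _) (kerX_nonneg n _))
  have h1 : ∫ w : Dom d, (Y w - m) ^ 2 * (kerA n (shrink n z.1 - w.1) * kerX n (z.2 - w.2))
      = (∫ w : Dom d, Y w ^ 2 * (kerA n (shrink n z.1 - w.1) * kerX n (z.2 - w.2)))
        - 2 * m * (∫ w : Dom d, Y w * (kerA n (shrink n z.1 - w.1) * kerX n (z.2 - w.2)))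
        + m ^ 2 * ∫ w : Dom d, kerA n (shrink n z.1 - w.1) * kerX n (z.2 - w.2) := by
    rw [← integral_const_mul, ← integral_const_mul, ← integral_sub i2 (i1.const_mul _),
      ← integral_add (by exact i2.sub (i1.const_mul _)) (i3.const_mul _)]
    congr 1; ext w; ring
  have h2 : ∫ w : Dom d, Y w * (kerA n (shrink n z.1 - w.1) * kerX n (z.2 - w.2)) = m := rfl
  rw [h1, h2, integral_kernel n z] at h0
  nlinarith

theorem norm_mollL2_le (n : ℕ) (Y : L2 d) : ‖mollL2 n Y‖ ≤ 2 * ‖Y‖ := by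
  have hY2 : Integrable fun w => Y w ^ 2 := (Lp.memLp Y).integrable_sq
  have key : ‖mollL2 n Y‖ ^ 2 ≤ 2 * ‖Y‖ ^ 2 := by
    rw [norm_sq_eq_integral, norm_sq_eq_integral]
    have e1 : ∫ z, mollL2 n Y z ^ 2 = ∫ z : Dom d, moll n Y z.1 z.2 ^ 2 := integral_congr_ae (by
      filter_upwards [coeFn_mollL2 n Y] with z hz
      rw [hz])
    obtain ⟨C, hC⟩ := isCompact_univ.exists_bound_of_continuousOn
      (continuous_kernel (d := d) n).continuousOn
    have hi : Integrable (Function.uncurry fun (z w : Dom d) =>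
        Y w ^ 2 * (kerA n (shrink n z.1 - w.1) * kerX n (z.2 - w.2)))
        ((volume : Measure (Dom d)).prod volume) := by
      have := (hY2.comp_snd (volume : Measure (Dom d))).mul_bdd (c := C)
        (continuous_kernel (d := d) n).aestronglyMeasurable
        (Eventually.of_forall fun p => hC p (mem_univ p))
      exact this
    calc ∫ z, mollL2 n Y z ^ 2 = ∫ z : Dom d, moll n Y z.1 z.2 ^ 2 := e1
      _ ≤ ∫ z : Dom d, ∫ w : Dom d, Y w ^ 2 *
            (kerA n (shrink n z.1 - w.1) * kerX n (z.2 - w.2)) := by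
          refine integral_mono ?_ hi.integral_prod_left fun z => moll_sq_le n Y z
          exact ((continuous_moll n (integrable_coeFn Y)).pow 2).integrable_of_hasCompactSupport
            (HasCompactSupport.of_compactSpace _)
      _ = ∫ w : Dom d, ∫ z : Dom d, Y w ^ 2 *
            (kerA n (shrink n z.1 - w.1) * kerX n (z.2 - w.2)) := integral_integral_swap hi
      _ ≤ ∫ w : Dom d, 2 * Y w ^ 2 := by
          refine integral_mono hi.integral_prod_right (hY2.const_mul _) fun w => ?_
          simp only
          rw [integral_const_mul, mul_comm]
          exact mul_le_mul_of_nonneg_right (integral_kernel_left_le n w) (sq_nonneg _)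
      _ = 2 * ∫ w, Y w ^ 2 := integral_const_mul _ _
  refine abs_le_of_sq_le_sq' ?_ (by positivity) |>.2
  nlinarith [sq_nonneg ‖Y‖]

theorem abs_moll_sub_le {n : ℕ} {F : Dom d → ℝ} (hF : Continuous F) {δ : ℝ}
    (h : ∀ z w : Dom d, kerA n (shrink n z.1 - w.1) * kerX n (z.2 - w.2) ≠ 0 → |F w - F z| ≤ δ)
    (z : Dom d) : |moll n F z.1 z.2 - F z| ≤ δ := by
  have hFi : Integrable F := hF.integrable_of_hasCompactSupport (HasCompactSupport.of_compactSpace _)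
  have i1 := integrable_mul_kernel hFi (continuous_kerA n) (hasCompactSupport_kerA n)
    (continuous_kerX n) (shrink n z.1) z.2
  have i3 := integrable_mul_kernel (integrable_const (1 : ℝ)) (continuous_kerA n)
    (hasCompactSupport_kerA n) (continuous_kerX n) (shrink n z.1) z.2
  simp only [one_mul] at i3
  have e1 : moll n F z.1 z.2 - F z = ∫ w : Dom d, (F w - F z) *
      (kerA n (shrink n z.1 - w.1) * kerX n (z.2 - w.2)) := by
    have e2 : F z = ∫ w : Dom d, F z * (kerA n (shrink n z.1 - w.1) * kerX n (z.2 - w.2)) := by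
      rw [integral_const_mul, integral_kernel, mul_one]
    conv_lhs => rw [e2]
    rw [moll, ← integral_sub i1 (i3.const_mul _)]
    congr 1; ext w; ring
  rw [e1, ← Real.norm_eq_abs]
  calc _ ≤ ∫ w : Dom d, δ * (kerA n (shrink n z.1 - w.1) * kerX n (z.2 - w.2)) := by
        refine norm_integral_le_of_norm_le (i3.const_mul δ) (Eventually.of_forall fun w => ?_)
        have hk : 0 ≤ kerA n (shrink n z.1 - w.1) * kerX n (z.2 - w.2) :=
          mul_nonneg (kerA_nonneg n _) (kerX_nonneg n _)
        rw [norm_mul, Real.norm_of_nonneg hk, Real.norm_eq_abs]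
        rcases hk.eq_or_lt with h0 | h0
        · rw [← h0, mul_zero, mul_zero]
        · exact mul_le_mul_of_nonneg_right (h z w h0.ne') hk
    _ = δ := by rw [integral_const_mul, integral_kernel, mul_one]

theorem tendsto_mollL2_toL2 {F : Dom d → ℝ} (hF : Continuous F) :
    Tendsto (fun n => mollL2 n (toL2 F hF)) atTop (𝓝 (toL2 F hF)) := by
  rw [Metric.tendsto_nhds]
  intro ε hε
  obtain ⟨δ, hδ, hδF⟩ := Metric.uniformContinuous_iff.1
    (CompactSpace.uniformContinuous_of_continuous hF) (ε / 2) (by positivity)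
  obtain ⟨r, hr, hrδ⟩ := exists_torusGap_lt (d := d) hδ
  have h1 := tendsto_width.eventually (gt_mem_nhds (show (0 : ℝ) < δ / 2 by positivity))
  have h2 := tendsto_width.eventually (gt_mem_nhds hr)
  filter_upwards [h1, h2] with n hn1 hn2
  have hw := width_pos n
  rw [dist_eq_norm]
  have hc : Continuous fun z : Dom d => moll n (toL2 F hF) z.1 z.2 - F z :=
    (continuous_moll n (integrable_coeFn (toL2 F hF))).sub hF
  have e : mollL2 n (toL2 F hF) - toL2 F hF = toL2 _ hc := by
    refine Lp.ext ?_
    filter_upwards [coeFn_mollL2 n (toL2 F hF), coeFn_toL2 F hF, coeFn_toL2 _ hc,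
      Lp.coeFn_sub (mollL2 n (toL2 F hF)) (toL2 F hF)] with z h1 h2 h3 h4
    rw [h4, h3, Pi.sub_apply, h1, h2]
  rw [e]
  refine (norm_toL2_le hc (C := ε / 2) fun z => ?_).trans_lt (by linarith)
  rw [moll_congr_ae n (coeFn_toL2 F hF)]
  refine abs_moll_sub_le hF (fun z w hzw => ?_) z
  have ha : |shrink n z.1 - w.1| < width n / 2 := by
    by_contra! h
    exact hzw (by rw [kerA_eq_zero h, zero_mul])
  have hx : torusGap (z.2 - w.2) < width n / 2 := by
    by_contra! h
    exact hzw (by rw [kerX_eq_zero h, mul_zero])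
  have hdist : dist w z < δ := by
    rw [Prod.dist_eq, max_lt_iff]
    constructor
    · rw [dist_comm, Subtype.dist_eq, Real.dist_eq]
      have h3 := abs_shrink_sub_le (n := n) z.1.2
      have h4 := abs_sub_le (z.1 : ℝ) (shrink n z.1) w.1
      rw [abs_sub_comm (z.1 : ℝ) (shrink n z.1)] at h4
      linarith
    · rw [dist_comm, dist_eq_norm]
      exact hrδ _ (by linarith)
  have := hδF hdist
  rw [Real.dist_eq] at this
  exact this.le

/-- Mollifications converge in `L²`. -/
theorem tendsto_mollL2 (Y : L2 d) : Tendsto (fun n => mollL2 n Y) atTop (𝓝 Y) := by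
  rw [Metric.tendsto_nhds]
  intro ε hε
  obtain ⟨F, hF, hYF⟩ := exists_norm_sub_toL2_lt Y (show 0 < ε / 6 by positivity)
  filter_upwards [Metric.tendsto_nhds.1 (tendsto_mollL2_toL2 hF) (ε / 2) (by positivity)]
    with n hn
  rw [dist_eq_norm] at hn ⊢
  have e : mollL2 n Y - Y = mollL2 n (Y - toL2 F hF) + (mollL2 n (toL2 F hF) - toL2 F hF)
      - (Y - toL2 F hF) := by rw [mollL2_sub]; abel
  rw [e]
  have h1 := norm_mollL2_le n (Y - toL2 F hF)
  have h2 := norm_sub_le (mollL2 n (Y - toL2 F hF) + (mollL2 n (toL2 F hF) - toL2 F hF))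
    (Y - toL2 F hF)
  have h3 := norm_add_le (mollL2 n (Y - toL2 F hF)) (mollL2 n (toL2 F hF) - toL2 F hF)
  linarith

theorem moll_monotone (n : ℕ) {Y : L2 d} (hY : Y ∈ K d) (x : UnitAddTorus (Fin d)) :
    Monotone fun a : unitInterval => moll n Y a x := by
  have h : MonotoneOn (fun a : ℝ => moll n Y a x) (Icc 0 1) := by
    have hd := fun a => hasDerivAt_moll n (integrable_coeFn Y) a x
    refine monotoneOn_of_deriv_nonneg (convex_Icc 0 1)
      (fun a _ => (hd a).continuousAt.continuousWithinAt)
      (fun a _ => (hd a).differentiableAt.differentiableWithinAt) fun a ha => ?_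
    rw [interior_Icc] at ha
    exact deriv_moll_nonneg n hY (Ioo_subset_Icc_self ha) x
  exact fun a b hab => h a.2 b.2 hab

theorem mollL2_mem_K (n : ℕ) {Y : L2 d} (hY : Y ∈ K d) : mollL2 n Y ∈ K d :=
  toL2_mem_K _ (moll_monotone n hY)

/-- The cone `K` is stable under `(f, g) ↦ f - γ(f - g)` for every nondecreasing contraction
`γ`. -/
theorem sub_comp_mem_K {γ : ℝ → ℝ} (hγ : LipschitzWith 1 γ) (hm : Monotone γ) (h0 : γ 0 = 0)
    {f g : L2 d} (hf : f ∈ K d) (hg : g ∈ K d) : f - hγ.compLp h0 (f - g) ∈ K d := by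
  have hlim : Tendsto (fun n => mollL2 n f - hγ.compLp h0 (mollL2 n f - mollL2 n g)) atTop
      (𝓝 (f - hγ.compLp h0 (f - g))) :=
    (tendsto_mollL2 f).sub (((hγ.continuous_compLp h0).tendsto _).comp
      ((tendsto_mollL2 f).sub (tendsto_mollL2 g)))
  refine isClosed_K.mem_of_tendsto hlim (Eventually.of_forall fun n => ?_)
  have hc1 := continuous_moll n (integrable_coeFn f)
  have hc2 := continuous_moll n (integrable_coeFn g)
  have hc : Continuous fun z : Dom d =>
      moll n f z.1 z.2 - γ (moll n f z.1 z.2 - moll n g z.1 z.2) :=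
    hc1.sub (hγ.continuous.comp (hc1.sub hc2))
  have e : mollL2 n f - hγ.compLp h0 (mollL2 n f - mollL2 n g) = toL2 _ hc := by
    refine Lp.ext ?_
    filter_upwards [coeFn_mollL2 n f, coeFn_mollL2 n g, coeFn_toL2 _ hc,
      Lp.coeFn_sub (mollL2 n f) (hγ.compLp h0 (mollL2 n f - mollL2 n g)),
      Lp.coeFn_sub (mollL2 n f) (mollL2 n g),
      hγ.coeFn_compLp h0 (mollL2 n f - mollL2 n g)] with z h1 h2 h3 h4 h5 h6
    rw [h4, h3, Pi.sub_apply, h6, Function.comp_apply, h5, Pi.sub_apply, h1, h2]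
  rw [e]
  refine toL2_mem_K hc fun x a b hab => ?_
  have hfm := moll_monotone n hf x hab
  have hgm := moll_monotone n hg x hab
  simp only at hfm hgm ⊢
  set A := moll n f a x - moll n g a x
  set B := moll n f b x - moll n g b x
  rcases le_total A B with hAB | hAB
  · have := hγ.dist_le_mul B A
    rw [Real.dist_eq, Real.dist_eq, abs_of_nonneg (sub_nonneg.2 hAB),
      abs_of_nonneg (sub_nonneg.2 (hm hAB)), NNReal.coe_one, one_mul] at this
    simp only [A, B] at this ⊢
    linarith
  · have := hm hAB
    simp only [A, B] at this ⊢
    linarith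

end
end LevelSet

namespace LevelSet
noncomputable section
open scoped ContDiff Topology
open Set Filter

open scoped InnerProductSpace ENNReal

variable {d : ℕ}

/-! ### Contraction in `Lᵖ` -/

theorem lintegral_rpow_mul_sub {r s : ℝ} (hr : 1 < r) (hs : 0 ≤ s) :
    ∫⁻ c in Ioi (0 : ℝ), ENNReal.ofReal (c ^ (r - 2)) * ENNReal.ofReal (s - c)
      = ENNReal.ofReal (s ^ r / (r * (r - 1))) := by
  have h1 : ∫⁻ c in Ioi (0 : ℝ), ENNReal.ofReal (c ^ (r - 2)) * ENNReal.ofReal (s - c)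
      = ∫⁻ c in Ioc (0 : ℝ) s, ENNReal.ofReal (c ^ (r - 2) * (s - c)) := by
    rw [← Ioc_union_Ioi_eq_Ioi hs, lintegral_union measurableSet_Ioi
      (Set.disjoint_left.2 fun c hc hc' => not_lt.2 hc.2 hc')]
    have e1 : ∫⁻ c in Ioi s, ENNReal.ofReal (c ^ (r - 2)) * ENNReal.ofReal (s - c) = 0 := by
      rw [setLIntegral_congr_fun (g := fun _ => 0) measurableSet_Ioi]
      · simp
      · intro c hc
        have : s - c ≤ 0 := by linarith [mem_Ioi.1 hc]
        simp only [ENNReal.ofReal_of_nonpos this, mul_zero]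
    rw [e1, add_zero]
    refine setLIntegral_congr_fun measurableSet_Ioc fun c hc => ?_
    rw [ENNReal.ofReal_mul (Real.rpow_nonneg hc.1.le _)]
  have hI : IntervalIntegrable (fun c : ℝ => s * c ^ (r - 2) - c ^ (r - 1)) volume 0 s :=
    ((intervalIntegral.intervalIntegrable_rpow' (by linarith)).const_mul s).sub
      (intervalIntegral.intervalIntegrable_rpow' (by linarith))
  have hfun : ∀ c ∈ Ioc (0 : ℝ) s, c ^ (r - 2) * (s - c) = s * c ^ (r - 2) - c ^ (r - 1) := by
    intro c hc
    have : c ^ (r - 1) = c ^ (r - 2) * c := by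
      rw [← Real.rpow_add_one hc.1.ne']; congr 1; ring
    rw [this]; ring
  have h2 : ∫ c in Ioc (0 : ℝ) s, (s * c ^ (r - 2) - c ^ (r - 1)) = s ^ r / (r * (r - 1)) := by
    rw [← intervalIntegral.integral_of_le hs, intervalIntegral.integral_sub
      ((intervalIntegral.intervalIntegrable_rpow' (by linarith)).const_mul s)
      (intervalIntegral.intervalIntegrable_rpow' (by linarith)),
      intervalIntegral.integral_const_mul, integral_rpow (Or.inl (by linarith)),
      integral_rpow (Or.inl (by linarith)), Real.zero_rpow (by linarith),
      Real.zero_rpow (by linarith), sub_zero, sub_zero]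
    have e1 : r - 2 + 1 = r - 1 := by ring
    have e2 : r - 1 + 1 = r := by ring
    rw [e1, e2]
    rcases hs.eq_or_lt with h | h
    · rw [← h, Real.zero_rpow (by linarith), Real.zero_rpow (by linarith)]; simp
    · have e3 : s ^ r = s ^ (r - 1) * s := by
        rw [← Real.rpow_add_one h.ne']; congr 1; ring
      have hr1 : r - 1 ≠ 0 := by linarith
      have hr0 : r ≠ 0 := by linarith
      rw [e3]; field_simp; ring
  rw [h1, ← h2, ofReal_integral_eq_lintegral_ofReal]
  · exact setLIntegral_congr_fun measurableSet_Ioc fun c hc => by simp only [hfun c hc]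
  · exact (intervalIntegrable_iff_integrableOn_Ioc_of_le hs).1 hI
  · refine (ae_restrict_iff' measurableSet_Ioc).2 (Eventually.of_forall fun c hc => ?_)
    simp only [Pi.zero_apply]
    rw [← hfun c hc]
    exact mul_nonneg (Real.rpow_nonneg hc.1.le _) (sub_nonneg.2 hc.2)

/-- If `∫ (|x| - c)₊ ≤ ∫ (|y| - c)₊` for all `c ≥ 0`, then `‖x‖_p ≤ ‖y‖_p` for all `p ≥ 1`. -/
theorem eLpNorm_le_of_lintegral_le {α : Type*} [MeasurableSpace α] {μ : Measure α} [SFinite μ]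
    {x y : α → ℝ} (hx : AEMeasurable x μ) (hy : AEMeasurable y μ)
    (h : ∀ c : ℝ, 0 ≤ c → ∫⁻ z, ENNReal.ofReal (|x z| - c) ∂μ ≤ ∫⁻ z, ENNReal.ofReal (|y z| - c) ∂μ)
    {p : ℝ≥0∞} (hp : 1 ≤ p) : eLpNorm x p μ ≤ eLpNorm y p μ := by
  rcases eq_or_ne p ∞ with rfl | hpt
  · rw [eLpNorm_exponent_top, eLpNorm_exponent_top]
    rcases eq_or_ne (eLpNormEssSup y μ) ∞ with htop | htop
    · rw [htop]; exact le_top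
    set C := (eLpNormEssSup y μ).toReal with hC
    have hyC : ∀ᵐ z ∂μ, |y z| ≤ C := by
      filter_upwards [ae_le_eLpNormEssSup (f := y) (μ := μ)] with z hz
      rw [hC, ← Real.norm_eq_abs, ← toReal_enorm]
      exact ENNReal.toReal_mono htop hz
    have h1 : ∫⁻ z, ENNReal.ofReal (|y z| - C) ∂μ = 0 := by
      rw [lintegral_congr_ae (g := fun _ => 0)]
      · simp
      · filter_upwards [hyC] with z hz
        exact ENNReal.ofReal_of_nonpos (by linarith)
    have h2 := h C ENNReal.toReal_nonneg
    rw [h1, nonpos_iff_eq_zero, lintegral_eq_zero_iff' (by fun_prop)] at h2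
    rw [← ENNReal.ofReal_toReal htop]
    refine eLpNormEssSup_le_of_ae_bound ?_
    filter_upwards [h2] with z hz
    simp only [Pi.zero_apply, ENNReal.ofReal_eq_zero] at hz
    rw [Real.norm_eq_abs]
    linarith
  · have hp0 : p ≠ 0 := (zero_lt_one.trans_le hp).ne'
    rw [eLpNorm_eq_lintegral_rpow_enorm_toReal hp0 hpt, eLpNorm_eq_lintegral_rpow_enorm_toReal hp0 hpt]
    set r := p.toReal with hr
    have hr1 : 1 ≤ r := by
      rw [hr, ← ENNReal.toReal_one]; exact ENNReal.toReal_mono hpt hp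
    refine ENNReal.rpow_le_rpow ?_ (by positivity)
    have henorm : ∀ (u : α → ℝ) z, ‖u z‖ₑ = ENNReal.ofReal |u z| := fun u z =>
      Real.enorm_eq_ofReal_abs _
    simp only [henorm]
    rcases hr1.eq_or_lt with h1 | h1
    · rw [← h1]
      simpa using h 0 le_rfl
    · have key : ∀ u : α → ℝ, AEMeasurable u μ → ∫⁻ z, ENNReal.ofReal |u z| ^ r ∂μ
          = ENNReal.ofReal (r * (r - 1)) * ∫⁻ c in Ioi (0 : ℝ), ENNReal.ofReal (c ^ (r - 2)) *
            ∫⁻ z, ENNReal.ofReal (|u z| - c) ∂μ := by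
        intro u hu
        have hrr : 0 < r * (r - 1) := by nlinarith
        have e1 : ∀ z, ENNReal.ofReal |u z| ^ r = ENNReal.ofReal (r * (r - 1)) *
            ∫⁻ c in Ioi (0 : ℝ), ENNReal.ofReal (c ^ (r - 2)) * ENNReal.ofReal (|u z| - c) := by
          intro z
          rw [lintegral_rpow_mul_sub h1 (abs_nonneg _), ← ENNReal.ofReal_mul hrr.le,
            mul_div_cancel₀ _ hrr.ne', ENNReal.ofReal_rpow_of_nonneg (abs_nonneg _) (by linarith)]
        simp only [e1]
        have hm : AEMeasurable (Function.uncurry fun (z : α) (c : ℝ) =>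
            ENNReal.ofReal (c ^ (r - 2)) * ENNReal.ofReal (|u z| - c))
            (μ.prod (volume.restrict (Ioi 0))) := by
          have hu' : AEMeasurable (fun q : α × ℝ => u q.1) (μ.prod (volume.restrict (Ioi 0))) :=
            hu.comp_quasiMeasurePreserving Measure.quasiMeasurePreserving_fst
          refine AEMeasurable.mul (f := fun q : α × ℝ => ENNReal.ofReal (q.2 ^ (r - 2)))
            (g := fun q : α × ℝ => ENNReal.ofReal (|u q.1| - q.2)) ?_ ?_
          · exact (ENNReal.measurable_ofReal.comp
              (measurable_snd.pow_const (r - 2))).aemeasurable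
          · exact ENNReal.measurable_ofReal.comp_aemeasurable
              ((continuous_abs.measurable.comp_aemeasurable hu').sub measurable_snd.aemeasurable)
        rw [lintegral_const_mul' _ _ ENNReal.ofReal_ne_top, lintegral_lintegral_swap hm]
        congr 1
        refine lintegral_congr fun c => ?_
        rw [lintegral_const_mul' _ _ ENNReal.ofReal_ne_top]
      rw [key x hx, key y hy]
      refine mul_le_mul_right ?_ _
      refine setLIntegral_mono' measurableSet_Ioi fun c hc => ?_
      exact mul_le_mul_right (h c (le_of_lt hc)) _

/-- The truncation `s ↦ min (s - c)₊ ε`. -/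
def trunc (c ε : ℝ) (s : ℝ) : ℝ := max 0 (min (s - c) ε)

theorem lipschitzWith_trunc (c ε : ℝ) : LipschitzWith 1 (trunc c ε) := by
  refine LipschitzWith.of_dist_le_mul fun s t => ?_
  rw [Real.dist_eq, Real.dist_eq, NNReal.coe_one, one_mul, trunc, trunc]
  have h1 := abs_max_sub_max_le_max 0 (min (s - c) ε) 0 (min (t - c) ε)
  have h2 := abs_min_sub_min_le_max (s - c) ε (t - c) ε
  simp only [sub_self, abs_zero, sub_sub_sub_cancel_right] at h1 h2
  exact h1.trans (max_le (abs_nonneg _) (h2.trans (max_le le_rfl (abs_nonneg _))))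

theorem monotone_trunc (c ε : ℝ) : Monotone (trunc c ε) := fun s t hst =>
  max_le_max le_rfl (min_le_min (by linarith) le_rfl)

theorem trunc_zero {c ε : ℝ} (hc : 0 ≤ c) : trunc c ε 0 = 0 :=
  max_eq_left ((min_le_left _ _).trans (by linarith))

theorem trunc_nonneg (c ε s : ℝ) : 0 ≤ trunc c ε s := le_max_left _ _

theorem trunc_le {c ε : ℝ} (hε : 0 ≤ ε) (s : ℝ) : trunc c ε s ≤ ε := max_le hε (min_le_right _ _)

theorem trunc_mul_ge {c ε : ℝ} (hε : 0 ≤ ε) (s : ℝ) :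
    ε * max (s - c) 0 ≤ trunc c ε s * (s - c) + ε ^ 2 := by
  unfold trunc
  rcases le_total (s - c) 0 with h1 | h1
  · rw [max_eq_right h1, max_eq_left ((min_le_left _ _).trans h1)]; nlinarith
  · rw [max_eq_left h1]
    rcases le_total (s - c) ε with h2 | h2
    · rw [min_eq_left h2, max_eq_right h1]; nlinarith
    · rw [min_eq_right h2, max_eq_right hε]; nlinarith

theorem trunc_mul_le {c ε : ℝ} (hε : 0 ≤ ε) (s t : ℝ) :
    trunc c ε s * (t - c) ≤ ε * max (t - c) 0 := by
  have h1 := trunc_nonneg c ε s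
  have h2 := trunc_le (c := c) hε s
  have h3 := le_max_left (t - c) 0
  have h4 := le_max_right (t - c) 0
  nlinarith

theorem lipschitzWith_neg_comp_neg {γ : ℝ → ℝ} (hγ : LipschitzWith 1 γ) :
    LipschitzWith 1 fun s => -γ (-s) :=
  LipschitzWith.of_dist_le_mul fun s t => by
    have := hγ.dist_le_mul (-s) (-t)
    rw [dist_neg_neg] at this ⊢
    exact this

/-- `v` is the projection of `f` onto `K`. -/
def IsProjK (f v : L2 d) : Prop := v ∈ K d ∧ ∀ w ∈ K d, ⟪f - v, w - v⟫_ℝ ≤ 0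

theorem integrable_posPart (x : L2 d) (c : ℝ) : Integrable fun z => max (x z - c) 0 :=
  ((integrable_coeFn x).sub (integrable_const c)).pos_part

theorem IsProjK.integral_posPart_le {f g v w : L2 d} (hv : IsProjK f v) (hw : IsProjK g w) {c : ℝ}
    (hc : 0 ≤ c) : ∫ z, max ((v - w : L2 d) z - c) 0 ≤ ∫ z, max ((f - g : L2 d) z - c) 0 := by
  set x := v - w with hx
  set y := f - g with hy
  refine le_of_forall_pos_le_add fun ε hε => ?_
  have hγ := lipschitzWith_trunc c ε
  set Γ : L2 d := hγ.compLp (trunc_zero hc) x with hΓ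
  have hΓz : Γ =ᵐ[volume] fun z => trunc c ε (x z) := hγ.coeFn_compLp (trunc_zero hc) x
  have h1 : 0 ≤ ⟪f - v, Γ⟫_ℝ := by
    have := hv.2 _ (sub_comp_mem_K hγ (monotone_trunc c ε) (trunc_zero hc) hv.1 hw.1)
    rw [sub_sub_cancel_left, inner_neg_right] at this
    exact neg_nonpos.1 this
  have h2 : ⟪g - w, Γ⟫_ℝ ≤ 0 := by
    have hγ' := lipschitzWith_neg_comp_neg hγ
    have hz : -trunc c ε (-0) = 0 := by rw [neg_zero, trunc_zero hc, neg_zero]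
    have hmem := sub_comp_mem_K hγ' (fun s t hst => neg_le_neg
      (monotone_trunc c ε (neg_le_neg hst))) hz hw.1 hv.1
    have := hw.2 _ hmem
    rw [sub_sub_cancel_left] at this
    have e : -(hγ'.compLp hz (w - v)) = Γ := by
      refine Lp.ext ?_
      filter_upwards [Lp.coeFn_neg (hγ'.compLp hz (w - v)), hγ'.coeFn_compLp hz (w - v), hΓz,
        Lp.coeFn_sub v w, Lp.coeFn_sub w v] with z a1 a2 a3 a4 a5
      rw [a1, Pi.neg_apply, a2, a3, Function.comp_apply, a5, hx, a4, Pi.sub_apply, Pi.sub_apply,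
        neg_neg, neg_sub]
    rwa [e] at this
  have h3 : 0 ≤ ⟪y - x, Γ⟫_ℝ := by
    have e : y - x = (f - v) - (g - w) := by rw [hx, hy]; abel
    rw [e, inner_sub_left]; linarith
  rw [inner_sub_left, inner_eq_integral, inner_eq_integral] at h3
  have ix : Integrable fun z => x z * Γ z := by
    have := L2.integrable_inner (𝕜 := ℝ) Γ x
    simpa using this
  have iy : Integrable fun z => y z * Γ z := by
    have := L2.integrable_inner (𝕜 := ℝ) Γ y
    simpa using this
  have iΓ := integrable_coeFn Γ
  have a1 : ∫ z, ε * max (x z - c) 0 ≤ ∫ z, (x z * Γ z - c * Γ z + ε ^ 2) := by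
    refine integral_mono_ae ((integrable_posPart x c).const_mul ε)
      ((ix.sub (iΓ.const_mul c)).add (integrable_const _)) ?_
    filter_upwards [hΓz] with z hz
    have := trunc_mul_ge (c := c) hε.le (x z)
    simp only [hz]
    linarith
  have a2 : ∫ z, (y z * Γ z - c * Γ z) ≤ ∫ z, ε * max (y z - c) 0 := by
    refine integral_mono_ae (iy.sub (iΓ.const_mul c)) ((integrable_posPart y c).const_mul ε) ?_
    filter_upwards [hΓz] with z hz
    have := trunc_mul_le (c := c) hε.le (x z) (y z)
    simp only [hz]
    linarith
  have i1 : Integrable fun z => x z * Γ z - c * Γ z := ix.sub (iΓ.const_mul c)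
  rw [integral_const_mul, integral_add i1 (integrable_const _),
    integral_sub ix (iΓ.const_mul c), integral_const] at a1
  rw [integral_const_mul, integral_sub iy (iΓ.const_mul c)] at a2
  simp only [probReal_univ, smul_eq_mul, one_mul] at a1
  have a3 : ε * ∫ z, max (x z - c) 0 ≤ ε * ((∫ z, max (y z - c) 0) + ε) := by nlinarith
  exact le_of_mul_le_mul_left a3 hε

theorem lintegral_abs_sub_eq (x : L2 d) {c : ℝ} (hc : 0 ≤ c) :
    ∫⁻ z, ENNReal.ofReal (|x z| - c)
      = ENNReal.ofReal ((∫ z, max (x z - c) 0) + ∫ z, max ((-x : L2 d) z - c) 0) := by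
  rw [← integral_add (integrable_posPart x c) (integrable_posPart (-x) c),
    ofReal_integral_eq_lintegral_ofReal
      (by exact (integrable_posPart x c).add (integrable_posPart (-x) c))
      (Eventually.of_forall fun z => add_nonneg (le_max_right _ _) (le_max_right _ _))]
  refine lintegral_congr_ae ?_
  filter_upwards [Lp.coeFn_neg x] with z hz
  rw [hz, Pi.neg_apply]
  rcases le_total 0 (x z) with h | h
  · rw [abs_of_nonneg h, max_eq_right (show -x z - c ≤ 0 by linarith), add_zero]
    rcases le_total 0 (x z - c) with h' | h'
    · rw [max_eq_left h']
    · rw [max_eq_right h', ENNReal.ofReal_of_nonpos h', ENNReal.ofReal_zero]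
  · rw [abs_of_nonpos h, max_eq_right (show x z - c ≤ 0 by linarith), zero_add]
    rcases le_total 0 (-x z - c) with h' | h'
    · rw [max_eq_left h']
    · rw [max_eq_right h', ENNReal.ofReal_of_nonpos h', ENNReal.ofReal_zero]

/-- The projection onto `K` is a contraction in every `Lᵖ`. -/
theorem IsProjK.eLpNorm_sub_le {f g v w : L2 d} (hv : IsProjK f v) (hw : IsProjK g w)
    {p : ℝ≥0∞} (hp : 1 ≤ p) :
    eLpNorm (v - w : L2 d) p volume ≤ eLpNorm (f - g : L2 d) p volume := by
  refine eLpNorm_le_of_lintegral_le (Lp.aestronglyMeasurable _).aemeasurable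
    (Lp.aestronglyMeasurable _).aemeasurable (fun c hc => ?_) hp
  rw [lintegral_abs_sub_eq _ hc, lintegral_abs_sub_eq _ hc, neg_sub, neg_sub]
  exact ENNReal.ofReal_le_ofReal
    (add_le_add (hv.integral_posPart_le hw hc) (hw.integral_posPart_le hv hc))

/-- The constant functions. -/
def constL2 (c : ℝ) : L2 d := toL2 (fun _ => c) continuous_const

theorem coeFn_constL2 (c : ℝ) : (constL2 c : L2 d) =ᵐ[volume] fun _ => c := coeFn_toL2 _ _

theorem isProjK_constL2 (c : ℝ) : IsProjK (constL2 c : L2 d) (constL2 c) :=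
  ⟨toL2_mem_K _ fun _ => monotone_const, fun w _ => by simp⟩

theorem ae_le_of_integral_posPart_le {x y : L2 d}
    (h : ∫ z, max (x z - 0) 0 ≤ ∫ z, max (y z - 0) 0) (hy : ∀ᵐ z, y z ≤ 0) :
    ∀ᵐ z, x z ≤ 0 := by
  have h1 : ∫ z, max (y z - 0) 0 = 0 := by
    rw [integral_congr_ae (g := fun _ => 0)]
    · simp
    · filter_upwards [hy] with z hz
      rw [sub_zero, max_eq_right hz]
  rw [h1] at h
  have h2 : ∫ z, max (x z - 0) 0 = 0 :=
    le_antisymm h (integral_nonneg fun z => le_max_right _ _)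
  have h3 := (integral_eq_zero_iff_of_nonneg (f := fun z => max (x z - 0) 0)
    (fun z => le_max_right _ _) (integrable_posPart x 0)).1 h2
  filter_upwards [h3] with z hz
  have := le_max_left (x z - 0) 0
  simp only [Pi.zero_apply] at hz
  linarith

/-- The projection onto `K` preserves upper bounds. -/
theorem IsProjK.ae_le {f v : L2 d} (hv : IsProjK f v) {c : ℝ} (hf : ∀ᵐ z, f z ≤ c) :
    ∀ᵐ z, v z ≤ c := by
  have h := ae_le_of_integral_posPart_le (hv.integral_posPart_le (isProjK_constL2 c) le_rfl) (by
    filter_upwards [hf, Lp.coeFn_sub f (constL2 c), coeFn_constL2 (d := d) c] with z h1 h2 h3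
    rw [h2, Pi.sub_apply, h3]; linarith)
  filter_upwards [h, Lp.coeFn_sub v (constL2 c), coeFn_constL2 (d := d) c] with z h1 h2 h3
  rw [h2, Pi.sub_apply, h3] at h1
  linarith

/-- The projection onto `K` preserves lower bounds. -/
theorem IsProjK.le_ae {f v : L2 d} (hv : IsProjK f v) {c : ℝ} (hf : ∀ᵐ z, c ≤ f z) :
    ∀ᵐ z, c ≤ v z := by
  have h := ae_le_of_integral_posPart_le ((isProjK_constL2 c).integral_posPart_le hv le_rfl) (by
    filter_upwards [hf, Lp.coeFn_sub (constL2 c) f, coeFn_constL2 (d := d) c] with z h1 h2 h3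
    rw [h2, Pi.sub_apply, h3]; linarith)
  filter_upwards [h, Lp.coeFn_sub (constL2 c) v, coeFn_constL2 (d := d) c] with z h1 h2 h3
  rw [h2, Pi.sub_apply, h3] at h1
  linarith

end
end LevelSet

namespace LevelSet
noncomputable section
open scoped ContDiff Topology
open Set Filter
open scoped InnerProductSpace

variable {d : ℕ}

/-- A bounded measurable velocity field on `[0,1] × 𝕋ᵈ` depending on `a` only. -/
structure Velocity (d : ℕ) where
  /-- the field -/
  toFun : unitInterval → Fin d → ℝ
  measurable : Measurable toFun
  /-- a bound for the components -/
  bound : ℝ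
  abs_le : ∀ a i, |toFun a i| ≤ bound

namespace Velocity

/-- The constant field along the `i`-th coordinate axis. -/
def single (i : Fin d) : Velocity d where
  toFun _ := Pi.single i 1
  measurable := measurable_const
  bound := 1
  abs_le _ j := by
    by_cases h : j = i
    · subst h; simp
    · simp [h]

variable (v w : Velocity d)

theorem bound_nonneg (i : Fin d) : 0 ≤ v.bound := (abs_nonneg _).trans (v.abs_le 0 i)

/-- The flow of the field. -/
def flow (s : ℝ) (z : Dom d) : Dom d := (z.1, z.2 + toTorus (s • v.toFun z.1))

theorem flow_zero (z : Dom d) : v.flow 0 z = z := by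
  simp [flow, toTorus_zero]

theorem flow_flow (s t : ℝ) (z : Dom d) : v.flow s (v.flow t z) = v.flow (s + t) z := by
  simp only [flow, add_smul, toTorus_add]
  rw [add_assoc, add_comm (toTorus (t • _))]

theorem flow_comm (s t : ℝ) (z : Dom d) : v.flow s (w.flow t z) = w.flow t (v.flow s z) := by
  simp only [flow]
  rw [add_right_comm]

theorem measurePreserving_flow (s : ℝ) : MeasurePreserving (v.flow s) volume volume := by
  refine MeasurePreserving.skew_product (μa := (volume : Measure unitInterval))
    (μc := (volume : Measure (UnitAddTorus (Fin d)))) (MeasurePreserving.id _)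
    (g := fun a x => x + toTorus (s • v.toFun a)) ?_ (Eventually.of_forall fun a => ?_)
  · have h : Measurable fun a : unitInterval => toTorus (s • v.toFun a) :=
      continuous_toTorus.measurable.comp (v.measurable.const_smul s)
    exact measurable_snd.add (h.comp measurable_fst)
  · exact (measurePreserving_add_right volume (toTorus (s • v.toFun a))).map_eq

/-- Composition with the flow. -/
def shift (s : ℝ) : L2 d →ₗᵢ[ℝ] L2 d :=
  Lp.compMeasurePreservingₗᵢ ℝ (v.flow s) (v.measurePreserving_flow s)

theorem coeFn_shift (s : ℝ) (Y : L2 d) : v.shift s Y =ᵐ[volume] fun z => Y (v.flow s z) :=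
  Lp.coeFn_compMeasurePreserving Y (v.measurePreserving_flow s)

theorem ae_flow (s : ℝ) {p : Dom d → Prop} (h : ∀ᵐ z, p z) : ∀ᵐ z, p (v.flow s z) :=
  (v.measurePreserving_flow s).quasiMeasurePreserving.ae h

theorem shift_eq_of_ae (s : ℝ) {Y Z : L2 d} {F : Dom d → ℝ} (hY : Y =ᵐ[volume] F)
    (hZ : Z =ᵐ[volume] fun z => F (v.flow s z)) : v.shift s Y = Z := by
  refine Lp.ext ?_
  filter_upwards [v.coeFn_shift s Y, hZ, v.ae_flow s hY] with z h1 h2 h3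
  rw [h1, h2, h3]

theorem shift_zero (Y : L2 d) : v.shift 0 Y = Y :=
  v.shift_eq_of_ae 0 (ae_eq_refl _) (Eventually.of_forall fun z => by simp only [flow_zero])

theorem shift_shift (s t : ℝ) (Y : L2 d) : v.shift s (v.shift t Y) = v.shift (s + t) Y := by
  refine v.shift_eq_of_ae s (v.coeFn_shift t Y) ?_
  filter_upwards [v.coeFn_shift (s + t) Y] with z hz
  rw [hz, flow_flow, add_comm]

theorem shift_comm (s t : ℝ) (Y : L2 d) : v.shift s (w.shift t Y) = w.shift t (v.shift s Y) := by
  refine v.shift_eq_of_ae s (w.coeFn_shift t Y) ?_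
  filter_upwards [w.coeFn_shift t (v.shift s Y), w.ae_flow t (v.coeFn_shift s Y)] with z h1 h2
  rw [h1, h2, flow_comm]

theorem shift_shift_neg (s : ℝ) (Y : L2 d) : v.shift s (v.shift (-s) Y) = Y := by
  rw [shift_shift, add_neg_cancel, shift_zero]

theorem inner_shift_left (s : ℝ) (Y Z : L2 d) : ⟪v.shift s Y, Z⟫_ℝ = ⟪Y, v.shift (-s) Z⟫_ℝ := by
  conv_lhs => rw [← v.shift_shift_neg s Z]
  exact (v.shift s).inner_map_map _ _

theorem eLpNorm_shift (s : ℝ) (Y : L2 d) (p : ENNReal) :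
    eLpNorm (v.shift s Y) p volume = eLpNorm Y p volume := by
  rw [eLpNorm_congr_ae (v.coeFn_shift s Y)]
  exact eLpNorm_comp_measurePreserving (Lp.aestronglyMeasurable Y) (v.measurePreserving_flow s)

theorem memLp_mul (i : Fin d) (Y : L2 d) : MemLp (fun z : Dom d => v.toFun z.1 i * Y z) 2 :=
  MemLp.of_le_mul (c := v.bound) (Lp.memLp Y)
    (((measurable_pi_apply i).comp (v.measurable.comp measurable_fst)).aestronglyMeasurable.mul
      (Lp.aestronglyMeasurable Y))
    (Eventually.of_forall fun z => by
      rw [norm_mul]; gcongr; exact v.abs_le _ _)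

/-- Multiplication by the `i`-th component of the field. -/
def mul (i : Fin d) : L2 d →L[ℝ] L2 d :=
  LinearMap.mkContinuous
    { toFun := fun Y => (v.memLp_mul i Y).toLp
      map_add' := fun Y Z => by
        rw [← MemLp.toLp_add]
        refine MemLp.toLp_congr _ _ ?_
        filter_upwards [Lp.coeFn_add Y Z] with z hz
        rw [hz, Pi.add_apply, Pi.add_apply, mul_add]
      map_smul' := fun c Y => by
        rw [RingHom.id_apply, ← MemLp.toLp_const_smul]
        refine MemLp.toLp_congr _ _ ?_
        filter_upwards [Lp.coeFn_smul c Y] with z hz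
        rw [hz, Pi.smul_apply, Pi.smul_apply, smul_eq_mul, smul_eq_mul, mul_left_comm] }
    v.bound fun Y => by
      refine Lp.norm_le_mul_norm_of_ae_le_mul ?_
      filter_upwards [(v.memLp_mul i Y).coeFn_toLp] with z hz
      refine le_trans (le_of_eq (congrArg norm hz)) ?_
      rw [norm_mul]; gcongr; exact v.abs_le _ _

theorem coeFn_mul (i : Fin d) (Y : L2 d) : v.mul i Y =ᵐ[volume] fun z => v.toFun z.1 i * Y z :=
  (v.memLp_mul i Y).coeFn_toLp

theorem mul_shift (i : Fin d) (s : ℝ) (Y : L2 d) : v.mul i (v.shift s Y) = v.shift s (v.mul i Y) := by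
  refine (v.shift_eq_of_ae s (v.coeFn_mul i Y) ?_).symm
  filter_upwards [v.coeFn_mul i (v.shift s Y), v.coeFn_shift s Y] with z h1 h2
  rw [h1, h2]
  rfl

/-- The scalar product of the field with a vector-valued function. -/
def dot (G : Fin d → L2 d) : L2 d := ∑ i, v.mul i (G i)

theorem coeFn_dot (G : Fin d → L2 d) :
    v.dot G =ᵐ[volume] fun z => ∑ i, v.toFun z.1 i * G i z := by
  have h := ae_all_iff.2 fun i => v.coeFn_mul i (G i)
  filter_upwards [h, Lp.coeFn_finsetSum Finset.univ fun i => v.mul i (G i)] with z h1 h2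
  rw [dot, h2, Finset.sum_apply]
  exact Finset.sum_congr rfl fun i _ => h1 i

theorem dot_shift (s : ℝ) (G : Fin d → L2 d) :
    v.dot (fun i => v.shift s (G i)) = v.shift s (v.dot G) := by
  simp only [dot, mul_shift, map_sum]

end Velocity

/-- The function `(a, x) ↦ q₀(a)`. -/
def liftL2 (q₀ : Lp ℝ 2 (volume : Measure unitInterval)) : L2 d :=
  Lp.compMeasurePreservingₗᵢ ℝ Prod.fst
    (measurePreserving_fst (μ := volume) (ν := (volume : Measure (UnitAddTorus (Fin d))))) q₀

theorem coeFn_liftL2 (q₀ : Lp ℝ 2 (volume : Measure unitInterval)) :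
    (liftL2 q₀ : L2 d) =ᵐ[volume] fun z => q₀ z.1 :=
  Lp.coeFn_compMeasurePreserving q₀ measurePreserving_fst

theorem norm_liftL2_sub (q₀ q₁ : Lp ℝ 2 (volume : Measure unitInterval)) :
    ‖(liftL2 q₀ - liftL2 q₁ : L2 d)‖ = ‖q₀ - q₁‖ := by
  rw [liftL2, liftL2, ← map_sub, LinearIsometry.norm_map]

theorem eLpNorm_liftL2_sub (q₀ q₁ : Lp ℝ 2 (volume : Measure unitInterval)) (p : ENNReal) :
    eLpNorm (liftL2 q₀ - liftL2 q₁ : L2 d) p volume = eLpNorm (q₀ - q₁ : Lp ℝ 2 _) p volume := by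
  rw [liftL2, liftL2, ← map_sub]
  refine (eLpNorm_congr_ae (Lp.coeFn_compMeasurePreserving (q₀ - q₁) measurePreserving_fst)).trans ?_
  exact eLpNorm_comp_measurePreserving (Lp.aestronglyMeasurable _) measurePreserving_fst

theorem ae_fst {p : unitInterval → Prop} (h : ∀ᵐ a, p a) : ∀ᵐ z : Dom d, p z.1 :=
  (measurePreserving_fst (μ := volume)
    (ν := (volume : Measure (UnitAddTorus (Fin d))))).quasiMeasurePreserving.ae h

theorem Velocity.shift_liftL2 (v : Velocity d) (s : ℝ)
    (q₀ : Lp ℝ 2 (volume : Measure unitInterval)) : v.shift s (liftL2 q₀) = liftL2 q₀ :=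
  v.shift_eq_of_ae s (coeFn_liftL2 q₀) (coeFn_liftL2 q₀)

theorem IsTestFunction.comp_sub {φ : ℝ → UnitAddTorus (Fin d) → ℝ} (hφ : IsTestFunction φ)
    (y : UnitAddTorus (Fin d)) : IsTestFunction fun a x => φ a (x - y) := by
  refine ⟨?_, ?_, ?_⟩
  · obtain ⟨y, rfl⟩ := toTorus_surjective y
    simp only [← toTorus_sub]
    exact hφ.smooth.comp (contDiff_fst.prodMk (contDiff_snd.sub contDiff_const))
  · exact hφ.compact_support.comp_homeomorph
      ((Homeomorph.refl ℝ).prodCongr (Homeomorph.subRight y))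
  · have h := tsupport_comp_eq_preimage (Function.uncurry φ)
      ((Homeomorph.refl ℝ).prodCongr (Homeomorph.subRight y))
    refine h.subset.trans ?_
    rintro ⟨a, x⟩ hp
    exact ⟨(hφ.support_subset hp).1, mem_univ _⟩

/-- The cone `K` is invariant under translations in `x`. -/
theorem shift_single_mem_K (i : Fin d) (s : ℝ) {Y : L2 d} (hY : Y ∈ K d) :
    (Velocity.single i).shift s Y ∈ K d := by
  rw [mem_K_iff] at hY ⊢
  intro φ hφ h0
  set y : UnitAddTorus (Fin d) := toTorus (s • Pi.single i 1) with hy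
  have h := hY _ (hφ.comp_sub y) fun a x => h0 a _
  rw [Velocity.inner_shift_left, Velocity.shift_eq_of_ae _ _ (coeFn_toL2 _ _)]
  · exact h
  · filter_upwards [coeFn_toL2 _ (continuous_comp_dom (continuous_deriv_fst
      (φ := fun a x => φ a (x - y)) (hφ.comp_sub y).smooth))] with z hz
    rw [hz]
    have : (Velocity.single i).flow (-s) z = (z.1, z.2 - y) := by
      rw [hy, Velocity.flow, Velocity.single, sub_eq_add_neg, neg_smul]
      congr 2
    rw [this]

end
end LevelSet

namespace LevelSet
noncomputable section
open scoped ContDiff Topology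
open Set Filter
open scoped InnerProductSpace

variable {d : ℕ}

/-- Bounded convergence in `L²`. -/
theorem tendsto_of_bounded {ι : Type*} {l : Filter ι} [l.IsCountablyGenerated] [l.NeBot]
    {f : ι → L2 d} {g : L2 d} {F : ι → Dom d → ℝ} {G : Dom d → ℝ} {M : ℝ}
    (hf : ∀ n, f n =ᵐ[volume] F n) (hg : g =ᵐ[volume] G)
    (hb : ∀ᶠ n in l, ∀ z, |F n z| ≤ M) (h : ∀ z, Tendsto (fun n => F n z) l (𝓝 (G z))) :
    Tendsto f l (𝓝 g) := by
  have hG : ∀ z, |G z| ≤ M := fun z =>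
    le_of_tendsto (h z).abs (hb.mono fun n hn => hn z)
  rw [tendsto_iff_norm_sub_tendsto_zero]
  have hae : ∀ n, (fun z => (f n - g : L2 d) z ^ 2) =ᵐ[volume] fun z => (F n z - G z) ^ 2 := by
    intro n
    filter_upwards [Lp.coeFn_sub (f n) g, hf n, hg] with z h1 h2 h3
    rw [h1, Pi.sub_apply, h2, h3]
  have key : Tendsto (fun n => ‖f n - g‖ ^ 2) l (𝓝 0) := by
    have e : ∀ n, ‖f n - g‖ ^ 2 = ∫ z, (F n z - G z) ^ 2 := fun n =>
      (norm_sq_eq_integral _).trans (integral_congr_ae (hae n))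
    simp only [e]
    have h0 : (0 : ℝ) = ∫ z : Dom d, (0 : ℝ) := by simp
    rw [h0]
    refine tendsto_integral_filter_of_dominated_convergence (fun _ => (2 * M) ^ 2) ?_ ?_
      (integrable_const _) ?_
    · exact Eventually.of_forall fun n => ((Lp.aestronglyMeasurable _).pow 2).congr (hae n)
    · filter_upwards [hb] with n hn
      refine Eventually.of_forall fun z => ?_
      rw [norm_pow, Real.norm_eq_abs]
      have := abs_sub (F n z) (G z)
      gcongr
      linarith [hn z, hG z]
    · refine Eventually.of_forall fun z => ?_
      have := ((h z).sub_const (G z)).pow 2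
      rwa [sub_self, zero_pow two_ne_zero] at this
  have := key.sqrt
  simpa [Real.sqrt_sq (norm_nonneg _)] using this

theorem exists_bound_of_continuous {F : ℝ × Dom d → ℝ} (hF : Continuous F) (t : ℝ) :
    ∃ M, ∀ s, |s - t| ≤ 1 → ∀ z, |F (s, z)| ≤ M := by
  obtain ⟨M, hM⟩ := ((isCompact_closedBall t (1 : ℝ)).prod
    (isCompact_univ (X := Dom d))).exists_bound_of_continuousOn hF.continuousOn
  exact ⟨M, fun s hs z => hM (s, z) ⟨by rwa [Metric.mem_closedBall, Real.dist_eq], mem_univ _⟩⟩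

theorem eventually_abs_sub_le_one (t : ℝ) : ∀ᶠ s in 𝓝 t, |s - t| ≤ 1 := by
  filter_upwards [Metric.closedBall_mem_nhds t one_pos] with s hs
  rwa [Metric.mem_closedBall, Real.dist_eq] at hs

theorem continuous_of_ae_eq {F : ℝ × Dom d → ℝ} (hF : Continuous F) {γ : ℝ → Dom d → Dom d}
    (hγ : ∀ z, Continuous fun t => γ t z) {f : ℝ → L2 d}
    (hf : ∀ t, f t =ᵐ[volume] fun z => F (t, γ t z)) : Continuous f := by
  refine continuous_iff_continuousAt.2 fun t => ?_
  obtain ⟨M, hM⟩ := exists_bound_of_continuous hF t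
  refine tendsto_of_bounded (M := M) hf (hf t) ?_ fun z => ?_
  · filter_upwards [eventually_abs_sub_le_one t] with s hs z
    exact hM s hs _
  · exact (hF.comp (continuous_id.prodMk (hγ z))).tendsto t

theorem hasDerivAt_of_ae_eq {F F' : ℝ → Dom d → ℝ} {f : ℝ → L2 d} {f' : L2 d} {t M : ℝ}
    (hF : ∀ s z, HasDerivAt (fun r => F r z) (F' s z) s)
    (hb : ∀ s, |s - t| ≤ 1 → ∀ z, |F' s z| ≤ M)
    (hf : ∀ s, f s =ᵐ[volume] F s) (hf' : f' =ᵐ[volume] F' t) : HasDerivAt f f' t := by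
  rw [hasDerivAt_iff_tendsto_slope]
  refine tendsto_of_bounded (M := M) (F := fun s z => slope (fun r => F r z) t s) (fun s => ?_)
    hf' ?_ fun z => hasDerivAt_iff_tendsto_slope.1 (hF t z)
  · filter_upwards [Lp.coeFn_smul (s - t)⁻¹ (f s - f t), Lp.coeFn_sub (f s) (f t), hf s, hf t]
      with z h1 h2 h3 h4
    rw [slope_def_module, h1, Pi.smul_apply, h2, Pi.sub_apply, h3, h4, slope_def_module]
  · filter_upwards [nhdsWithin_le_nhds (eventually_abs_sub_le_one t), self_mem_nhdsWithin]
      with s hs hne z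
    have hne' : s - t ≠ 0 := sub_ne_zero.2 hne
    have h1 := Convex.norm_image_sub_le_of_norm_hasDerivWithin_le (f := fun r => F r z)
      (f' := fun r => F' r z) (C := M) (s := Metric.closedBall t 1) (x := t) (y := s)
      (fun r _ => (hF r z).hasDerivWithinAt)
      (fun r hr => hb r (by rwa [Metric.mem_closedBall, Real.dist_eq] at hr) z)
      (convex_closedBall t 1) (Metric.mem_closedBall_self zero_le_one)
      (by rwa [Metric.mem_closedBall, Real.dist_eq])
    rw [slope_def_field, abs_div, div_le_iff₀ (abs_pos.2 hne')]
    exact h1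

/-- The `L²` class of a time slice of a continuous function. -/
def timeL2 (F : ℝ × Dom d → ℝ) (hF : Continuous F) (t : ℝ) : L2 d :=
  toL2 (fun z => F (t, z)) (hF.comp (by fun_prop))

theorem coeFn_timeL2 (F : ℝ × Dom d → ℝ) (hF : Continuous F) (t : ℝ) :
    timeL2 F hF t =ᵐ[volume] fun z => F (t, z) := coeFn_toL2 _ _

theorem continuous_timeL2 {F : ℝ × Dom d → ℝ} (hF : Continuous F) : Continuous (timeL2 F hF) :=
  continuous_of_ae_eq hF (γ := fun _ z => z) (fun _ => continuous_const) (coeFn_timeL2 F hF)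

theorem Velocity.continuous_flow (v : Velocity d) (z : Dom d) : Continuous fun t => v.flow t z := by
  refine continuous_const.prodMk (continuous_const.add (continuous_toTorus.comp ?_))
  exact continuous_id.smul continuous_const

theorem Velocity.coeFn_shift_timeL2 (v : Velocity d) {F : ℝ × Dom d → ℝ} (hF : Continuous F)
    (t : ℝ) : v.shift t (timeL2 F hF t) =ᵐ[volume] fun z => F (t, v.flow t z) := by
  filter_upwards [v.coeFn_shift t (timeL2 F hF t), v.ae_flow t (coeFn_timeL2 F hF t)] with z h1 h2
  rw [h1, h2]

theorem Velocity.continuous_shift_timeL2 (v : Velocity d) {F : ℝ × Dom d → ℝ}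
    (hF : Continuous F) : Continuous fun t => v.shift t (timeL2 F hF t) :=
  continuous_of_ae_eq hF v.continuous_flow fun t => v.coeFn_shift_timeL2 hF t

section Smooth

variable {Z : ℝ → ℝ → UnitAddTorus (Fin d) → ℝ}

theorem continuous_of_comp_time {E : Type*} [TopologicalSpace E]
    {f : ℝ → ℝ → UnitAddTorus (Fin d) → E}
    (hf : Continuous fun p : ℝ × ℝ × (Fin d → ℝ) => f p.1 p.2.1 (toTorus p.2.2)) :
    Continuous fun p : ℝ × Dom d => f p.1 p.2.1 p.2.2 := by
  have h1 : Continuous fun p : (ℝ × ℝ) × UnitAddTorus (Fin d) => f p.1.1 p.1.2 p.2 := by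
    refine continuous_of_comp_prod_toTorus ?_
    exact hf.comp (g := fun p : ℝ × ℝ × (Fin d → ℝ) => f p.1 p.2.1 (toTorus p.2.2))
      (f := fun q : (ℝ × ℝ) × (Fin d → ℝ) => (q.1.1, q.1.2, q.2)) (by fun_prop)
  exact h1.comp (f := fun p : ℝ × Dom d => ((p.1, (p.2.1 : ℝ)), p.2.2)) (by fun_prop)

/-- The lift of a time dependent function to the universal cover of the torus. -/
def coverLift (Z : ℝ → ℝ → UnitAddTorus (Fin d) → ℝ) (p : ℝ × ℝ × (Fin d → ℝ)) : ℝ :=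
  Z p.1 p.2.1 (toTorus p.2.2)

theorem deriv_eq_fderiv_coverLift (hZ : ContDiff ℝ ∞ (coverLift Z)) (t a : ℝ) (x : Fin d → ℝ) :
    deriv (fun s => Z s a (toTorus x)) t = fderiv ℝ (coverLift Z) (t, a, x) (1, 0, 0) := by
  have h1 : HasFDerivAt (coverLift Z) (fderiv ℝ (coverLift Z) (t, a, x)) (t, a, x) :=
    (hZ.differentiable (by simp)).differentiableAt.hasFDerivAt
  have h2 : HasDerivAt (fun s : ℝ => (s, a, x)) ((1 : ℝ), (0 : ℝ), (0 : Fin d → ℝ)) t :=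
    (hasDerivAt_id t).prodMk ((hasDerivAt_const t a).prodMk (hasDerivAt_const t x))
  exact (h1.comp_hasDerivAt t h2).deriv

theorem torusDeriv_eq_fderiv_coverLift (hZ : ContDiff ℝ ∞ (coverLift Z)) (i : Fin d) (t a : ℝ)
    (x : Fin d → ℝ) :
    torusDeriv i (Z t a) (toTorus x) = fderiv ℝ (coverLift Z) (t, a, x) (0, 0, Pi.single i 1) := by
  have h1 : HasFDerivAt (coverLift Z) (fderiv ℝ (coverLift Z) (t, a, x)) (t, a, x) :=
    (hZ.differentiable (by simp)).differentiableAt.hasFDerivAt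
  have h2 : HasDerivAt (fun s : ℝ => (t, a, x + s • (Pi.single i 1 : Fin d → ℝ)))
      ((0 : ℝ), (0 : ℝ), (Pi.single i 1 : Fin d → ℝ)) 0 := by
    refine (hasDerivAt_const _ t).prodMk ((hasDerivAt_const _ a).prodMk ?_)
    simpa using ((hasDerivAt_id (0 : ℝ)).smul_const (Pi.single i (1 : ℝ) : Fin d → ℝ)).const_add x
  have h3 := (h1.comp_hasDerivAt_of_eq (0 : ℝ) h2 (by simp)).deriv
  rw [← h3, torusDeriv]
  congr 1
  ext s
  simp only [Function.comp_apply, coverLift, toTorus_add, toTorus_smul_single]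

theorem continuous_time (hZ : ContDiff ℝ ∞ (coverLift Z)) :
    Continuous fun p : ℝ × Dom d => Z p.1 p.2.1 p.2.2 :=
  continuous_of_comp_time hZ.continuous

theorem continuous_time_deriv (hZ : ContDiff ℝ ∞ (coverLift Z)) :
    Continuous fun p : ℝ × Dom d => deriv (fun s => Z s p.2.1 p.2.2) p.1 := by
  refine continuous_of_comp_time (f := fun t a x => deriv (fun s => Z s a x) t) ?_
  simp only [deriv_eq_fderiv_coverLift hZ]
  exact (hZ.continuous_fderiv (by simp)).clm_apply continuous_const

theorem continuous_time_torusDeriv (hZ : ContDiff ℝ ∞ (coverLift Z)) (i : Fin d) :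
    Continuous fun p : ℝ × Dom d => torusDeriv i (Z p.1 p.2.1) p.2.2 := by
  refine continuous_of_comp_time (f := fun t a x => torusDeriv i (Z t a) x) ?_
  simp only [torusDeriv_eq_fderiv_coverLift hZ]
  exact (hZ.continuous_fderiv (by simp)).clm_apply continuous_const

theorem hasDerivAt_along_flow (hZ : ContDiff ℝ ∞ (coverLift Z)) (v : Velocity d) (t : ℝ) (z : Dom d) :
    HasDerivAt (fun s => Z s (v.flow s z).1 (v.flow s z).2)
      (deriv (fun s => Z s (v.flow t z).1 (v.flow t z).2) t +
        ∑ i, v.toFun z.1 i * torusDeriv i (Z t (v.flow t z).1) (v.flow t z).2) t := by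
  obtain ⟨a, x⟩ := z
  obtain ⟨x, rfl⟩ := toTorus_surjective x
  simp only [Velocity.flow, ← toTorus_add, deriv_eq_fderiv_coverLift hZ,
    torusDeriv_eq_fderiv_coverLift hZ]
  have h1 : HasFDerivAt (coverLift Z) (fderiv ℝ (coverLift Z) (t, a, x + t • v.toFun a))
      (t, a, x + t • v.toFun a) :=
    (hZ.differentiable (by simp)).differentiableAt.hasFDerivAt
  have h2 : HasDerivAt (fun s : ℝ => (s, (a : ℝ), x + s • v.toFun a))
      ((1 : ℝ), (0 : ℝ), v.toFun a) t := by
    refine (hasDerivAt_id t).prodMk ((hasDerivAt_const _ (a : ℝ)).prodMk ?_)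
    simpa using ((hasDerivAt_id t).smul_const (v.toFun a)).const_add x
  refine (h1.comp_hasDerivAt t h2).congr_deriv ?_
  have e : ((1 : ℝ), (0 : ℝ), v.toFun a) = ((1 : ℝ), (0 : ℝ), (0 : Fin d → ℝ)) +
      ∑ i, v.toFun a i • ((0 : ℝ), (0 : ℝ), (Pi.single i 1 : Fin d → ℝ)) := by
    have hv := pi_eq_sum_univ' (v.toFun a)
    refine Prod.ext ?_ (Prod.ext ?_ ?_)
    · simp [Prod.fst_sum]
    · simp [Prod.fst_sum, Prod.snd_sum]
    · simp only [Prod.snd_add, Prod.snd_sum, Prod.smul_snd, zero_add]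
      exact hv
  rw [e, map_add, map_sum]
  simp only [map_smul, smul_eq_mul]

/-- `Z(t, ·)` as an element of `L²`. -/
def sliceL2 (hZ : ContDiff ℝ ∞ (coverLift Z)) : ℝ → L2 d := timeL2 _ (continuous_time hZ)

/-- `∇ₓ Z(t, ·)` as an element of `L²`. -/
def gradL2 (hZ : ContDiff ℝ ∞ (coverLift Z)) (t : ℝ) (i : Fin d) : L2 d :=
  timeL2 _ (continuous_time_torusDeriv hZ i) t

/-- `∂ₜ Z(t, ·) + v ⬝ ∇ₓ Z(t, ·)` as an element of `L²`. -/
def transportL2 (hZ : ContDiff ℝ ∞ (coverLift Z)) (v : Velocity d) (t : ℝ) : L2 d :=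
  timeL2 _ (continuous_time_deriv hZ) t + v.dot (gradL2 hZ t)

theorem coeFn_transportL2 (hZ : ContDiff ℝ ∞ (coverLift Z)) (v : Velocity d) (t : ℝ) :
    transportL2 hZ v t =ᵐ[volume] fun z => deriv (fun s => Z s z.1 z.2) t +
      ∑ i, v.toFun z.1 i * torusDeriv i (Z t z.1) z.2 := by
  have h := ae_all_iff.2 fun i => coeFn_timeL2 _ (continuous_time_torusDeriv hZ i) t
  filter_upwards [Lp.coeFn_add (timeL2 _ (continuous_time_deriv hZ) t) (v.dot (gradL2 hZ t)),
    coeFn_timeL2 _ (continuous_time_deriv hZ) t, v.coeFn_dot (gradL2 hZ t), h] with z h1 h2 h3 h4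
  rw [transportL2, h1, Pi.add_apply, h2, h3]
  simp only [gradL2, h4]

theorem continuous_transportL2 (hZ : ContDiff ℝ ∞ (coverLift Z)) (v : Velocity d) :
    Continuous (transportL2 hZ v) :=
  (continuous_timeL2 _).add (continuous_finsetSum _ fun i _ =>
    (v.mul i).continuous.comp (continuous_timeL2 _))

theorem continuous_shift_transportL2 (hZ : ContDiff ℝ ∞ (coverLift Z)) (v : Velocity d) :
    Continuous fun t => v.shift t (transportL2 hZ v t) := by
  simp only [transportL2, map_add, ← v.dot_shift]
  exact (v.continuous_shift_timeL2 _).add (continuous_finsetSum _ fun i _ =>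
    (v.mul i).continuous.comp (v.continuous_shift_timeL2 (continuous_time_torusDeriv hZ i)))

theorem hasDerivAt_shift_sliceL2 (hZ : ContDiff ℝ ∞ (coverLift Z)) (v : Velocity d) (t : ℝ) :
    HasDerivAt (fun s => v.shift s (sliceL2 hZ s)) (v.shift t (transportL2 hZ v t)) t := by
  obtain ⟨M, hM⟩ := exists_bound_of_continuous (continuous_time_deriv hZ) t
  choose N hN using fun i => exists_bound_of_continuous (continuous_time_torusDeriv hZ i) t
  refine hasDerivAt_of_ae_eq (M := M + ∑ i, v.bound * N i)
    (fun s z => hasDerivAt_along_flow hZ v s z) (fun s hs z => ?_)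
    (fun s => v.coeFn_shift_timeL2 (continuous_time hZ) s) ?_
  · refine (abs_add_le _ _).trans (add_le_add (hM s hs (v.flow s z))
      ((Finset.abs_sum_le_sum_abs _ _).trans (Finset.sum_le_sum fun i _ => ?_)))
    rw [abs_mul]
    exact mul_le_mul (v.abs_le _ _) (hN i s hs (v.flow s z)) (abs_nonneg _) (v.bound_nonneg i)
  · filter_upwards [v.coeFn_shift t (transportL2 hZ v t),
      v.ae_flow t (coeFn_transportL2 hZ v t)] with z h1 h2
    rw [h1, h2]
    rfl

end Smooth

end
end LevelSet

namespace LevelSet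
noncomputable section
open scoped ContDiff Topology
open Set Filter
open scoped InnerProductSpace

variable {d : ℕ}

theorem transportL2_const {φ : ℝ → UnitAddTorus (Fin d) → ℝ}
    (hφ : ContDiff ℝ ∞ (coverLift fun _ => φ)) (v : Velocity d) (t : ℝ) :
    transportL2 hφ v t = v.dot (gradL2 hφ t) := by
  have h : timeL2 _ (continuous_time_deriv hφ) t = 0 := by
    refine Lp.ext ?_
    filter_upwards [coeFn_timeL2 _ (continuous_time_deriv hφ) t,
      Lp.coeFn_zero ℝ 2 (volume : Measure (Dom d))] with z h1 h2
    rw [h1, h2]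
    simp
  rw [transportL2, h, zero_add]

/-- Difference quotients of a stationary smooth function along the flow. -/
theorem norm_shift_sliceL2_sub_le {φ : ℝ → UnitAddTorus (Fin d) → ℝ}
    (hφ : ContDiff ℝ ∞ (coverLift fun _ => φ)) (v : Velocity d) (s : ℝ) :
    ‖v.shift s (sliceL2 hφ 0) - sliceL2 hφ 0‖ ≤ ‖v.dot (gradL2 hφ 0)‖ * |s| := by
  have h1 := Convex.norm_image_sub_le_of_norm_hasDerivWithin_le
    (f := fun r => v.shift r (sliceL2 hφ r)) (f' := fun r => v.shift r (transportL2 hφ v r))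
    (C := ‖v.dot (gradL2 hφ 0)‖) (s := univ) (x := 0) (y := s)
    (fun r _ => (hasDerivAt_shift_sliceL2 hφ v r).hasDerivWithinAt)
    (fun r _ => by rw [LinearIsometry.norm_map, transportL2_const]; rfl) convex_univ (mem_univ _) (mem_univ _)
  simp only [v.shift_zero, sub_zero, Real.norm_eq_abs] at h1
  exact h1

theorem contDiff_coverLift_const {φ : ℝ → UnitAddTorus (Fin d) → ℝ}
    (hφ : ContDiff ℝ ∞ fun p : ℝ × (Fin d → ℝ) => φ p.1 (toTorus p.2)) :
    ContDiff ℝ ∞ (coverLift fun _ => φ) := hφ.comp contDiff_snd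

theorem contDiff_coverLift_moll (n : ℕ) (Y : L2 d) : ContDiff ℝ ∞ (coverLift fun _ => moll n Y) :=
  contDiff_coverLift_const (contDiff_moll n (integrable_coeFn Y))

theorem gradL2_moll (n : ℕ) {Y G : L2 d} {i : Fin d} (h : HasWeakDeriv i Y G) (t : ℝ) :
    gradL2 (contDiff_coverLift_moll n Y) t i = mollL2 n G := by
  refine Lp.ext ?_
  filter_upwards [coeFn_timeL2 _ (continuous_time_torusDeriv (contDiff_coverLift_moll n Y) i) t,
    coeFn_mollL2 n G] with z h1 h2
  rw [gradL2, h1, h2]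
  exact torusDeriv_moll_eq n h z.1.2 z.2

theorem Velocity.tendsto_dot_mollL2 (v : Velocity d) (G : Fin d → L2 d) :
    Tendsto (fun n => v.dot fun i => mollL2 n (G i)) atTop (𝓝 (v.dot G)) :=
  tendsto_finsetSum _ fun i _ => ((v.mul i).continuous.tendsto _).comp (tendsto_mollL2 (G i))

theorem Velocity.norm_shift_sub_le (v : Velocity d) {Y : L2 d} {G : Fin d → L2 d}
    (h : ∀ i, HasWeakDeriv i Y (G i)) (s : ℝ) : ‖v.shift s Y - Y‖ ≤ ‖v.dot G‖ * |s| := by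
  refine le_of_tendsto_of_tendsto (f := fun n => ‖v.shift s (mollL2 n Y) - mollL2 n Y‖)
    (g := fun n => ‖v.dot fun i => mollL2 n (G i)‖ * |s|) (b := atTop)
    ((((v.shift s).continuous.tendsto _).comp (tendsto_mollL2 Y)).sub (tendsto_mollL2 Y)).norm
    ((v.tendsto_dot_mollL2 G).norm.mul_const _) (Eventually.of_forall fun n => ?_)
  have h1 := norm_shift_sliceL2_sub_le (contDiff_coverLift_moll n Y) v s
  have h2 : gradL2 (contDiff_coverLift_moll n Y) 0 = fun i => mollL2 n (G i) :=
    funext fun i => gradL2_moll n (h i) 0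
  rw [h2] at h1
  exact h1

theorem Velocity.dot_single (i : Fin d) (G : Fin d → L2 d) : (single i).dot G = G i := by
  refine Lp.ext ?_
  filter_upwards [(single i).coeFn_dot G] with z hz
  rw [hz]
  simp [single, Pi.single_apply]

theorem hasWeakDeriv_iff {i : Fin d} {Y G : L2 d} : HasWeakDeriv i Y G ↔
    ∀ (φ : ℝ → UnitAddTorus (Fin d) → ℝ) (hφ : IsTestFunction φ),
      ⟪Y, gradL2 (contDiff_coverLift_const hφ.smooth) 0 i⟫_ℝ
        = -⟪G, sliceL2 (contDiff_coverLift_const hφ.smooth) 0⟫_ℝ := by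
  simp only [gradL2, sliceL2, timeL2, inner_toL2]
  rfl

theorem hasDerivAt_inner_shift {φ : ℝ → UnitAddTorus (Fin d) → ℝ}
    (hφ : ContDiff ℝ ∞ (coverLift fun _ => φ)) (i : Fin d) (Y : L2 d) :
    HasDerivAt (fun s => ⟪(Velocity.single i).shift s Y, sliceL2 hφ 0⟫_ℝ)
      (-⟪Y, gradL2 hφ 0 i⟫_ℝ) 0 := by
  have h1 := hasDerivAt_shift_sliceL2 hφ (Velocity.single i) 0
  rw [transportL2_const, Velocity.dot_single, Velocity.shift_zero] at h1
  have h3 := HasDerivAt.scomp_of_eq (0 : ℝ) h1 ((hasDerivAt_id (0 : ℝ)).fun_neg) (by simp)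
  have h4 := (hasDerivAt_const (0 : ℝ) Y).inner ℝ h3
  simp only [Function.comp_apply, inner_zero_left, add_zero, id, neg_smul, one_smul,
    inner_neg_right] at h4
  refine h4.congr_of_eventuallyEq (Eventually.of_forall fun s => ?_)
  exact Velocity.inner_shift_left _ _ _ _

/-- Translation-Lipschitz functions have weak derivatives in `L²`. -/
theorem exists_hasWeakDeriv {i : Fin d} {Y : L2 d} {C : ℝ}
    (h : ∀ s, ‖(Velocity.single i).shift s Y - Y‖ ≤ C * |s|) :
    ∃ G, HasWeakDeriv i Y G ∧ ‖G‖ ≤ C := by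
  set D : ℝ → L2 d := fun s => s⁻¹ • ((Velocity.single i).shift s Y - Y) with hD
  have hC : 0 ≤ C := by simpa using (norm_nonneg _).trans (h 1)
  have hDn : ∀ s, ‖D s‖ ≤ C := by
    intro s
    rw [hD]
    simp only [norm_smul, norm_inv, Real.norm_eq_abs]
    by_cases hs : s = 0
    · subst hs; simpa using hC
    · rw [inv_mul_le_iff₀ (abs_pos.2 hs), mul_comm]
      exact h s
  let X : ℝ → WeakDual ℝ (L2 d) := fun s => StrongDual.toWeakDual (InnerProductSpace.toDual ℝ _ (D s))
  obtain ⟨ℓ, hℓ, hlim⟩ := (WeakDual.isCompact_closedBall (0 : StrongDual ℝ (L2 d))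
    C).ultrafilter_le_nhds ((Ultrafilter.of (𝓝[≠] (0 : ℝ))).map X) (by
      rw [Ultrafilter.coe_map, le_principal_iff, mem_map]
      filter_upwards with s
      exact mem_closedBall_zero_iff.2
        (((InnerProductSpace.toDual ℝ (L2 d)).norm_map (D s)).le.trans (hDn s)))
  set G : L2 d := (InnerProductSpace.toDual ℝ (L2 d)).symm (WeakDual.toStrongDual ℓ) with hG
  refine ⟨G, hasWeakDeriv_iff.2 fun φ hφ => ?_, ?_⟩
  · set w := sliceL2 (contDiff_coverLift_const hφ.smooth) 0
    have h1 : Tendsto (fun s => ⟪D s, w⟫_ℝ) (Ultrafilter.of (𝓝[≠] (0 : ℝ))) (𝓝 ⟪G, w⟫_ℝ) := by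
      have := ((WeakDual.eval_continuous (𝕜 := ℝ) w).tendsto ℓ).comp
        (show Tendsto X (Ultrafilter.of (𝓝[≠] (0 : ℝ)) : Filter ℝ) (𝓝 ℓ) from hlim)
      have e : ⟪G, w⟫_ℝ = ℓ w := by
        rw [hG, InnerProductSpace.toDual_symm_apply]; rfl
      rw [e]
      exact this
    have h2 := hasDerivAt_iff_tendsto_slope.1
      (hasDerivAt_inner_shift (contDiff_coverLift_const hφ.smooth) i Y)
    have h3 : slope (fun s => ⟪(Velocity.single i).shift s Y, w⟫_ℝ) 0 = fun s => ⟪D s, w⟫_ℝ := by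
      ext s
      rw [slope_def_module, hD]
      simp only [sub_zero, Velocity.shift_zero, real_inner_smul_left, inner_sub_left, smul_eq_mul]
    rw [h3] at h2
    have h4 := tendsto_nhds_unique h1 (h2.mono_left (Ultrafilter.of_le _))
    rw [h4, neg_neg]
  · rw [hG, LinearIsometryEquiv.norm_map]
    simpa using hℓ

/-- The data of the splitting scheme. -/
def splitting (v : Velocity d) (q₀ : Lp ℝ 2 (volume : Measure unitInterval)) :
    Splitting (L2 d) where
  K := K d
  isClosed := isClosed_K
  convex := convex_K
  nonempty := ⟨0, zero_mem_K⟩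
  U h := v.shift (-h)
  U_zero Y := by rw [neg_zero, v.shift_zero]
  U_add s t Y := by rw [v.shift_shift, neg_add]
  b := liftL2 q₀
  U_b t := v.shift_liftL2 _ _

variable (v : Velocity d) (q₀ : Lp ℝ 2 (volume : Measure unitInterval))

theorem shift_proj (i : Fin d) (s : ℝ) (Y : L2 d) :
    (splitting v q₀).proj ((Velocity.single i).shift s Y)
      = (Velocity.single i).shift s ((splitting v q₀).proj Y) := by
  refine (splitting v q₀).proj_eq (shift_single_mem_K i s ((splitting v q₀).proj_mem Y))
    fun w hw => ?_
  have h := (splitting v q₀).inner_proj_le Y (w := (Velocity.single i).shift (-s) w)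
    (shift_single_mem_K i (-s) hw)
  rw [← (Velocity.shift _ s).inner_map_map, map_sub, map_sub, Velocity.shift_shift_neg] at h
  exact h

theorem shift_step (i : Fin d) (s h : ℝ) (Y : L2 d) :
    (splitting v q₀).step h ((Velocity.single i).shift s Y)
      = (Velocity.single i).shift s ((splitting v q₀).step h Y) := by
  rw [Splitting.step, Splitting.step, ← shift_proj, map_add, map_smul]
  congr 2
  · exact Velocity.shift_comm _ _ _ _ _
  · exact congrArg _ ((Velocity.single i).shift_liftL2 s q₀).symm

variable (d) in
/-- The elements of `K` that are Lipschitz with respect to translations in `x`. -/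
def lipK (C : ℝ) : Set (L2 d) :=
  {Y | Y ∈ K d ∧ ∀ i s, ‖(Velocity.single i).shift s Y - Y‖ ≤ C * |s|}

theorem isClosed_lipK (C : ℝ) : IsClosed (lipK d C) := by
  refine isClosed_K.inter (s₂ := {Y | ∀ i s, ‖(Velocity.single i).shift s Y - Y‖ ≤ C * |s|}) ?_
  simp only [ofPred_forall]
  exact isClosed_iInter fun i => isClosed_iInter fun s => isClosed_le
    ((((Velocity.single i).shift s).continuous.sub continuous_id).norm) continuous_const

theorem isRegularSet_lipK {C : ℝ} (hC : 0 ≤ C) :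
    (splitting v q₀).IsRegularSet (lipK d C) (∑ i, ‖v.mul i‖ * C) where
  nonneg := Finset.sum_nonneg fun i _ => mul_nonneg (norm_nonneg _) hC
  subset := fun Y hY => hY.1
  lipschitz := fun Y hY h => by
    choose G hG hGn using fun i => exists_hasWeakDeriv (hY.2 i)
    have h1 := v.norm_shift_sub_le hG (-h)
    rw [abs_neg] at h1
    refine h1.trans (mul_le_mul_of_nonneg_right ?_ (abs_nonneg _))
    exact (norm_sum_le _ _).trans (Finset.sum_le_sum fun i _ =>
      ((v.mul i).le_opNorm _).trans (mul_le_mul_of_nonneg_left (hGn i) (norm_nonneg _)))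
  step_mem := fun h _ Y hY => ⟨(splitting v q₀).step_mem h Y, fun i s => by
    rw [← shift_step]
    exact ((splitting v q₀).norm_step_sub_step_le h _ _).trans (hY.2 i s)⟩

theorem GradInL2.exists_mem_lipK {Y : L2 d} (h : GradInL2 Y) (hY : Y ∈ K d) :
    ∃ C, 0 ≤ C ∧ Y ∈ lipK d C := by
  choose G hG using h
  refine ⟨∑ i, ‖G i‖, Finset.sum_nonneg fun i _ => norm_nonneg _, hY, fun i s => ?_⟩
  have h1 := (Velocity.single i).norm_shift_sub_le hG s
  rw [Velocity.dot_single] at h1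
  refine h1.trans (mul_le_mul_of_nonneg_right ?_ (abs_nonneg _))
  exact Finset.single_le_sum (f := fun i => ‖G i‖) (fun i _ => norm_nonneg _) (Finset.mem_univ i)

theorem exists_mollL2_mem_lipK (n : ℕ) {Y : L2 d} (hY : Y ∈ K d) :
    ∃ C, 0 ≤ C ∧ mollL2 n Y ∈ lipK d C := by
  set G := gradL2 (contDiff_coverLift_moll n Y) 0
  refine ⟨∑ i, ‖G i‖, Finset.sum_nonneg fun i _ => norm_nonneg _, mollL2_mem_K n hY,
    fun i s => ?_⟩
  have h1 := norm_shift_sliceL2_sub_le (contDiff_coverLift_moll n Y) (Velocity.single i) s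
  rw [Velocity.dot_single] at h1
  refine h1.trans (mul_le_mul_of_nonneg_right ?_ (abs_nonneg _))
  exact Finset.single_le_sum (f := fun i => ‖G i‖) (fun i _ => norm_nonneg _) (Finset.mem_univ i)

theorem gradInL2_of_mem_lipK {C : ℝ} {Y : L2 d} (hY : Y ∈ lipK d C) : GradInL2 Y := fun i =>
  let ⟨G, hG, _⟩ := exists_hasWeakDeriv (hY.2 i)
  ⟨G, hG⟩

theorem exists_mem_lipK_norm_sub_lt {Y : L2 d} (hY : Y ∈ K d) {ε : ℝ} (hε : 0 < ε) :
    ∃ C, 0 ≤ C ∧ ∃ Y' ∈ lipK d C, ‖Y - Y'‖ < ε := by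
  obtain ⟨n, hn⟩ := ((tendsto_mollL2 Y).eventually (Metric.ball_mem_nhds Y hε)).exists
  obtain ⟨C, hC, h⟩ := exists_mollL2_mem_lipK n hY
  exact ⟨C, hC, _, h, by rwa [dist_comm, dist_eq_norm] at hn⟩

theorem denseRegular : (splitting v q₀).DenseRegular := by
  intro Y hY ε hε
  obtain ⟨C, hC, Y', hY', h⟩ := exists_mem_lipK_norm_sub_lt hY hε
  exact ⟨_, _, isRegularSet_lipK v q₀ hC, Y', hY', h⟩

end
end LevelSet

namespace LevelSet
noncomputable section
open scoped ContDiff Topology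
open Set Filter
open scoped InnerProductSpace

variable {d : ℕ}

section Link

variable {Z : ℝ → ℝ → UnitAddTorus (Fin d) → ℝ} {v : Velocity d} {q : unitInterval → Fin d → ℝ}
  {q₀ : Lp ℝ 2 (volume : Measure unitInterval)} {Y₀ : L2 d} {Y : ℝ → L2 d}

theorem integral_abs_sub_sq (hZ : ContDiff ℝ ∞ (coverLift Z)) (y : L2 d) (t : ℝ) :
    ∫ z : Dom d, |y z - Z t z.1 z.2| ^ 2 = ‖y - sliceL2 hZ t‖ ^ 2 := by
  rw [norm_sq_eq_integral]
  refine integral_congr_ae ?_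
  filter_upwards [Lp.coeFn_sub y (sliceL2 hZ t), coeFn_timeL2 _ (continuous_time hZ) t] with z h1 h2
  rw [h1, Pi.sub_apply, sliceL2, h2, sq_abs]

theorem integral_sub_mul_sub (hZ : ContDiff ℝ ∞ (coverLift Z)) (hv : ∀ᵐ a, v.toFun a = q a)
    (q₀ : Lp ℝ 2 (volume : Measure unitInterval)) (y : L2 d) (t : ℝ) :
    ∫ z : Dom d, (y z - Z t z.1 z.2) * (q₀ z.1 - deriv (fun s => Z s z.1 z.2) t
        - ∑ i, q z.1 i * torusDeriv i (Z t z.1) z.2)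
      = ⟪y - sliceL2 hZ t, liftL2 q₀ - transportL2 hZ v t⟫_ℝ := by
  rw [inner_eq_integral]
  refine integral_congr_ae ?_
  filter_upwards [Lp.coeFn_sub y (sliceL2 hZ t), coeFn_timeL2 _ (continuous_time hZ) t,
    Lp.coeFn_sub (liftL2 q₀) (transportL2 hZ v t), coeFn_liftL2 q₀, coeFn_transportL2 hZ v t,
    ae_fst hv] with z h1 h2 h3 h4 h5 h6
  rw [h1, Pi.sub_apply, sliceL2, h2, h3, Pi.sub_apply, h4, h5, h6, sub_sub]

theorem IsMonotoneSmooth.sliceL2_mem_K (hZ : IsMonotoneSmooth Z) {t : ℝ} (ht : 0 ≤ t) :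
    sliceL2 hZ.smooth t ∈ K d := by
  refine toL2_mem_K _ fun x a b hab => ?_
  have hs : ContDiff ℝ ∞ fun c => Z t c x := by
    obtain ⟨x, rfl⟩ := toTorus_surjective x
    exact hZ.smooth.comp (contDiff_const.prodMk (contDiff_id.prodMk contDiff_const))
  have h : MonotoneOn (fun c => Z t c x) (Icc 0 1) :=
    monotoneOn_of_deriv_nonneg (convex_Icc 0 1) hs.continuous.continuousOn
      (hs.differentiable (by simp)).differentiableOn fun c hc =>
        hZ.deriv_nonneg t ht c (interior_subset hc) x
  exact h a.2 b.2 hab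

theorem continuousOn_norm_sq_sub (hZ : ContDiff ℝ ∞ (coverLift Z)) (hY : ContinuousOn Y (Ici 0)) :
    ContinuousOn (fun t => ‖Y t - sliceL2 hZ t‖ ^ 2) (Ici 0) :=
  (hY.sub (continuous_timeL2 _).continuousOn).norm.pow 2

theorem continuousOn_inner_sub (hZ : ContDiff ℝ ∞ (coverLift Z)) (v : Velocity d) (b : L2 d)
    (hY : ContinuousOn Y (Ici 0)) :
    ContinuousOn (fun t => 2 * ⟪Y t - sliceL2 hZ t, b - transportL2 hZ v t⟫_ℝ) (Ici 0) :=
  continuousOn_const.mul ((hY.sub (continuous_timeL2 _).continuousOn).inner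
    (continuousOn_const.sub (continuous_transportL2 hZ v).continuousOn))

theorem IsSolution.sub_le_integral (hv : ∀ᵐ a, v.toFun a = q a) (h : IsSolution q q₀ Y₀ Y)
    (hZ : IsMonotoneSmooth Z) {s t : ℝ} (hs : 0 ≤ s) (hst : s ≤ t) :
    ‖Y t - sliceL2 hZ.smooth t‖ ^ 2 - ‖Y s - sliceL2 hZ.smooth s‖ ^ 2
      ≤ ∫ r in s..t, 2 * ⟪Y r - sliceL2 hZ.smooth r,
        liftL2 q₀ - transportL2 hZ.smooth v r⟫_ℝ := by
  refine sub_le_integral_of_distrib_le (continuousOn_norm_sq_sub hZ.smooth h.continuous)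
    (continuousOn_inner_sub hZ.smooth v _ h.continuous) (fun θ h1 h2 h3 h4 => ?_) hs hst
  have := h.semi_integral Z hZ θ h1 h2 h3 h4
  simpa only [integral_abs_sub_sq hZ.smooth, integral_sub_mul_sub hZ.smooth hv] using this

/-- The limit of the splitting scheme is a solution. -/
theorem isSolution_sol (hv : ∀ᵐ a, v.toFun a = q a) (hY₀ : Y₀ ∈ K d) :
    IsSolution q q₀ Y₀ ((splitting v q₀).sol Y₀) := by
  have hS := denseRegular v q₀
  have hc := hS.continuousOn_sol hY₀
  have hU : ∀ t, (splitting v q₀).U (-t) = v.shift t := fun t => by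
    change v.shift (- -t) = _
    rw [neg_neg]
  refine ⟨hc, fun t ht => hS.sol_mem hY₀ ht, hS.sol_zero hY₀, fun Z hZ θ h1 h2 h3 h4 => ?_⟩
  simp only [integral_abs_sub_sq hZ.smooth, integral_sub_mul_sub hZ.smooth hv]
  refine distrib_le_of_sub_le_integral (continuousOn_norm_sq_sub hZ.smooth hc)
    (continuousOn_inner_sub hZ.smooth v _ hc) (fun s t hs hst => ?_) h1 h2 h3 h4
  refine Splitting.norm_sq_sol_sub_le_integral hS hY₀ (continuous_timeL2 _)
    (fun t ht => hZ.sliceL2_mem_K ht) (continuous_transportL2 hZ.smooth v) ?_ (fun t => ?_) hs hst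
  · simp only [hU]
    exact continuous_shift_transportL2 hZ.smooth v
  · simp only [hU]
    exact hasDerivAt_shift_sliceL2 hZ.smooth v t

theorem isMonotoneSmooth_moll (n : ℕ) {W : L2 d} (hW : W ∈ K d) :
    IsMonotoneSmooth fun _ => moll n W :=
  ⟨contDiff_coverLift_moll n W, fun _ _ _ ha x => deriv_moll_nonneg n hW ha x⟩

theorem transportL2_moll (v : Velocity d) (n : ℕ) {W : L2 d} {G : Fin d → L2 d}
    (h : ∀ i, HasWeakDeriv i W (G i)) (t : ℝ) :
    transportL2 (contDiff_coverLift_moll n W) v t = v.dot fun i => mollL2 n (G i) := by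
  have h2 : gradL2 (contDiff_coverLift_moll n W) t = fun i => mollL2 n (G i) :=
    funext fun i => gradL2_moll n (h i) t
  rw [transportL2_const, h2]

end Link

/-- The graph of the operator `v ⬝ ∇ₓ` in `L²`. -/
def graph (v : Velocity d) : Set (L2 d × L2 d) :=
  {p | ∃ G : Fin d → L2 d, (∀ i, HasWeakDeriv i p.1 (G i)) ∧ p.2 = v.dot G}

theorem convex_graph (v : Velocity d) : Convex ℝ (graph v) := by
  rintro ⟨Y, g⟩ ⟨G, hG, hg⟩ ⟨Y', g'⟩ ⟨G', hG', hg'⟩ α β - - -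
  refine ⟨fun i => α • G i + β • G' i, fun i => ?_, ?_⟩
  · have h1 := hasWeakDeriv_iff.1 (hG i)
    have h2 := hasWeakDeriv_iff.1 (hG' i)
    refine hasWeakDeriv_iff.2 fun φ hφ => ?_
    have e1 := h1 φ hφ
    have e2 := h2 φ hφ
    simp only [Prod.fst_add, Prod.smul_fst, inner_add_left, real_inner_smul_left] at e1 e2 ⊢
    rw [e1, e2]; ring
  · simp only at hg hg'
    simp only [Prod.snd_add, Prod.smul_snd, hg, hg', Velocity.dot, map_add, map_smul,
      Finset.sum_add_distrib, Finset.smul_sum]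

theorem GradInL2.exists_mem_graph {Y : L2 d} (h : GradInL2 Y) (v : Velocity d) :
    ∃ g, (Y, g) ∈ graph v := by
  choose G hG using h
  exact ⟨_, G, hG, rfl⟩

theorem exists_mem_graph_norm_sub_lt (v : Velocity d) :
    ∀ Z ∈ K d, ∀ ε > 0, ∃ Z' ∈ K d, ‖Z - Z'‖ < ε ∧ ∃ g, (Z', g) ∈ graph v := by
  intro Z hZ ε hε
  obtain ⟨C, _, Z', hZ', h⟩ := exists_mem_lipK_norm_sub_lt hZ hε
  exact ⟨Z', hZ'.1, h, (gradInL2_of_mem_lipK hZ').exists_mem_graph v⟩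

section Unique

variable {v : Velocity d} {q : unitInterval → Fin d → ℝ}
  {q₀ q₀' : Lp ℝ 2 (volume : Measure unitInterval)} {Y₀ Y₀' : L2 d} {Y Y' : ℝ → L2 d}

theorem IsSolution.isIntegralSolution (hv : ∀ᵐ a, v.toFun a = q a) (h : IsSolution q q₀ Y₀ Y) :
    IsIntegralSolution (K d) (graph v) (liftL2 q₀) Y := by
  refine ⟨h.continuous, h.mem_K, ?_⟩
  rintro W g hW ⟨G, hG, hg⟩ s t hs hst
  simp only at hG hg
  subst hg
  have hsub : uIcc s t ⊆ Ici 0 := by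
    rw [uIcc_of_le hst]; exact fun r hr => hs.trans hr.1
  have hi : ∀ W' g' : L2 d, IntervalIntegrable (fun r => 2 * ⟪Y r - W', g'⟫_ℝ) volume s t :=
    fun W' g' => ContinuousOn.intervalIntegrable <|
      (continuousOn_const.mul ((h.continuous.sub continuousOn_const).inner
        continuousOn_const)).mono hsub
  have hiY : IntervalIntegrable Y volume s t := (h.continuous.mono hsub).intervalIntegrable
  have e : ∀ W' g' : L2 d, ∫ r in s..t, 2 * ⟪Y r - W', g'⟫_ℝ
      = 2 * (⟪∫ r in s..t, Y r, g'⟫_ℝ - (t - s) * ⟪W', g'⟫_ℝ) := by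
    intro W' g'
    have hin : IntervalIntegrable (fun r => ⟪Y r, g'⟫_ℝ) volume s t :=
      ((h.continuous.inner continuousOn_const).mono hsub).intervalIntegrable
    have h1 : ∫ r in s..t, ⟪Y r, g'⟫_ℝ = ⟪∫ r in s..t, Y r, g'⟫_ℝ := by
      have := (innerSL ℝ g').intervalIntegral_comp_comm hiY
      simp only [innerSL_apply_apply] at this
      rw [real_inner_comm, ← this]
      simp only [real_inner_comm]
    rw [intervalIntegral.integral_const_mul]
    simp only [inner_sub_left]
    rw [intervalIntegral.integral_sub hin intervalIntegrable_const, h1,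
      intervalIntegral.integral_const, smul_eq_mul]
  have hm : ∀ n, ‖Y t - mollL2 n W‖ ^ 2 - ‖Y s - mollL2 n W‖ ^ 2
      ≤ ∫ r in s..t, 2 * ⟪Y r - mollL2 n W, liftL2 q₀ - v.dot fun i => mollL2 n (G i)⟫_ℝ := by
    intro n
    have h1 := h.sub_le_integral hv (isMonotoneSmooth_moll n hW) hs hst
    simp only [transportL2_moll v n hG] at h1
    exact h1
  have hW' := tendsto_mollL2 W
  have hg' : Tendsto (fun n => liftL2 q₀ - v.dot fun i => mollL2 n (G i)) atTop
      (𝓝 (liftL2 q₀ - v.dot G)) := (v.tendsto_dot_mollL2 G).const_sub _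
  simp only [e] at hm ⊢
  refine le_of_tendsto_of_tendsto' (b := atTop) ?_ ?_ hm
  · exact ((hW'.const_sub _).norm.pow 2).sub ((hW'.const_sub _).norm.pow 2)
  · exact ((tendsto_const_nhds.inner hg').sub ((hW'.inner hg').const_mul _)).const_mul 2

theorem sol_mem_lipK (v : Velocity d) (q₀ : Lp ℝ 2 (volume : Measure unitInterval)) {C : ℝ}
    (hC : 0 ≤ C) (hY₀ : Y₀ ∈ lipK d C) {t : ℝ} (ht : 0 ≤ t) :
    (splitting v q₀).sol Y₀ t ∈ lipK d C := by
  have hR := isRegularSet_lipK v q₀ hC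
  refine (isClosed_lipK C).mem_of_tendsto (hR.tendsto_approx hY₀ ht)
    (Eventually.of_forall fun n => hR.iterate_mem (by positivity) hY₀ _)

/-- Two solutions are compared in `L²`. -/
theorem IsSolution.norm_sub_le (hv : ∀ᵐ a, v.toFun a = q a) (h : IsSolution q q₀ Y₀ Y)
    (h' : IsSolution q q₀' Y₀' Y') {t : ℝ} (ht : 0 ≤ t) :
    ‖Y t - Y' t‖ ≤ ‖Y₀ - Y₀'‖ + t * ‖q₀ - q₀'‖ := by
  have key : ∀ {q₁ : Lp ℝ 2 (volume : Measure unitInterval)} {X₀ W : L2 d} {X : ℝ → L2 d} {C : ℝ},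
      IsSolution q q₁ X₀ X → 0 ≤ C → W ∈ lipK d C →
      ‖X t - (splitting v q₀').sol W t‖ ≤ ‖X₀ - W‖ + t * ‖q₁ - q₀'‖ := by
    intro q₁ X₀ W X C hX hC hW
    have hsol := isSolution_sol (q₀ := q₀') hv hW.1
    have h1 := (hsol.isIntegralSolution hv).norm_sub_le convex_K (convex_graph v)
      (exists_mem_graph_norm_sub_lt v) (fun r hr => (gradInL2_of_mem_lipK
        (sol_mem_lipK v q₀' hC hW hr)).exists_mem_graph v) (hX.isIntegralSolution hv) ht
    rwa [norm_liftL2_sub, hX.initial, hsol.initial] at h1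
  refine le_of_forall_pos_le_add fun ε hε => ?_
  have hY₀' : Y₀' ∈ K d := h'.initial ▸ h'.mem_K 0 le_rfl
  obtain ⟨C, hC, W, hW, hlt⟩ := exists_mem_lipK_norm_sub_lt hY₀' (half_pos hε)
  have h1 := key h hC hW
  have h2 := key h' hC hW
  rw [sub_self, norm_zero, mul_zero, add_zero] at h2
  have h3 := norm_sub_le_norm_sub_add_norm_sub (Y t) ((splitting v q₀').sol W t) (Y' t)
  have h4 := norm_sub_le_norm_sub_add_norm_sub Y₀ Y₀' W
  rw [norm_sub_rev ((splitting v q₀').sol W t)] at h3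
  linarith

theorem IsSolution.eq_sol (hv : ∀ᵐ a, v.toFun a = q a) (h : IsSolution q q₀ Y₀ Y) {t : ℝ}
    (ht : 0 ≤ t) : Y t = (splitting v q₀).sol Y₀ t := by
  have hY₀ : Y₀ ∈ K d := h.initial ▸ h.mem_K 0 le_rfl
  have h1 := h.norm_sub_le hv (isSolution_sol (q₀ := q₀) hv hY₀) ht
  rw [sub_self, sub_self, norm_zero, norm_zero, mul_zero, add_zero] at h1
  exact sub_eq_zero.1 (norm_le_zero_iff.1 h1)

end Unique

end
end LevelSet

namespace LevelSet
noncomputable section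
open scoped ContDiff Topology
open Set Filter
open scoped InnerProductSpace

variable {d : ℕ}

theorem exists_ae_abs_le {α : Type*} {m : MeasurableSpace α} {μ : Measure α} {f : α → ℝ}
    (hf : MemLp f ⊤ μ) : ∃ M, ∀ᵐ z ∂μ, |f z| ≤ M := by
  refine ⟨(eLpNorm f ⊤ μ).toReal, ?_⟩
  filter_upwards [enorm_ae_le_eLpNormEssSup f μ] with z hz
  rw [eLpNorm_exponent_top, ← Real.norm_eq_abs, ← toReal_enorm]
  exact ENNReal.toReal_mono (by rw [← eLpNorm_exponent_top]; exact hf.2.ne) hz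

/-- A bounded field agrees almost everywhere with a measurable and everywhere bounded one. -/
theorem exists_velocity {q : unitInterval → Fin d → ℝ} (hq : MemLp q ⊤ volume) :
    ∃ v : Velocity d, ∀ᵐ a, v.toFun a = q a := by
  obtain ⟨M, hM⟩ := exists_ae_abs_le hq.norm
  have hm := hq.1.stronglyMeasurable_mk.measurable
  have hM0 : 0 ≤ M := by
    obtain ⟨a, ha⟩ := hM.exists
    exact (abs_nonneg _).trans ha
  refine ⟨⟨fun a i => max (-M) (min (hq.1.mk q a i) M), ?_, M, fun a i => ?_⟩, ?_⟩
  · exact measurable_pi_lambda _ fun i => measurable_const.max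
      (((measurable_pi_apply i).comp hm).min measurable_const)
  · exact abs_le.2 ⟨le_max_left _ _, max_le (by linarith) (min_le_right _ _)⟩
  · filter_upwards [hM, hq.1.ae_eq_mk] with a h1 h2
    funext i
    rw [← h2]
    have h3 : |q a i| ≤ M := by
      rw [abs_of_nonneg (norm_nonneg _)] at h1
      exact (norm_le_pi_norm (q a) i).trans h1
    rw [min_eq_left (abs_le.1 h3).2, max_eq_right (abs_le.1 h3).1]

theorem ae_le_of_tendsto {f : ℕ → L2 d} {g : L2 d} {c : ℝ} (h : Tendsto f atTop (𝓝 g))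
    (hf : ∀ n, ∀ᵐ z, f n z ≤ c) : ∀ᵐ z, g z ≤ c := by
  obtain ⟨ns, -, hns⟩ := (tendstoInMeasure_of_tendsto_Lp h).exists_seq_tendsto_ae
  filter_upwards [hns, ae_all_iff.2 hf] with z h1 h2
  exact le_of_tendsto' h1 fun n => h2 _

theorem le_ae_of_tendsto {f : ℕ → L2 d} {g : L2 d} {c : ℝ} (h : Tendsto f atTop (𝓝 g))
    (hf : ∀ n, ∀ᵐ z, c ≤ f n z) : ∀ᵐ z, c ≤ g z := by
  obtain ⟨ns, -, hns⟩ := (tendstoInMeasure_of_tendsto_Lp h).exists_seq_tendsto_ae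
  filter_upwards [hns, ae_all_iff.2 hf] with z h1 h2
  exact ge_of_tendsto' h1 fun n => h2 _

theorem floor_mul_inv_le (n : ℕ) {t : ℝ} (ht : 0 ≤ t) : (⌊2 ^ n * t⌋₊ : ℝ) * (2 ^ n)⁻¹ ≤ t := by
  rw [← div_eq_mul_inv, div_le_iff₀ (by positivity), mul_comm t]
  exact Nat.floor_le (by positivity)

section Bounds

variable (v : Velocity d) (q₀ q₀' : Lp ℝ 2 (volume : Measure unitInterval))

theorem isProjK_proj (Y : L2 d) : IsProjK Y ((splitting v q₀).proj Y) :=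
  ⟨(splitting v q₀).proj_mem Y, fun _ hw => (splitting v q₀).inner_proj_le Y hw⟩

variable {v q₀ q₀'}

theorem coeFn_shift_add_smul (v : Velocity d) (q₀ : Lp ℝ 2 (volume : Measure unitInterval))
    (h : ℝ) (Y : L2 d) : (v.shift (-h) Y + h • liftL2 q₀ : L2 d) =ᵐ[volume]
      fun z => Y (v.flow (-h) z) + h * q₀ z.1 := by
  filter_upwards [Lp.coeFn_add (v.shift (-h) Y) (h • liftL2 q₀), Lp.coeFn_smul h (liftL2 q₀ : L2 d),
    v.coeFn_shift (-h) Y, coeFn_liftL2 q₀] with z h1 h2 h3 h4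
  rw [h1, Pi.add_apply, h2, Pi.smul_apply, h3, h4, smul_eq_mul]

theorem iterate_step_ae_le {Y : L2 d} {c m h : ℝ} (hh : 0 ≤ h) (hY : ∀ᵐ z, Y z ≤ c)
    (hq : ∀ᵐ a, q₀ a ≤ m) (n : ℕ) :
    ∀ᵐ z, ((splitting v q₀).step h)^[n] Y z ≤ c + n * h * m := by
  induction n with
  | zero => simpa using hY
  | succ n ih =>
    rw [Function.iterate_succ_apply']
    refine (isProjK_proj v q₀ _).ae_le ?_
    filter_upwards [coeFn_shift_add_smul v q₀ h (((splitting v q₀).step h)^[n] Y),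
      v.ae_flow (-h) ih, ae_fst hq] with z h1 h2 h3
    refine (le_of_eq h1).trans ?_
    push_cast
    nlinarith [mul_le_mul_of_nonneg_left h3 hh]

theorem le_iterate_step_ae {Y : L2 d} {c m h : ℝ} (hh : 0 ≤ h) (hY : ∀ᵐ z, c ≤ Y z)
    (hq : ∀ᵐ a, -q₀ a ≤ m) (n : ℕ) :
    ∀ᵐ z, c - n * h * m ≤ ((splitting v q₀).step h)^[n] Y z := by
  induction n with
  | zero => simpa using hY
  | succ n ih =>
    rw [Function.iterate_succ_apply']
    refine (isProjK_proj v q₀ _).le_ae ?_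
    filter_upwards [coeFn_shift_add_smul v q₀ h (((splitting v q₀).step h)^[n] Y),
      v.ae_flow (-h) ih, ae_fst hq] with z h1 h2 h3
    refine le_trans ?_ (le_of_eq h1.symm)
    push_cast
    nlinarith [mul_le_mul_of_nonneg_left h3 hh]

theorem sol_ae_le {Y : L2 d} (hYK : Y ∈ K d) {c m t : ℝ} (ht : 0 ≤ t) (hm : 0 ≤ m)
    (hY : ∀ᵐ z, Y z ≤ c) (hq : ∀ᵐ a, q₀ a ≤ m) :
    ∀ᵐ z, (splitting v q₀).sol Y t z ≤ c + t * m := by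
  refine ae_le_of_tendsto ((denseRegular v q₀).tendsto_approx hYK ht) fun n => ?_
  filter_upwards [iterate_step_ae_le (v := v) (h := (2 ^ n)⁻¹) (by positivity) hY hq ⌊2 ^ n * t⌋₊]
    with z hz
  exact hz.trans (by gcongr; exact floor_mul_inv_le n ht)

theorem le_sol_ae {Y : L2 d} (hYK : Y ∈ K d) {c m t : ℝ} (ht : 0 ≤ t) (hm : 0 ≤ m)
    (hY : ∀ᵐ z, c ≤ Y z) (hq : ∀ᵐ a, -q₀ a ≤ m) :
    ∀ᵐ z, c - t * m ≤ (splitting v q₀).sol Y t z := by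
  refine le_ae_of_tendsto ((denseRegular v q₀).tendsto_approx hYK ht) fun n => ?_
  filter_upwards [le_iterate_step_ae (v := v) (h := (2 ^ n)⁻¹) (by positivity) hY hq ⌊2 ^ n * t⌋₊]
    with z hz
  exact le_trans (by gcongr; exact floor_mul_inv_le n ht) hz

theorem eLpNorm_step_sub_le {Y Y' : L2 d} {h : ℝ} (hh : 0 ≤ h) {p : ENNReal} (hp : 1 ≤ p) :
    eLpNorm ((splitting v q₀).step h Y - (splitting v q₀').step h Y' : L2 d) p volume
      ≤ eLpNorm (Y - Y' : L2 d) p volume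
        + ENNReal.ofReal h * eLpNorm (q₀ - q₀' : Lp ℝ 2 _) p volume := by
  refine ((isProjK_proj v q₀ _).eLpNorm_sub_le (isProjK_proj v q₀' _) hp).trans ?_
  have e : v.shift (-h) Y + h • liftL2 q₀ - (v.shift (-h) Y' + h • liftL2 q₀')
      = v.shift (-h) (Y - Y') + h • (liftL2 q₀ - liftL2 q₀' : L2 d) := by
    rw [map_sub, smul_sub]; abel
  change eLpNorm (v.shift (-h) Y + h • liftL2 q₀ - (v.shift (-h) Y' + h • liftL2 q₀') : L2 d) p
    volume ≤ _
  rw [e, eLpNorm_congr_ae (Lp.coeFn_add _ _)]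
  refine (eLpNorm_add_le (Lp.aestronglyMeasurable _) (Lp.aestronglyMeasurable _) hp).trans ?_
  rw [v.eLpNorm_shift, eLpNorm_congr_ae (Lp.coeFn_smul h _), eLpNorm_const_smul,
    eLpNorm_liftL2_sub, Real.enorm_of_nonneg hh]

theorem eLpNorm_iterate_step_sub_le {Y Y' : L2 d} {h : ℝ} (hh : 0 ≤ h) {p : ENNReal}
    (hp : 1 ≤ p) (n : ℕ) :
    eLpNorm (((splitting v q₀).step h)^[n] Y - ((splitting v q₀').step h)^[n] Y' : L2 d) p volume
      ≤ eLpNorm (Y - Y' : L2 d) p volume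
        + ENNReal.ofReal (n * h) * eLpNorm (q₀ - q₀' : Lp ℝ 2 _) p volume := by
  induction n with
  | zero => simp
  | succ n ih =>
    rw [Function.iterate_succ_apply', Function.iterate_succ_apply']
    refine (eLpNorm_step_sub_le hh hp).trans ((add_le_add_left ih _).trans ?_)
    rw [add_assoc, ← add_mul, ← ENNReal.ofReal_add (by positivity) hh]
    push_cast
    rw [add_mul, one_mul]

theorem eLpNorm_sol_sub_le {Y Y' : L2 d} (hY : Y ∈ K d) (hY' : Y' ∈ K d) {t : ℝ} (ht : 0 ≤ t)
    {p : ENNReal} (hp : 1 ≤ p) :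
    eLpNorm ((splitting v q₀).sol Y t - (splitting v q₀').sol Y' t : L2 d) p volume
      ≤ eLpNorm (Y - Y' : L2 d) p volume
        + ENNReal.ofReal t * eLpNorm (q₀ - q₀' : Lp ℝ 2 _) p volume := by
  have hlim := ((denseRegular v q₀).tendsto_approx hY ht).sub
    ((denseRegular v q₀').tendsto_approx hY' ht)
  refine eLpNorm_le_of_tendstoInMeasure (Eventually.of_forall fun n => ?_)
    (tendstoInMeasure_of_tendsto_Lp hlim) fun n => Lp.aestronglyMeasurable _
  refine (eLpNorm_iterate_step_sub_le (h := (2 ^ n)⁻¹) (by positivity) hp ⌊2 ^ n * t⌋₊).trans ?_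
  gcongr
  exact floor_mul_inv_le n ht

end Bounds

section Regularity

variable {v : Velocity d} {q : unitInterval → Fin d → ℝ}
  {q₀ : Lp ℝ 2 (volume : Measure unitInterval)} {Y₀ : L2 d} {Y : ℝ → L2 d}

theorem intervalIntegrable_of_right_deriv {E : Type*} [NormedAddCommGroup E] [NormedSpace ℝ E]
    {Y V : ℝ → E} {M : ℝ} (hY : ContinuousOn Y (Ici 0))
    (hV : ∀ t, 0 ≤ t → HasDerivWithinAt Y (V t) (Ici t) t) (hM : ∀ t, 0 ≤ t → ‖V t‖ ≤ M)
    {t : ℝ} (ht : 0 ≤ t) : IntervalIntegrable V volume 0 t := by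
  rw [intervalIntegrable_iff_integrableOn_Ioc_of_le ht]
  have hX : Continuous fun s => Y (max s 0) :=
    hY.comp_continuous (continuous_id.max continuous_const) fun s => mem_Ici.2 (le_max_right _ _)
  refine Integrable.of_bound (C := M) ?_ ?_
  · let f : ℕ → ℝ → E := fun n s =>
      ((n : ℝ) + 1) • (Y (max (s + 1 / ((n : ℝ) + 1)) 0) - Y (max s 0))
    refine aestronglyMeasurable_of_tendsto_ae atTop (f := f) (fun n => ?_) ?_
    · refine Continuous.aestronglyMeasurable (continuous_const.smul (Continuous.sub ?_ hX))
      exact hX.comp (continuous_id.add continuous_const)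
    · filter_upwards [ae_restrict_mem (measurableSet_Ioc (a := (0 : ℝ)) (b := t))] with s hs
      have h1 := (hasDerivWithinAt_iff_tendsto_slope.1 (hV s hs.1.le))
      have h2 : Tendsto (fun n : ℕ => s + 1 / ((n : ℝ) + 1)) atTop (𝓝[Ici s \ {s}] s) := by
        refine tendsto_nhdsWithin_iff.2 ⟨?_, Eventually.of_forall fun n => ?_⟩
        · simpa using (tendsto_one_div_add_atTop_nhds_zero_nat (𝕜 := ℝ)).const_add s
        · have : (0 : ℝ) < 1 / ((n : ℝ) + 1) := by positivity
          exact ⟨by simp only [mem_Ici]; linarith, by simp only [mem_singleton_iff]; linarith⟩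
      refine (h1.comp h2).congr fun n => ?_
      have : (0 : ℝ) < 1 / ((n : ℝ) + 1) := by positivity
      simp only [Function.comp_apply, slope_def_module, f]
      rw [max_eq_left hs.1.le, max_eq_left (by linarith [hs.1]), add_sub_cancel_left, one_div,
        inv_inv]
  · exact (ae_restrict_mem measurableSet_Ioc).mono fun s hs => hM s hs.1.le

theorem IsSolution.exists_hasTimeDeriv (hv : ∀ᵐ a, v.toFun a = q a) (h : IsSolution q q₀ Y₀ Y)
    {C : ℝ} (hC : ∀ t, 0 ≤ t → Y t ∈ lipK d C) : ∃ V, HasTimeDeriv Y V := by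
  have hd : ∀ t, 0 ≤ t → ∃ V, HasDerivWithinAt Y V (Ici t) t ∧
      ‖V‖ ≤ ‖(liftL2 q₀ : L2 d)‖ + ∑ i, ‖v.mul i‖ * C := by
    intro t ht
    choose G hG hGn using fun i => exists_hasWeakDeriv ((hC t ht).2 i)
    obtain ⟨V, hV, hVn, -⟩ := (h.isIntegralSolution hv).exists_hasDerivWithinAt convex_K
      (convex_graph v) (exists_mem_graph_norm_sub_lt v) ht
      (g₀ := v.dot G) ⟨G, hG, rfl⟩
    refine ⟨V, hV, ?_⟩
    have h1 := _root_.norm_sub_le (liftL2 q₀ : L2 d) (v.dot G)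
    suffices h2 : ‖v.dot G‖ ≤ ∑ i, ‖v.mul i‖ * C by linarith
    exact (norm_sum_le _ _).trans (Finset.sum_le_sum fun i _ =>
      ((v.mul i).le_opNorm _).trans (mul_le_mul_of_nonneg_left (hGn i) (norm_nonneg _)))
  choose! V hV hVn using hd
  have hi := fun t (ht : 0 ≤ t) => intervalIntegrable_of_right_deriv h.continuous hV hVn ht
  refine ⟨V, hV, hi, fun t ht => ?_⟩
  rw [intervalIntegral.integral_eq_sub_of_hasDeriv_right (f := Y) (f' := V) ?_ ?_ (hi t ht)]
  · abel
  · refine h.continuous.mono ?_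
    rw [uIcc_of_le ht]; exact fun r hr => hr.1
  · intro s hs
    rw [min_eq_left ht] at hs
    exact (hV s hs.1.le).mono Ioi_subset_Ici_self

end Regularity

end
end LevelSet

open LevelSet
theorem proposition1 (d : ℕ) (q : unitInterval → Fin d → ℝ) (hq : MemLp q ⊤ volume) :
    -- existence and uniqueness
    (∀ Y₀ ∈ K d, ∀ q₀ : Lp ℝ 2 (volume : Measure unitInterval),
      ∃ Y : ℝ → L2 d, IsSolution q q₀ Y₀ Y ∧
        ∀ Y' : ℝ → L2 d, IsSolution q q₀ Y₀ Y' → ∀ t, 0 ≤ t → Y' t = Y t) ∧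
    -- maximum and minimum bounds
    (∀ (Y₀ : L2 d) (q₀ : Lp ℝ 2 (volume : Measure unitInterval)) (Y : ℝ → L2 d),
      IsSolution q q₀ Y₀ Y → MemLp Y₀ ⊤ volume → MemLp q₀ ⊤ volume →
      ∀ t, 0 ≤ t → ∀ᵐ z : Dom d,
        -(t * essSup (fun a => max (-q₀ a) 0) volume) + essInf Y₀ volume ≤ Y t z ∧
        Y t z ≤ essSup Y₀ volume + t * essSup (fun a => max (q₀ a) 0) volume) ∧
    -- propagation of regularity
    (∀ (Y₀ : L2 d) (q₀ : Lp ℝ 2 (volume : Measure unitInterval)) (Y : ℝ → L2 d),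
      IsSolution q q₀ Y₀ Y → GradInL2 Y₀ →
      (∃ V : ℝ → L2 d, HasTimeDeriv Y V) ∧ ∀ t, 0 ≤ t → GradInL2 (Y t)) ∧
    -- stability in `L²` and in `Lᵖ`
    (∀ (Y₀ Y₀' : L2 d) (q₀ q₀' : Lp ℝ 2 (volume : Measure unitInterval)) (Y Y' : ℝ → L2 d),
      IsSolution q q₀ Y₀ Y → IsSolution q q₀' Y₀' Y' →
      (∀ t, 0 ≤ t → ‖Y t - Y' t‖ ≤ ‖Y₀ - Y₀'‖ + t * ‖q₀ - q₀'‖) ∧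
      ∀ p : ENNReal, 1 ≤ p → MemLp (Y₀ - Y₀') p volume → MemLp (q₀ - q₀') p volume →
        ∀ t, 0 ≤ t → MemLp (Y t - Y' t) p volume ∧
          eLpNorm (Y t - Y' t) p volume ≤
            eLpNorm (Y₀ - Y₀') p volume + ENNReal.ofReal t * eLpNorm (q₀ - q₀') p volume) := by
  obtain ⟨v, hv⟩ := exists_velocity hq
  have hmem : ∀ {Y₀ : L2 d} {q₀ : Lp ℝ 2 (volume : Measure unitInterval)} {Y : ℝ → L2 d},
      IsSolution q q₀ Y₀ Y → Y₀ ∈ K d := fun h => h.initial ▸ h.mem_K 0 le_rfl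
  refine ⟨fun Y₀ hY₀ q₀ => ⟨_, isSolution_sol hv hY₀, fun Y' h' t ht => h'.eq_sol hv ht⟩,
    fun Y₀ q₀ Y h hY₀ hq₀ t ht => ?_, fun Y₀ q₀ Y h hg => ?_, fun Y₀ Y₀' q₀ q₀' Y Y' h h' =>
      ⟨fun t ht => h.norm_sub_le hv h' ht, fun p hp hY hq' t ht => ?_⟩⟩
  · obtain ⟨M, hM⟩ := exists_ae_abs_le hY₀
    obtain ⟨N, hN⟩ := exists_ae_abs_le hq₀
    have hpos : ∀ f : unitInterval → ℝ, (∀ᵐ a, |f a| ≤ N) →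
        (∀ᵐ a, f a ≤ essSup (fun a => max (f a) 0) volume) ∧
          0 ≤ essSup (fun a => max (f a) 0) volume := by
      intro f hf
      have h1 : ∀ᵐ a, max (f a) 0 ≤ essSup (fun a => max (f a) 0) volume := by
        refine ae_le_essSup ⟨max N 0, ?_⟩
        rw [Filter.eventually_map]
        filter_upwards [hf] with a ha
        exact max_le_max ((le_abs_self _).trans ha) le_rfl
      obtain ⟨a, ha⟩ := h1.exists
      exact ⟨h1.mono fun a ha => (le_max_left _ _).trans ha, (le_max_right _ _).trans ha⟩
    obtain ⟨h1, h2⟩ := hpos q₀ hN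
    obtain ⟨h3, h4⟩ := hpos (fun a => -q₀ a) (by simpa only [abs_neg] using hN)
    have h5 : ∀ᵐ z, Y₀ z ≤ essSup Y₀ volume := ae_le_essSup ⟨M, by
      rw [Filter.eventually_map]; exact hM.mono fun z hz => (le_abs_self _).trans hz⟩
    have h6 : ∀ᵐ z, essInf Y₀ volume ≤ Y₀ z := ae_essInf_le ⟨-M, by
      rw [Filter.eventually_map]; exact hM.mono fun z hz => (abs_le.1 hz).1⟩
    rw [h.eq_sol hv ht]
    filter_upwards [sol_ae_le (v := v) (hmem h) ht h2 h5 h1,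
      le_sol_ae (v := v) (hmem h) ht h4 h6 h3] with z e1 e2
    exact ⟨by linarith, e1⟩
  · obtain ⟨C, hC, hYC⟩ := hg.exists_mem_lipK (hmem h)
    have hlip : ∀ t, 0 ≤ t → Y t ∈ lipK d C := fun t ht => by
      rw [h.eq_sol hv ht]
      exact sol_mem_lipK v q₀ hC hYC ht
    exact ⟨h.exists_hasTimeDeriv hv hlip, fun t ht => gradInL2_of_mem_lipK (hlip t ht)⟩
  · have hle : eLpNorm (Y t - Y' t : L2 d) p volume ≤ eLpNorm (Y₀ - Y₀' : L2 d) p volume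
        + ENNReal.ofReal t * eLpNorm (q₀ - q₀' : Lp ℝ 2 _) p volume := by
      rw [h.eq_sol hv ht, h'.eq_sol hv ht]
      exact eLpNorm_sol_sub_le (hmem h) (hmem h') ht hp
    exact ⟨⟨Lp.aestronglyMeasurable _, hle.trans_lt (ENNReal.add_lt_top.2
      ⟨hY.2, ENNReal.mul_lt_top ENNReal.ofReal_lt_top hq'.2⟩)⟩, hle⟩
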